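/- **Setting.** Let $d\ge 3$ and $\gamma\in(1-d,1]$. Let $b:[-1,1]\to\mathbb R$ be measurable, non-negative, even and in $L^\infty([-1,1])$, and let $B(\sigma,u)=|u|^\gamma b(\hat u\cdot\sigma)$ with $\hat u=u/|u|$, for $\sigma\in\mathbb S^{d-1}$, $u\in\mathbb R^d$. Write $X_k=(x_1,\dots,x_k)$ and $V_k=(v_1,\dots,v_k)$ for points of $(\mathbb R^d)^k$. The Boltzmann hierarchy for $F=(f^{(k)})_{k\ge1}$ is $$\partial_t f^{(k)}+\sum_{i=1}^k v_i\cdot\nabla_{x_i}f^{(k)}=\mathcal C^{k+1}f^{(k+1)},\qquad \mathcal C^{k+1}=\sum_{j=1}^k(\mathcal C^+_{j,k+1}-\mathcal C^-_{j,k+1}),$$ $$\mathcal C^+_{j,k+1}g(X_k,V_k)=\int_{\mathbb R^d\times\mathbb S^{d-1}}B(\sigma,v_{k+1}-v_j)\,g(X_k,x_j,V_k^{*j},v_{k+1}^*)\,d\sigma\,dv_{k+1},$$ $$\mathcal C^-_{j,k+1}g(X_k,V_k)=\int_{\mathbb R^d\times\mathbb S^{d-1}}B(\sigma,v_{k+1}-v_j)\,g(X_k,x_j,V_k,v_{k+1})\,d\sigma\,dv_{k+1},$$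 where $v_j^*=\frac{v_j+v_{k+1}}2+\frac{|v_{k+1}-v_j|}2\sigma$, $v_{k+1}^*=\frac{v_j+v_{k+1}}2-\frac{|v_{k+1}-v_j|}2\sigma$, and $V_k^{*j}$ is $V_k$ with $v_j$ replaced by $v_j^*$. Let $T_k^sg(X_k,V_k)=g(X_k-sV_k,V_k)$. For $y\in\mathbb R^d$ let $\langle y\rangle=\sqrt{1+|y|^2}$, and for $Y_k\in(\mathbb R^d)^k$ let $\langle\langle Y_k\rangle\rangle=\prod_{i=1}^k\langle y_i\rangle$. For $p,q>1$, $\alpha,\beta>0$, $\mu\in\mathbb R$, let $X^k_{p,q,\alpha,\beta}$ be the space of measurable functions $g$ on $(\mathbb R^d)^k\times(\mathbb R^d)^k$ that are invariant under permutations of the $k$ particles and have finite norm $$\|g\|_{k,p,q,\alpha,\beta}=\sup_{X_k,V_k}\langle\langle\alpha X_k\rangle\rangle^p\langle\langle\beta V_k\rangle\rangle^q|g(X_k,V_k)|,$$ and let $\mathcal X^\infty_{p,q,\alpha,\beta,\mu}$ be the space of sequences $G=(g^{(k)})_{k\ge1}$, $g^{(k)}\in X^k_{p,q,\alpha,\beta}$,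 with $\sup_{k\ge1}e^{\mu k}\|g^{(k)}\|_{k,p,q,\alpha,\beta}<\infty$. (Functions are defined at every point and the supremum is over all points.) A mild $\mu$-solution on $[0,T]$ with data $F_0=(f_0^{(k)})_{k\ge1}\in\mathcal X^\infty_{p,q,\alpha,\beta,\mu}$ is a sequence $F$ of measurable functions $f^{(k)}:[0,T]\times(\mathbb R^d)^k\times(\mathbb R^d)^k\to\mathbb R$ such that $t\mapsto(T_k^{-t}f^{(k)}(t))_{k\ge1}$ belongs to $C([0,T],\mathcal X^\infty_{p,q,\alpha,\beta,\mu})$ and, at every point, $$T_k^{-t}f^{(k)}(t)=f_0^{(k)}+\int_0^tT_k^{-s}\mathcal C^{k+1}f^{(k+1)}(s)\,ds\qquad\text{for all }t\in[0,T],\ k\ge1.$$ **Theorem.** Let $d,\gamma,b$ be as above and $q>\max\{d-1+\gamma,d-1\}$. (0) There is a finite constant $U_q$, depending only on $d,\gamma,q$, such that, with $u=v_1-v$, $v^*=\frac{v+v_1}2+\frac{|u|}2\sigma$ and $v_1^*=\frac{v+v_1}2-\frac{|u|}2\sigma$, $$\sup_{v\in\mathbb R^d}\int_{\mathbb R^d\times\mathbb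 S^{d-1}}\frac{|u|^{\gamma-1}}{\sqrt{1-(\hat u\cdot\sigma)^2}}\,\frac{\langle v\rangle^q}{\langle v^*\rangle^q\langle v_1^*\rangle^q}\,d\sigma\,dv_1\le U_q.$$ Let $U_q$ be any such constant, let $T>0$, $p>1$, $\alpha,\beta>0$, and let $\mu\in\mathbb R$ satisfy $$e^\mu>4C_{p,q,\alpha,\beta},\qquad C_{p,q,\alpha,\beta}=\frac{8p}{\alpha(p-1)}\,U_q\,\max\{\beta^q,\beta^{-2q}\}\,\|b\|_{L^\infty}.$$ (1) For every $F_0\in\mathcal X^\infty_{p,q,\alpha,\beta,\mu}$, any two mild $\mu$-solutions on $[0,T]$ with data $F_0$ are equal. (2) In particular, the only mild $\mu$-solution on $[0,T]$ with zero data is $F=0$. -/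

import Mathlib

open MeasureTheory Set Filter Topology
open scoped ENNReal

noncomputable section

namespace BoltzmannHierarchy

/-- Physical (position or velocity) space `ℝ^d` with its Euclidean norm. -/
abbrev E (d : ℕ) : Type := EuclideanSpace ℝ (Fin d)

/-- The positions `X_k = (x_1, …, x_k)`, or the velocities `V_k`, of `k` particles. -/
abbrev Config (d k : ℕ) : Type := Fin k → E d

/-- Real-valued functions of `(X_k, V_k)`. -/
abbrev Density (d k : ℕ) : Type := Config d k → Config d k → ℝ

/-- Sequences `(g^(k))_k`. Only the entries with `k ≥ 1` are ever used. -/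
abbrev DensitySeq (d : ℕ) : Type := (k : ℕ) → Density d k

/-- Time-dependent sequences `(f^(k)(t))_k`. Only the entries with `k ≥ 1` are ever used. -/
abbrev TimeDensitySeq (d : ℕ) : Type := (k : ℕ) → ℝ → Density d k

variable {d : ℕ}

/-! ### Collisions and the collision operators -/

/-- The surface measure `dσ` of the unit sphere of `ℝ^d`. -/
def sphereMeasure (d : ℕ) : Measure (Metric.sphere (0 : E d) 1) :=
  (volume : Measure (E d)).toSphere

/-- `v^* = (v + v₁)/2 + (|v₁ - v|/2) σ`. -/
def vStar (v v₁ σ : E d) : E d := (1 / 2 : ℝ) • (v + v₁) + (‖v₁ - v‖ / 2) • σ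

/-- `v₁^* = (v + v₁)/2 - (|v₁ - v|/2) σ`. -/
def vStarOne (v v₁ σ : E d) : E d := (1 / 2 : ℝ) • (v + v₁) - (‖v₁ - v‖ / 2) • σ

/-- `û · σ` with `û = u / |u|`. -/
def cosAngle (σ u : E d) : ℝ := inner ℝ (‖u‖⁻¹ • u) σ

/-- The differential cross-section `B(σ, u) = |u|^γ b(û · σ)`. -/
def crossSection (γ : ℝ) (b : ℝ → ℝ) (σ u : E d) : ℝ := ‖u‖ ^ γ * b (cosAngle σ u)

/-- An admissible angular cross-section: (the restriction to `[-1, 1]` of) `b` is measurable and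
essentially bounded, non-negative and even. -/
structure IsAngularCrossSection (b : ℝ → ℝ) : Prop where
  memLp_top : MemLp b ∞ (volume.restrict (Icc (-1 : ℝ) 1))
  nonneg : ∀ z ∈ Icc (-1 : ℝ) 1, 0 ≤ b z
  even : ∀ z ∈ Icc (-1 : ℝ) 1, b (-z) = b z

/-- The norm of `b` in `L^∞([-1, 1])`. -/
def angularNorm (b : ℝ → ℝ) : ℝ := (eLpNorm b ∞ (volume.restrict (Icc (-1 : ℝ) 1))).toReal

/-- The gain operator `C_{j,k+1}^+`. -/
def gain (γ : ℝ) (b : ℝ → ℝ) {k : ℕ} (j : Fin k) (f : Density d (k + 1)) : Density d k :=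
  fun X V => ∫ z : E d × Metric.sphere (0 : E d) 1,
    crossSection γ b (z.2 : E d) (z.1 - V j) *
      f (Fin.snoc (α := fun _ => E d) X (X j))
        (Fin.snoc (α := fun _ => E d) (Function.update V j (vStar (V j) z.1 z.2))
          (vStarOne (V j) z.1 z.2))
    ∂((volume : Measure (E d)).prod (sphereMeasure d))

/-- The loss operator `C_{j,k+1}^-`. -/
def loss (γ : ℝ) (b : ℝ → ℝ) {k : ℕ} (j : Fin k) (f : Density d (k + 1)) : Density d k :=
  fun X V => ∫ z : E d × Metric.sphere (0 : E d) 1,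
    crossSection γ b (z.2 : E d) (z.1 - V j) *
      f (Fin.snoc (α := fun _ => E d) X (X j)) (Fin.snoc (α := fun _ => E d) V z.1)
    ∂((volume : Measure (E d)).prod (sphereMeasure d))

/-- The collision operator `C^{k+1} = ∑_j (C_{j,k+1}^+ - C_{j,k+1}^-)`. -/
def collision (γ : ℝ) (b : ℝ → ℝ) {k : ℕ} (f : Density d (k + 1)) : Density d k :=
  fun X V => ∑ j : Fin k, (gain γ b j f X V - loss γ b j f X V)

/-- The transport operator `T_k^s`. -/
def transport {k : ℕ} (s : ℝ) (g : Density d k) : Density d k := fun X V => g (X - s • V) V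

/-! ### The weighted spaces -/

/-- `⟨y⟩ = √(1 + |y|²)`. -/
def bracket (y : E d) : ℝ := Real.sqrt (1 + ‖y‖ ^ 2)

/-- `⟪Y_k⟫ = ∏_i ⟨y_i⟩`. -/
def bracketProd {k : ℕ} (Y : Config d k) : ℝ := ∏ i, bracket (Y i)

/-- The norm `sup_{X,V} ⟪αX⟫^p ⟪βV⟫^q |g(X,V)|`, as an extended non-negative number. -/
def densityNorm (p q α β : ℝ) {k : ℕ} (g : Density d k) : ℝ≥0∞ :=
  ⨆ (X : Config d k) (V : Config d k),
    ENNReal.ofReal (bracketProd (α • X) ^ p * bracketProd (β • V) ^ q * |g X V|)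

/-- Invariance under permutations of the `k` particles. -/
def IsSymmetric {k : ℕ} (g : Density d k) : Prop :=
  ∀ (π : Equiv.Perm (Fin k)) (X V : Config d k), g (X ∘ π) (V ∘ π) = g X V

/-- Membership in the space `X^k_{p,q,α,β}`. -/
structure MemSpace (p q α β : ℝ) {k : ℕ} (g : Density d k) : Prop where
  measurable : Measurable fun z : Config d k × Config d k => g z.1 z.2
  symmetric : IsSymmetric g
  norm_lt_top : densityNorm p q α β g < ∞

/-- The norm `sup_{k ≥ 1} e^{μk} ‖g^(k)‖_{k,p,q,α,β}`, as an extended non-negative number. -/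
def seqNorm (p q α β μ : ℝ) (G : DensitySeq d) : ℝ≥0∞ :=
  ⨆ (k : ℕ) (_ : 1 ≤ k), ENNReal.ofReal (Real.exp (μ * k)) * densityNorm p q α β (G k)

/-- Membership in the sequence space `X^∞_{p,q,α,β,μ}`. -/
structure MemSeqSpace (p q α β μ : ℝ) (G : DensitySeq d) : Prop where
  mem : ∀ k, 1 ≤ k → MemSpace p q α β (G k)
  norm_lt_top : seqNorm p q α β μ G < ∞

/-- Membership in `C([0,T], X^∞_{p,q,α,β,μ})`. -/
structure MemTimeSpace (p q α β μ T : ℝ) (G : ℝ → DensitySeq d) : Prop where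
  mem : ∀ t ∈ Icc (0 : ℝ) T, MemSeqSpace p q α β μ (G t)
  continuous : ∀ t₀ ∈ Icc (0 : ℝ) T,
    Tendsto (fun t => seqNorm p q α β μ (G t - G t₀)) (𝓝[Icc (0 : ℝ) T] t₀) (𝓝 0)

/-- `F` is a mild `μ`-solution of the Boltzmann hierarchy in `[0,T]` with initial data `F₀`. -/
structure IsMildSolution (γ : ℝ) (b : ℝ → ℝ) (p q α β μ T : ℝ)
    (F₀ : DensitySeq d) (F : TimeDensitySeq d) : Prop where
  initial_mem : MemSeqSpace p q α β μ F₀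
  measurable : ∀ k, 1 ≤ k →
    Measurable fun z : Icc (0 : ℝ) T × Config d k × Config d k => F k z.1 z.2.1 z.2.2
  transported_mem : MemTimeSpace p q α β μ T fun t k => transport (-t) (F k t)
  mild_eq : ∀ t ∈ Icc (0 : ℝ) T, ∀ k, 1 ≤ k → ∀ X V : Config d k,
    transport (-t) (F k t) X V =
      F₀ k X V + ∫ s in (0 : ℝ)..t, transport (-s) (collision γ b (F (k + 1) s)) X V

/-! ### The constants -/

/-- The supremum over `v` of
`∫ |u|^{γ-1} (1 - (û·σ)²)^{-1/2} ⟨v⟩^q ⟨v^*⟩^{-q} ⟨v₁^*⟩^{-q} dσ dv₁`, with `u = v₁ - v`. -/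
def velocitySup (d : ℕ) (γ q : ℝ) : ℝ≥0∞ :=
  ⨆ v : E d, ∫⁻ z : E d × Metric.sphere (0 : E d) 1,
    ENNReal.ofReal
      (‖z.1 - v‖ ^ (γ - 1) / Real.sqrt (1 - cosAngle (z.2 : E d) (z.1 - v) ^ 2) *
        (bracket v ^ q / (bracket (vStar v z.1 z.2) ^ q * bracket (vStarOne v z.1 z.2) ^ q)))
    ∂((volume : Measure (E d)).prod (sphereMeasure d))

/-- `C_{p,q,α,β} = 8p / (α(p-1)) · U_q · max{β^q, β^{-2q}} · ‖b‖_{L^∞}`. -/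
def hierarchyConst (p q α β U : ℝ) (b : ℝ → ℝ) : ℝ :=
  8 * p / (α * (p - 1)) * U * max (β ^ q) (β ^ (-2 * q)) * angularNorm b

end BoltzmannHierarchy

end

open MeasureTheory Set Filter Topology
open scoped ENNReal
noncomputable section
namespace BoltzmannHierarchy
variable {d : ℕ}

/-! Let `h` be the difference of two solutions and `w(x,v) = ⟨αx⟩^{-p}⟨βv⟩^{-q}`. Compactness of
`[0,T]` gives `|h^(k)(t)| ≤ M e^{-μk} ∏ w(x_i,v_i)` along free transport, and `h^(k)(t)` is
dominated by the time integral of the transported collision term of `h^(k+1)`. Plain iteration of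
this inequality would create factorially many terms. A moving weight avoids any counting.

Let `r_s(x,v)` be the gain plus loss rate of particles distributed by `w` (`collisionRate`), suppose
`∫ r_s ds ≤ C w`, and set `ψ_t = w + 4λ ∫ r_s ds` with `4λC ≤ 1`, so that `w ≤ ψ_t ≤ 2w`. If
`|h^(k+1)| ≤ c ∏ ψ`, the `j`-th collision term is at most `4c r(x_j,v_j) ∏_{i≠j} ψ(x_i,v_i)`; the 4
comes from `ψ ≤ 2w` on the colliding pair. Since `4λr = ∂_t ψ`, the Leibniz rule
(`prod_primitive_eq`) makes the sum over `j` equal to `c/λ` times the derivative of `∏ ψ`, whose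
time integral is at most `(c/λ) ∏ ψ_t`. Because `e^μ > 4C`, one can write `e^{-μ} = θλ` with `θ <
1`. Descending from `k+1` to `k` then gains the factor `θ`; repeating this forces `h = 0`
(`eq_zero_of_hierarchy_inequality`).

The rate bound is a dispersive estimate. The displacements `v^* - v` and `v₁^* - v` are orthogonal,
so two brackets moving with them have product at least `⟨x⟩` times a bracket growing linearly in
time. Integrating in time returns the weight at `x` and gains one power of the relative speed `|u|`,
at the cost of `1/√(1-(û·σ)²)`. What is left is the velocity integral `U_q`. For `γ = 1`, gain and
loss contribute `6p` and `2p` to the constant `8p`; the loss integral is also below `U_q`, by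
averaging over `v`. For `γ < 1`, interpolation with the trivial bound by the length `τ` of the time
interval gives a factor `τ^ε`; hence `C` is as small as desired on short intervals, and these cover
`[0,T]`.

Finiteness of `U_q` follows from the substitution `z = v^* - v` for fixed `σ`
(`lintegral_halfSum_le`): its Jacobian separates into a power of `|z|` and an angular factor
integrable on the sphere when `d ≥ 3`. -/

lemma bracket_pos (y : E d) : 0 < bracket y := Real.sqrt_pos.2 (by positivity)

lemma one_le_bracket (y : E d) : 1 ≤ bracket y := Real.one_le_sqrt.2 (by nlinarith [norm_nonneg y])

lemma bracket_sq (y : E d) : bracket y ^ 2 = 1 + ‖y‖ ^ 2 := Real.sq_sqrt (by positivity)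

lemma bracket_rpow (y : E d) (c : ℝ) : bracket y ^ c = (1 + ‖y‖ ^ 2) ^ (c / 2) := by
  rw [bracket, Real.sqrt_eq_rpow, ← Real.rpow_mul (by positivity)]
  congr 1; ring

lemma continuous_bracket : Continuous (bracket : E d → ℝ) := by
  unfold bracket; fun_prop

lemma measurable_bracket : Measurable (bracket : E d → ℝ) := continuous_bracket.measurable

lemma norm_le_bracket (y : E d) : ‖y‖ ≤ bracket y := by
  apply Real.le_sqrt_of_sq_le; linarith

lemma bracket_le_one_add_norm (y : E d) : bracket y ≤ 1 + ‖y‖ := sqrt_one_add_norm_sq_le y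

/-! ### Integrability of brackets and of singular kernels -/

lemma lintegral_bracket_rpow_lt_top {c : ℝ} (hc : (d : ℝ) < c) :
    ∫⁻ z : E d, ENNReal.ofReal (bracket z ^ (-c)) < ∞ := by
  have h := (integrable_rpow_neg_one_add_norm_sq (E := E d) (μ := volume) (r := c)
    (by simpa using hc)).lintegral_lt_top
  simpa only [bracket_rpow] using h

/-- The one-dimensional function `|t|^{-s} 1_{[-1,1]}`. -/
def cubeWeight (s t : ℝ) : ℝ := (Icc (-1 : ℝ) 1).indicator (fun t => |t| ^ (-s)) t

lemma integrable_cubeWeight {s : ℝ} (hs : s < 1) : Integrable (cubeWeight s) := by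
  unfold cubeWeight
  rw [integrable_indicator_iff measurableSet_Icc]
  have h1 : IntervalIntegrable (fun t : ℝ => |t| ^ (-s)) volume (-1) 1 := by
    have h0 : IntervalIntegrable (fun t : ℝ => |t| ^ (-s)) volume 0 1 := by
      refine (intervalIntegral.intervalIntegrable_rpow' (by linarith : -1 < -s)).congr ?_
      intro t ht
      rw [uIoc_of_le zero_le_one] at ht
      simp only [abs_of_pos ht.1]
    have h2 := (h0.comp_sub_left 0).symm
    simp only [zero_sub, abs_neg, sub_zero] at h2
    exact h2.trans h0
  rwa [intervalIntegrable_iff_integrableOn_Icc_of_le (by norm_num)] at h1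

lemma lintegral_cube_lt_top (s : Fin d → ℝ) (hs : ∀ i, s i < 1) :
    ∫⁻ y : E d, ENNReal.ofReal (∏ i, cubeWeight (s i) (y i)) < ∞ := by
  have h : Integrable (fun x : Fin d → ℝ => ∏ i, cubeWeight (s i) (x i)) :=
    Integrable.fintype_prod (fun i => integrable_cubeWeight (hs i))
  have h2 := ((PiLp.volume_preserving_ofLp (Fin d)).integrable_comp_emb
    (MeasurableEquiv.toLp 2 (Fin d → ℝ)).symm.measurableEmbedding).2 h
  exact h2.lintegral_lt_top

lemma ae_coord_ne_zero : ∀ᵐ y : E d, ∀ i, y i ≠ 0 := by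
  rw [ae_all_iff]
  intro i
  have h := ((Measure.quasiMeasurePreserving_eval (fun _ : Fin d => (volume : Measure ℝ)) i).comp
    (PiLp.volume_preserving_ofLp (Fin d)).quasiMeasurePreserving).ae
    (p := fun x : ℝ => x ≠ 0) (Measure.ae_ne volume 0)
  exact h

/-- Distributing the power equally over the coordinates, `‖z‖^{-a} ≤ ∏ |z_i|^{-a/d}`, reduces the
claim to a product of integrable one-variable powers. -/
lemma lintegral_ball_norm_rpow_lt_top {a : ℝ} (ha : 0 ≤ a) (had : a < d) :
    ∫⁻ z : E d, ENNReal.ofReal ((Metric.closedBall (0 : E d) 1).indicator (fun z => ‖z‖ ^ (-a)) z)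
      < ∞ := by
  have hd : (0 : ℝ) < d := ha.trans_lt had
  refine lt_of_le_of_lt (lintegral_mono_ae ?_)
    (lintegral_cube_lt_top (d := d) (fun _ => a / d) fun _ => (div_lt_one hd).2 had)
  filter_upwards [ae_coord_ne_zero (d := d)] with z hz
  apply ENNReal.ofReal_le_ofReal
  by_cases h : z ∈ Metric.closedBall (0 : E d) 1
  · rw [indicator_of_mem h]
    have h1 : ‖z‖ ≤ 1 := by simpa using h
    have h2 : ∀ i, |z i| ≤ ‖z‖ := fun i => by simpa using PiLp.norm_apply_le z i
    have h3 : ‖z‖ ^ (-a) = ∏ i : Fin d, ‖z‖ ^ (-(a / d)) := by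
      rw [Finset.prod_const, ← Real.rpow_natCast, ← Real.rpow_mul (norm_nonneg _)]
      congr 1; simp; field_simp
    rw [h3]
    apply Finset.prod_le_prod (fun i _ => by positivity)
    intro i _
    have h4 : z i ∈ Icc (-1 : ℝ) 1 := abs_le.1 ((h2 i).trans h1)
    rw [cubeWeight, indicator_of_mem h4]
    exact Real.rpow_le_rpow_of_nonpos (abs_pos.2 (hz i)) (h2 i) (by simp; positivity)
  · rw [indicator_of_notMem h]
    apply Finset.prod_nonneg
    intro i _
    exact indicator_nonneg (fun _ _ => by positivity) _

/-- Near `v` the bracket is at least 1 and the singularity is integrable since `a < d`. Away from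
`v`, the smaller of `‖z - v‖` and `bracket z` carries the whole exponent `a + c > d`. Every
resulting integral is translation invariant, hence the uniformity in `v`. -/
lemma exists_lintegral_norm_sub_mul_bracket_le {a c : ℝ} (ha : 0 ≤ a) (had : a < d) (hc : 0 ≤ c)
    (hac : d < a + c) : ∃ K < ∞, ∀ v : E d,
      ∫⁻ z : E d, ENNReal.ofReal (‖z - v‖ ^ (-a) * bracket z ^ (-c)) ≤ K := by
  set K1 := ∫⁻ z : E d, ENNReal.ofReal
    ((Metric.closedBall (0 : E d) 1).indicator (fun z => ‖z‖ ^ (-a)) z)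
  set K2 := ∫⁻ z : E d, ENNReal.ofReal (bracket z ^ (-(a + c)))
  have h1 : K1 < ∞ := lintegral_ball_norm_rpow_lt_top ha had
  have h2 : K2 < ∞ := lintegral_bracket_rpow_lt_top hac
  refine ⟨K1 + ENNReal.ofReal (2 ^ (a + c)) * K2 + K2, by finiteness, fun v => ?_⟩
  have hm1 : Measurable fun z : E d => ENNReal.ofReal
      ((Metric.closedBall (0 : E d) 1).indicator (fun z => ‖z‖ ^ (-a)) (z - v)) := by
    apply Measurable.ennreal_ofReal
    have : Measurable ((Metric.closedBall (0 : E d) 1).indicator fun z : E d => ‖z‖ ^ (-a)) :=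
      (measurable_norm.pow_const _).indicator Metric.isClosed_closedBall.measurableSet
    exact this.comp (measurable_id.sub_const v)
  have hm2 : Measurable fun z : E d => ENNReal.ofReal (bracket (z - v) ^ (-(a + c))) :=
    ((measurable_bracket.comp (measurable_id.sub_const v)).pow_const _).ennreal_ofReal
  calc ∫⁻ z : E d, ENNReal.ofReal (‖z - v‖ ^ (-a) * bracket z ^ (-c))
      ≤ ∫⁻ z : E d, (ENNReal.ofReal
          ((Metric.closedBall (0 : E d) 1).indicator (fun z => ‖z‖ ^ (-a)) (z - v))
          + ENNReal.ofReal (2 ^ (a + c)) * ENNReal.ofReal (bracket (z - v) ^ (-(a + c)))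
          + ENNReal.ofReal (bracket z ^ (-(a + c)))) := by
        refine lintegral_mono fun z => ?_
        have hb := one_le_bracket z
        have hb0 := bracket_pos z
        have hw0 := bracket_pos (z - v)
        rcases le_or_gt ‖z - v‖ 1 with h | h
        · refine le_trans ?_ (le_trans le_self_add le_self_add)
          rw [indicator_of_mem (by simpa using h)]
          apply ENNReal.ofReal_le_ofReal
          exact mul_le_of_le_one_right (by positivity)
            (Real.rpow_le_one_of_one_le_of_nonpos hb (by linarith))
        · have hx : 0 < ‖z - v‖ := by linarith
          rcases le_total ‖z - v‖ (bracket z) with h' | h'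
          · refine le_trans ?_ (le_trans le_add_self le_self_add)
            rw [← ENNReal.ofReal_mul (by positivity)]
            apply ENNReal.ofReal_le_ofReal
            calc ‖z - v‖ ^ (-a) * bracket z ^ (-c)
                ≤ ‖z - v‖ ^ (-a) * ‖z - v‖ ^ (-c) := by
                  gcongr ?_ * ?_
                  exact Real.rpow_le_rpow_of_nonpos hx h' (by linarith)
              _ = ‖z - v‖ ^ (-(a + c)) := by rw [← Real.rpow_add hx]; ring_nf
              _ ≤ (bracket (z - v) / 2) ^ (-(a + c)) := by
                  apply Real.rpow_le_rpow_of_nonpos (by positivity) _ (by linarith)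
                  have := bracket_le_one_add_norm (z - v)
                  linarith
              _ = 2 ^ (a + c) * bracket (z - v) ^ (-(a + c)) := by
                  rw [Real.div_rpow hw0.le (by norm_num), Real.rpow_neg zero_le_two (a + c)]
                  field_simp
          · refine le_trans ?_ le_add_self
            apply ENNReal.ofReal_le_ofReal
            calc ‖z - v‖ ^ (-a) * bracket z ^ (-c)
                ≤ bracket z ^ (-a) * bracket z ^ (-c) := by
                  gcongr ?_ * ?_
                  exact Real.rpow_le_rpow_of_nonpos hb0 h' (by linarith)
              _ = bracket z ^ (-(a + c)) := by rw [← Real.rpow_add hb0]; ring_nf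
    _ = _ := by
        rw [lintegral_add_left (by fun_prop), lintegral_add_left hm1, lintegral_const_mul _ hm2,
          lintegral_sub_right_eq_self (fun z : E d => ENNReal.ofReal
            ((Metric.closedBall (0 : E d) 1).indicator (fun z => ‖z‖ ^ (-a)) z)) v,
          lintegral_sub_right_eq_self (fun z : E d => ENNReal.ofReal (bracket z ^ (-(a + c)))) v]

/-! ### Null sets of collision angles -/

/-- All translates of `S` along `σ` have the same volume; averaging over `τ ∈ [0,1]` and exchanging
the integrals reduces to the lines. This avoids choosing coordinates adapted to `σ`. -/
lemma volume_eq_zero_of_forall_line {S : Set (E d)} (hS : MeasurableSet S) (σ : E d)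
    (h : ∀ᵐ y : E d, volume {τ : ℝ | y + τ • σ ∈ S} = 0) : volume S = 0 := by
  have hm : Measurable fun z : E d × ℝ => z.1 + z.2 • σ := by fun_prop
  have h1 : ∫⁻ τ in Icc (0 : ℝ) 1, ∫⁻ y : E d, S.indicator 1 (y + τ • σ) = volume S := by
    simp_rw [lintegral_add_right_eq_self (fun y : E d => S.indicator (1 : E d → ℝ≥0∞) y)]
    simp [lintegral_indicator_one hS]
  rw [← h1, lintegral_lintegral_swap, lintegral_eq_zero_iff']
  · filter_upwards [h] with y hy
    have : ∫⁻ τ : ℝ, S.indicator (1 : E d → ℝ≥0∞) (y + τ • σ) = 0 := by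
      have h2 : MeasurableSet {τ : ℝ | y + τ • σ ∈ S} :=
        (show Measurable fun τ : ℝ => y + τ • σ by fun_prop) hS
      rw [← hy, ← lintegral_indicator_one h2]
      rfl
    exact le_antisymm ((setLIntegral_le_lintegral _ _).trans this.le) zero_le
  · apply Measurable.aemeasurable
    apply Measurable.lintegral_prod_right'
      (f := fun z : E d × ℝ => S.indicator (1 : E d → ℝ≥0∞) (z.1 + z.2 • σ))
    exact (measurable_one.indicator hS).comp hm
  · apply Measurable.aemeasurable
    exact (measurable_one.indicator hS).comp (hm.comp measurable_swap)

/-- The cosine is a diffeomorphism from the line onto `(-1,1)`. Its inverse `κ ↦ cκ/√(1-κ²) - y` is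
differentiable and so preserves null sets. -/
lemma volume_line_cos_eq_zero {N : Set ℝ} (hN : volume N = 0) {c : ℝ} (hc : 0 < c) (y : ℝ) :
    volume {τ : ℝ | (y + τ) / Real.sqrt (c ^ 2 + (y + τ) ^ 2) ∈ N} = 0 := by
  have hdiff : DifferentiableOn ℝ (fun κ : ℝ => c * κ / Real.sqrt (1 - κ ^ 2) - y)
      (N ∩ Ioo (-1) 1) := by
    intro κ hκ
    have h1 : 0 < 1 - κ ^ 2 := by nlinarith [hκ.2.1, hκ.2.2]
    apply DifferentiableAt.differentiableWithinAt
    have h2 : DifferentiableAt ℝ (fun κ : ℝ => Real.sqrt (1 - κ ^ 2)) κ :=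
      DifferentiableAt.sqrt (by fun_prop) h1.ne'
    exact ((differentiableAt_id.const_mul c).div h2 (Real.sqrt_pos.2 h1).ne').sub_const y
  have h0 := addHaar_image_eq_zero_of_differentiableOn_of_addHaar_eq_zero volume hdiff
    (measure_mono_null inter_subset_left hN)
  refine measure_mono_null ?_ h0
  intro τ hτ
  set t := y + τ with ht
  have hp : 0 < c ^ 2 + t ^ 2 := by positivity
  have hs := Real.sqrt_pos.2 hp
  have hsq := Real.sq_sqrt hp.le
  set r := Real.sqrt (c ^ 2 + t ^ 2) with hr
  refine ⟨t / r, ⟨hτ, abs_lt.1 ?_⟩, ?_⟩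
  · rw [abs_div, abs_of_pos hs, div_lt_one hs]
    exact abs_lt_of_sq_lt_sq (by nlinarith) hs.le
  · have : 1 - (t / r) ^ 2 = (c / r) ^ 2 := by
      field_simp; linarith
    simp only [this]
    rw [Real.sqrt_sq (by positivity), ht]
    field_simp; ring

/-- On a line parallel to `σ` at distance `c > 0` from the axis, the cosine has the form of the
previous lemma. The axis, where `c = 0`, is a null set because `d ≥ 2`. -/
lemma volume_cosAngle_preimage_eq_zero (hd : 2 ≤ d) {N : Set ℝ} (hN : volume N = 0) {σ : E d}
    (hσ : ‖σ‖ = 1) : volume {u : E d | cosAngle σ u ∈ N} = 0 := by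
  have hmeas : Measurable fun u : E d => cosAngle σ u := by unfold cosAngle; fun_prop
  refine measure_mono_null (t := {u : E d | cosAngle σ u ∈ toMeasurable volume N})
    (fun u hu => subset_toMeasurable _ _ hu) ?_
  refine volume_eq_zero_of_forall_line (hmeas (measurableSet_toMeasurable _ _)) σ ?_
  have hsub : volume ((ℝ ∙ σ : Submodule ℝ (E d)) : Set (E d)) = 0 := by
    apply Measure.addHaar_submodule
    intro h
    have h1 := finrank_span_singleton (K := ℝ) (v := σ) (by rintro rfl; simp at hσ)
    rw [h, finrank_top] at h1
    simp at h1; omega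
  filter_upwards [compl_mem_ae_iff.2 hsub] with y hy
  have hc : 0 < ‖y‖ ^ 2 - (inner ℝ y σ) ^ 2 := by
    by_contra hcon
    apply hy
    have h2 : ‖y - (inner ℝ y σ : ℝ) • σ‖ ^ 2 = ‖y‖ ^ 2 - (inner ℝ y σ) ^ 2 := by
      rw [norm_sub_sq_real, inner_smul_right, norm_smul, hσ, Real.norm_eq_abs, mul_one, sq_abs]
      ring
    have h3 : y - (inner ℝ y σ : ℝ) • σ = 0 := by
      rw [← norm_eq_zero]; nlinarith [norm_nonneg (y - (inner ℝ y σ : ℝ) • σ)]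
    exact Submodule.mem_span_singleton.2 ⟨_, (sub_eq_zero.1 h3).symm⟩
  have h4 := volume_line_cos_eq_zero (N := toMeasurable volume N) (by rwa [measure_toMeasurable])
    (Real.sqrt_pos.2 hc) (inner ℝ y σ)
  convert h4 using 3 with τ
  funext τ
  congr 1
  have h5 : ‖y + τ • σ‖ ^ 2 = Real.sqrt (‖y‖ ^ 2 - (inner ℝ y σ) ^ 2) ^ 2
      + (inner ℝ y σ + τ) ^ 2 := by
    rw [norm_add_sq_real, inner_smul_right, norm_smul, hσ, Real.norm_eq_abs, mul_one, sq_abs,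
      Real.sq_sqrt hc.le]
    ring
  rw [← h5, Real.sqrt_sq (norm_nonneg _), cosAngle, real_inner_smul_left, inner_add_left,
    real_inner_smul_left, real_inner_self_eq_norm_sq, hσ]
  field_simp

/-! ### Integration over the sphere -/

/-- Polar coordinates on the unit ball: the factor `d` cancels `∫_0^1 r^{d-1} dr`. It turns
spherical integrals into Lebesgue integrals, which Cartesian product bounds can handle. -/
lemma lintegral_sphere_eq (hd : 1 ≤ d) {g : E d → ℝ≥0∞} (hg : Measurable g) :
    ∫⁻ σ : Metric.sphere (0 : E d) 1, g σ ∂(sphereMeasure d) =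
      d * ∫⁻ y in ({0}ᶜ : Set (E d)), (Metric.ball (0 : E d) 1).indicator
        (fun y => g (‖y‖⁻¹ • y)) y := by
  have : Nonempty (Fin d) := ⟨⟨0, hd⟩⟩
  have hd' : ((d - 1 : ℕ) : ℝ) + 1 = d := by
    rw [Nat.cast_sub hd]; simp
  have h1 := (volume : Measure (E d)).measurePreserving_homeomorphUnitSphereProd.lintegral_comp_emb
    (Homeomorph.measurableEmbedding _)
    (fun z => (Iio (⟨1, mem_Ioi.2 one_pos⟩ : Ioi (0 : ℝ))).indicator 1 z.2 * g z.1)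
  have hm : Measurable ((Iio (⟨1, mem_Ioi.2 one_pos⟩ : Ioi (0 : ℝ))).indicator
      (1 : Ioi (0 : ℝ) → ℝ≥0∞)) := measurable_one.indicator measurableSet_Iio
  have hm2 : Measurable fun z : Metric.sphere (0 : E d) 1 × Ioi (0 : ℝ) =>
      (Iio (⟨1, mem_Ioi.2 one_pos⟩ : Ioi (0 : ℝ))).indicator (1 : Ioi (0 : ℝ) → ℝ≥0∞) z.2 * g z.1 :=
    (hm.comp measurable_snd).mul (hg.comp (measurable_subtype_coe.comp measurable_fst))
  rw [lintegral_prod_symm _ hm2.aemeasurable] at h1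
  have h4 : ∀ y : Ioi (0 : ℝ), ∫⁻ σ : Metric.sphere (0 : E d) 1,
      (Iio (⟨1, mem_Ioi.2 one_pos⟩ : Ioi (0 : ℝ))).indicator (1 : Ioi (0 : ℝ) → ℝ≥0∞) y * g σ
        ∂(volume : Measure (E d)).toSphere =
      (Iio (⟨1, mem_Ioi.2 one_pos⟩ : Ioi (0 : ℝ))).indicator (1 : Ioi (0 : ℝ) → ℝ≥0∞) y *
        ∫⁻ σ : Metric.sphere (0 : E d) 1, g σ ∂(volume : Measure (E d)).toSphere :=
    fun y => lintegral_const_mul _ (hg.comp measurable_subtype_coe)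
  simp only [h4] at h1
  rw [lintegral_mul_const _ hm, lintegral_indicator_one measurableSet_Iio,
    Measure.volumeIoiPow_apply_Iio, finrank_euclideanSpace_fin] at h1
  have h2 : (d : ℝ≥0∞) * ENNReal.ofReal ((1 : ℝ) ^ (d - 1 + 1) / ((d - 1 : ℕ) + 1)) = 1 := by
    rw [hd', one_pow, ← ENNReal.ofReal_natCast, ← ENNReal.ofReal_mul (by positivity)]
    rw [mul_one_div_cancel (by positivity), ENNReal.ofReal_one]
  have h3 := congrArg (fun x => (d : ℝ≥0∞) * x) h1
  simp only [← mul_assoc, h2, one_mul] at h3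
  rw [sphereMeasure, ← h3, ← lintegral_subtype_comap (measurableSet_singleton _).compl]
  congr 1
  apply lintegral_congr
  intro y
  have hiff : (homeomorphUnitSphereProd (E d) y).2 ∈ Iio (⟨1, mem_Ioi.2 one_pos⟩ : Ioi (0 : ℝ)) ↔
      ‖(y : E d)‖ < 1 := by
    rw [mem_Iio, ← Subtype.coe_lt_coe]; simp
  by_cases h : ‖(y : E d)‖ < 1
  · rw [indicator_of_mem, indicator_of_mem]
    · simp
    · simpa using h
    · exact hiff.2 h
  · rw [indicator_of_notMem, indicator_of_notMem, zero_mul]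
    · simpa using h
    · exact fun h' => h (hiff.1 h')

/-- The Jacobian factor of the collision map, integrated over the sphere. -/
def angularWeight (n κ : ℝ) : ℝ := if 0 < κ then κ ^ (n - 3) / Real.sqrt (1 - κ ^ 2) else 0

lemma measurable_angularWeight (n : ℝ) : Measurable (angularWeight n) := by
  unfold angularWeight
  exact Measurable.ite (measurableSet_lt measurable_const measurable_id) (by fun_prop) (by fun_prop)

/-- With the pole on the first axis, `‖y‖² - y_0² ≥ y_1² + y_2² ≥ |y_1||y_2|`. The singularity at `κ
= 1` is thereby split into two inverse square roots, which needs three coordinates; the one at `κ =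
0` sits on `y_0`. -/
lemma angularWeight_le {n : ℝ} (hd : 3 ≤ d) {y : E d} (hy : ‖y‖ < 1) (hy0 : ∀ i, y i ≠ 0) :
    angularWeight n (y ⟨0, by omega⟩ / ‖y‖) ≤
      |y ⟨0, by omega⟩| ^ (-max (3 - n) 0) * (|y ⟨1, by omega⟩| ^ (-(1 / 2 : ℝ))
        * |y ⟨2, by omega⟩| ^ (-(1 / 2 : ℝ))) := by
  set a := y ⟨0, by omega⟩
  set b := y ⟨1, by omega⟩
  set c := y ⟨2, by omega⟩
  have ha : a ≠ 0 := hy0 _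
  have hb : b ≠ 0 := hy0 _
  have hc : c ≠ 0 := hy0 _
  have hsum : a ^ 2 + b ^ 2 + c ^ 2 ≤ ‖y‖ ^ 2 := by
    rw [EuclideanSpace.real_norm_sq_eq]
    have h := Finset.sum_le_sum_of_subset_of_nonneg (f := fun i => (y i) ^ 2)
      (Finset.subset_univ ({⟨0, by omega⟩, ⟨1, by omega⟩, ⟨2, by omega⟩} : Finset (Fin d)))
      (fun i _ _ => sq_nonneg _)
    rw [Finset.sum_insert (by simp), Finset.sum_insert (by simp), Finset.sum_singleton] at h
    linarith
  have ha2 : 0 < a ^ 2 := by positivity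
  have hb2 : 0 < b ^ 2 := by positivity
  have hc2 : 0 < c ^ 2 := by positivity
  have hyp : 0 < ‖y‖ := by
    by_contra h
    have : ‖y‖ = 0 := le_antisymm (not_lt.1 h) (norm_nonneg _)
    rw [this] at hsum; nlinarith
  unfold angularWeight
  split_ifs with h
  · have hapos : 0 < a := by rwa [div_pos_iff_of_pos_right hyp] at h
    rw [div_eq_mul_inv]
    have hκ1 : a / ‖y‖ ≤ 1 := by
      rw [div_le_one hyp]; exact le_of_sq_le_sq (by nlinarith) hyp.le
    have haκ : |a| ≤ a / ‖y‖ := by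
      rw [abs_of_pos hapos, le_div_iff₀ hyp]; nlinarith
    gcongr ?_ * ?_
    · calc (a / ‖y‖) ^ (n - 3) ≤ (a / ‖y‖) ^ (-max (3 - n) 0) := by
            apply Real.rpow_le_rpow_of_exponent_ge h hκ1
            have := le_max_left (3 - n) 0; linarith
        _ ≤ _ := by
            apply Real.rpow_le_rpow_of_nonpos (by positivity) haκ
            have := le_max_right (3 - n) 0; linarith
    · have h1 : |b| * |c| ≤ 1 - (a / ‖y‖) ^ 2 := by
        have : 1 - (a / ‖y‖) ^ 2 = (‖y‖ ^ 2 - a ^ 2) / ‖y‖ ^ 2 := by field_simp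
        rw [this, le_div_iff₀ (by positivity)]
        have h3 : |b| * |c| ≤ b ^ 2 + c ^ 2 := by
          nlinarith [sq_nonneg (|b| - |c|), sq_abs b, sq_abs c, abs_nonneg b, abs_nonneg c]
        have h4 : 0 ≤ |b| * |c| := by positivity
        have h5 : ‖y‖ ^ 2 ≤ 1 := by nlinarith
        nlinarith
      rw [← Real.mul_rpow (abs_nonneg _) (abs_nonneg _), Real.rpow_neg (by positivity),
        ← Real.sqrt_eq_rpow]
      gcongr
  · positivity

lemma exists_lintegral_angularWeight_le (hd : 3 ≤ d) {n : ℝ} (hn : 2 < n) :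
    ∃ K < ∞, ∀ e : E d, ‖e‖ = 1 →
      ∫⁻ σ : Metric.sphere (0 : E d) 1, ENNReal.ofReal (angularWeight n (inner ℝ e σ))
        ∂(sphereMeasure d) ≤ K := by
  -- The exponents of the coordinate-wise bound; `max (3 - n) 0 < 1` is exactly where `2 < n` is
  -- needed.
  let s : Fin d → ℝ := fun i => if (i : ℕ) = 0 then max (3 - n) 0 else
    if (i : ℕ) = 1 then 1 / 2 else if (i : ℕ) = 2 then 1 / 2 else 0
  have hs : ∀ i, s i < 1 := by
    intro i
    simp only [s]
    split_ifs
    · apply max_lt <;> linarith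
    all_goals norm_num
  refine ⟨d * ∫⁻ y : E d, ENNReal.ofReal (∏ i, cubeWeight (s i) (y i)),
    ENNReal.mul_lt_top (by simp) (lintegral_cube_lt_top s hs), fun e he => ?_⟩
  have hg : Measurable fun y : E d => ENNReal.ofReal (angularWeight n (inner ℝ e y)) :=
    ((measurable_angularWeight n).comp (by fun_prop)).ennreal_ofReal
  rw [lintegral_sphere_eq (by omega) hg]
  refine mul_le_mul' le_rfl ?_
  -- Completing `e` to an orthonormal basis rotates the pole onto the first axis, so the bound does
  -- not depend on `e`.
  have horth : Orthonormal ℝ (({⟨0, by omega⟩} : Set (Fin d)).domRestrict (fun _ => e)) := by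
    constructor
    · intro i; exact he
    · intro i j hij; exact absurd (Subsingleton.elim i j) hij
  obtain ⟨b, hb⟩ := horth.exists_orthonormalBasis_extension_of_card_eq (by simp)
  have hb0 : b ⟨0, by omega⟩ = e := hb _ (mem_singleton _)
  refine (setLIntegral_le_lintegral _ _).trans ?_
  have hmp := b.measurePreserving_repr_symm
  rw [← hmp.lintegral_comp_emb b.repr.symm.toHomeomorph.measurableEmbedding]
  refine lintegral_mono_ae ?_
  filter_upwards [ae_coord_ne_zero (d := d)] with y hy
  by_cases h : ‖y‖ < 1
  · rw [indicator_of_mem (by simpa using h)]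
    apply ENNReal.ofReal_le_ofReal
    have h1 : inner ℝ e (‖b.repr.symm y‖⁻¹ • b.repr.symm y) = y ⟨0, by omega⟩ / ‖y‖ := by
      rw [← hb0, inner_smul_right, ← b.repr_apply_apply]
      simp [div_eq_inv_mul]
    rw [h1]
    refine (angularWeight_le hd h hy).trans (le_of_eq ?_)
    have h2 : ∀ i, |y i| ≤ 1 := fun i => le_trans (by simpa using PiLp.norm_apply_le y i) h.le
    have h3 : ∀ i, cubeWeight (s i) (y i) = |y i| ^ (-(s i)) := by
      intro i
      have h4 : y i ∈ Icc (-1 : ℝ) 1 := abs_le.1 (h2 i)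
      rw [cubeWeight, indicator_of_mem h4]
    simp_rw [h3]
    rw [← Finset.prod_subset
      (Finset.subset_univ ({⟨0, by omega⟩, ⟨1, by omega⟩, ⟨2, by omega⟩} : Finset (Fin d)))]
    · rw [Finset.prod_insert (by simp), Finset.prod_insert (by simp), Finset.prod_singleton]
      simp [s]
    · intro i _ hi
      simp only [Finset.mem_insert, Finset.mem_singleton, not_or, Fin.ext_iff] at hi
      simp [s, hi.1, hi.2.1, hi.2.2]
  · rw [indicator_of_notMem (by simpa using h)]
    exact zero_le

/-! ### The change of variables from relative velocity to displacement -/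

/-- The displacement `v^* - v` as a function of the relative velocity `u` and of `σ`. -/
def halfSum (σ u : E d) : E d := (1 / 2 : ℝ) • (u + ‖u‖ • σ)

lemma norm_halfSum_sq {σ : E d} (hσ : ‖σ‖ = 1) (u : E d) :
    ‖halfSum σ u‖ ^ 2 = ‖u‖ * (‖u‖ + inner ℝ u σ) / 2 := by
  rw [halfSum, norm_smul, mul_pow, norm_add_sq_real, inner_smul_right, norm_smul, hσ]
  norm_num
  ring

lemma inner_halfSum {σ : E d} (hσ : ‖σ‖ = 1) (u : E d) :
    inner ℝ (halfSum σ u) σ = (‖u‖ + inner ℝ u σ) / 2 := by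
  rw [halfSum, real_inner_smul_left, inner_add_left, real_inner_smul_left,
    real_inner_self_eq_norm_sq, hσ]
  ring

/-- The quotient of `‖halfSum σ u‖²` by its component along `σ` is `‖u‖`; once `‖u‖` is known, `u`
is determined. -/
lemma injOn_halfSum {σ : E d} (hσ : ‖σ‖ = 1) :
    InjOn (halfSum σ) {u : E d | 0 < ‖u‖ + inner ℝ u σ} := by
  intro u hu u' hu' h
  have h1 := norm_halfSum_sq hσ u
  have h2 := inner_halfSum hσ u
  rw [h, norm_halfSum_sq hσ u'] at h1
  rw [h, inner_halfSum hσ u'] at h2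
  have h3 : ‖u‖ = ‖u'‖ := by
    have h4 : ‖u'‖ + inner ℝ u' σ = ‖u‖ + inner ℝ u σ := by linarith
    rw [h4] at h1
    exact (mul_right_cancel₀ (ne_of_gt hu) (by linarith)).symm
  unfold halfSum at h
  rw [h3] at h
  simpa using h

/-- The derivative of `halfSum`. -/
def halfSumDeriv (σ u : E d) : E d →L[ℝ] E d :=
  (1 / 2 : ℝ) • (ContinuousLinearMap.id ℝ (E d) +
    (innerSL ℝ (‖u‖⁻¹ • u)).smulRight σ)

lemma hasFDerivAt_halfSum (σ : E d) {u : E d} (hu : u ≠ 0) :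
    HasFDerivAt (halfSum σ) (halfSumDeriv σ u) u := by
  have h1 : HasFDerivAt (fun u : E d => ‖u‖) (innerSL ℝ (‖u‖⁻¹ • u)) u := by
    have h2 := ((hasStrictFDerivAt_norm_sq u).hasFDerivAt).sqrt (by positivity)
    simp only [Real.sqrt_sq (norm_nonneg _)] at h2
    refine h2.congr_fderiv (ContinuousLinearMap.ext fun w => ?_)
    simp only [one_div, mul_inv_rev, smul_apply, innerSL_apply_apply, smul_eq_mul, nsmul_eq_mul,
      real_inner_smul_left]
    push_cast
    ring
  exact ((hasFDerivAt_id u).add (h1.smul_const σ)).const_smul (1 / 2 : ℝ)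

/-- The derivative is half of a rank-one perturbation of the identity, i.e. of a transvection. -/
lemma det_halfSumDeriv (σ u : E d) :
    (halfSumDeriv σ u).det = (1 / 2 : ℝ) ^ d * (1 + cosAngle σ u) := by
  have h : ((halfSumDeriv σ u : E d →L[ℝ] E d) : E d →ₗ[ℝ] E d) =
      (1 / 2 : ℝ) • LinearMap.transvection
        ((innerSL ℝ (‖u‖⁻¹ • u) : E d →L[ℝ] ℝ) : E d →ₗ[ℝ] ℝ) σ := by
    ext w : 1
    simp [halfSumDeriv, LinearMap.transvection]
  rw [ContinuousLinearMap.det, h, LinearMap.det_smul, LinearMap.transvection.det]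
  simp [cosAngle, real_inner_smul_left]

lemma cosAngle_eq (σ u : E d) : cosAngle σ u = inner ℝ u σ / ‖u‖ := by
  rw [cosAngle, real_inner_smul_left]; ring

lemma abs_cosAngle_le {σ : E d} (hσ : ‖σ‖ = 1) (u : E d) : |cosAngle σ u| ≤ 1 := by
  rw [cosAngle_eq, abs_div, abs_norm]
  apply div_le_one_of_le₀ _ (norm_nonneg _)
  simpa [hσ] using abs_real_inner_le_norm u σ

lemma cosAngle_sq_le {σ : E d} (hσ : ‖σ‖ = 1) (u : E d) : cosAngle σ u ^ 2 ≤ 1 := by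
  have := abs_cosAngle_le hσ u
  rw [← sq_abs]; exact pow_le_one₀ (abs_nonneg _) this

/-- Half-angle formulas: if `c` and `κ` are the cosines of the angles of `u` and `z` with `σ`, then
`2κ² = 1 + c`, `‖z‖ = κ‖u‖` and `√(1-c²) = 2κ√(1-κ²)`. -/
lemma angular_jacobian {n : ℝ} {σ u : E d} (hσ : ‖σ‖ = 1) (hu : 0 < ‖u‖ + inner ℝ u σ) :
    ‖u‖ ^ (-n) / Real.sqrt (1 - cosAngle σ u ^ 2) =
      (1 / 2 : ℝ) ^ d * (1 + cosAngle σ u) * (2 ^ ((d : ℝ) - 2) * ‖halfSum σ u‖ ^ (-n) *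
        angularWeight n (cosAngle σ (halfSum σ u))) := by
  have hupos : 0 < ‖u‖ := by
    by_contra h
    have h1 : ‖u‖ = 0 := le_antisymm (not_lt.1 h) (norm_nonneg _)
    rw [norm_eq_zero.1 h1] at hu
    simp at hu
  set z := halfSum σ u with hz
  set c := cosAngle σ u with hc
  set κ := cosAngle σ z with hκ
  have hin : inner ℝ u σ = c * ‖u‖ := by rw [hc, cosAngle_eq]; field_simp
  have hz2 : ‖z‖ ^ 2 = ‖u‖ * (‖u‖ + inner ℝ u σ) / 2 := norm_halfSum_sq hσ u
  have hzpos : 0 < ‖z‖ := by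
    have : 0 < ‖z‖ ^ 2 := by rw [hz2]; positivity
    exact lt_of_le_of_ne (norm_nonneg _) fun h => by rw [← h] at this; norm_num at this
  have hκ1 : κ = (‖u‖ + inner ℝ u σ) / 2 / ‖z‖ := by rw [hκ, cosAngle_eq, hz, inner_halfSum hσ]
  have hκpos : 0 < κ := by rw [hκ1]; positivity
  have hκz : κ * ‖u‖ = ‖z‖ := by
    rw [hκ1]; field_simp; rw [hz2]; ring
  have hκc : 2 * κ ^ 2 = 1 + c := by
    have h1 : ‖u‖ ^ 2 * (2 * κ ^ 2) = ‖u‖ ^ 2 * (1 + c) := by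
      have : ‖u‖ ^ 2 * (2 * κ ^ 2) = 2 * (κ * ‖u‖) ^ 2 := by ring
      rw [this, hκz, hz2, hin]; ring
    exact mul_left_cancel₀ (by positivity) h1
  have hsin : Real.sqrt (1 - c ^ 2) = 2 * κ * Real.sqrt (1 - κ ^ 2) := by
    have : 1 - c ^ 2 = (2 * κ) ^ 2 * (1 - κ ^ 2) := by
      have : c = 2 * κ ^ 2 - 1 := by linarith
      rw [this]; ring
    rw [this, Real.sqrt_mul (by positivity), Real.sqrt_sq (by positivity)]
  have hpow : (1 / 2 : ℝ) ^ d * 2 ^ ((d : ℝ) - 2) = 1 / 4 := by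
    rw [Real.rpow_sub two_pos, Real.rpow_natCast, one_div_pow]
    have : (2 : ℝ) ^ (2 : ℝ) = 4 := by norm_num
    rw [this]; field_simp
  have hu' : ‖u‖ = ‖z‖ / κ := by field_simp; linarith
  rw [angularWeight, if_pos hκpos, hsin, ← hκc, hu', Real.div_rpow hzpos.le hκpos.le,
    Real.rpow_neg hκpos.le, Real.rpow_sub hκpos]
  have h3 : κ ^ (3 : ℝ) = κ ^ 3 := by exact_mod_cast Real.rpow_natCast κ 3
  rw [h3]
  calc _ = ‖z‖ ^ (-n) * κ ^ n * (2 * κ)⁻¹ * (Real.sqrt (1 - κ ^ 2))⁻¹ := by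
        rw [div_inv_eq_mul, div_eq_mul_inv, mul_inv]; ring
    _ = ((1 / 2 : ℝ) ^ d * 2 ^ ((d : ℝ) - 2)) * (2 * κ ^ 2) * ‖z‖ ^ (-n) * (κ ^ n / κ ^ 3)
        * (Real.sqrt (1 - κ ^ 2))⁻¹ := by
        rw [hpow]; field_simp; ring
    _ = _ := by ring

lemma lintegral_halfSum_le {n : ℝ} (hn : n ≠ 0) {σ : E d} (hσ : ‖σ‖ = 1) (Φ : E d → ℝ≥0∞) :
    ∫⁻ u : E d, ENNReal.ofReal (‖u‖ ^ (-n) / Real.sqrt (1 - cosAngle σ u ^ 2)) * Φ (halfSum σ u)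
      ≤ ∫⁻ z : E d, ENNReal.ofReal (2 ^ ((d : ℝ) - 2) * ‖z‖ ^ (-n) *
          angularWeight n (cosAngle σ z)) * Φ z := by
  set S : Set (E d) := {u : E d | 0 < ‖u‖ + inner ℝ u σ} with hS
  have hSo : MeasurableSet S := measurableSet_lt measurable_const (by fun_prop)
  have hne : ∀ u ∈ S, u ≠ 0 := by
    rintro u hu rfl
    simp [hS] at hu
  have h1 := lintegral_image_eq_lintegral_abs_det_fderiv_mul volume hSo
    (fun u hu => (hasFDerivAt_halfSum σ (hne u hu)).hasFDerivWithinAt) (injOn_halfSum hσ)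
    (fun z => ENNReal.ofReal (2 ^ ((d : ℝ) - 2) * ‖z‖ ^ (-n) *
          angularWeight n (cosAngle σ z)) * Φ z)
  refine le_trans (le_of_eq ?_) (h1.symm.le.trans (setLIntegral_le_lintegral _ _))
  rw [← lintegral_indicator hSo]
  apply lintegral_congr
  intro u
  by_cases hu : u ∈ S
  · rw [indicator_of_mem hu, det_halfSumDeriv, angular_jacobian hσ hu, ← mul_assoc (ENNReal.ofReal _),
      ← ENNReal.ofReal_mul (abs_nonneg _)]
    congr 3
    rw [abs_of_nonneg]
    have := (abs_le.1 (abs_cosAngle_le hσ u)).1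
    have h2 : 0 ≤ 1 + cosAngle σ u := by linarith
    positivity
  · rw [indicator_of_notMem hu]
    -- Outside `S` either `u = 0` or the cosine is `-1`. In both cases the integrand is 0 by the
    -- conventions for `0 ^ (-n)` and division by zero, so nothing is lost.
    have h0 : ‖u‖ ^ (-n) / Real.sqrt (1 - cosAngle σ u ^ 2) = 0 := by
      rcases eq_or_ne u 0 with rfl | h0
      · rw [norm_zero, Real.zero_rpow (by simpa using hn), zero_div]
      · have hupos : 0 < ‖u‖ := norm_pos_iff.2 h0
        have h2 : cosAngle σ u ≤ -1 := by
          rw [cosAngle_eq, div_le_iff₀ hupos]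
          have : ¬ (0 < ‖u‖ + inner ℝ u σ) := hu
          linarith
        have h3 := (abs_le.1 (abs_cosAngle_le hσ u)).1
        have h4 : cosAngle σ u = -1 := le_antisymm h2 h3
        rw [h4]; simp
    rw [h0]; simp

/-! ### Post-collisional velocities -/

lemma vStar_eq (v v₁ σ : E d) : vStar v v₁ σ = v + halfSum σ (v₁ - v) := by
  rw [vStar, halfSum]
  module

lemma vStarOne_eq (v v₁ σ : E d) : vStarOne v v₁ σ = v + halfSum (-σ) (v₁ - v) := by
  rw [← vStar_eq, vStarOne, vStar, smul_neg, sub_eq_add_neg]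

lemma cosAngle_neg (σ u : E d) : cosAngle (-σ) u = -cosAngle σ u := by
  simp [cosAngle]

@[fun_prop]
lemma measurable_cosAngle {β : Type*} [MeasurableSpace β] {f g : β → E d} (hf : Measurable f)
    (hg : Measurable g) : Measurable fun x => cosAngle (f x) (g x) := by
  unfold cosAngle; fun_prop

@[fun_prop]
lemma measurable_vStar {β : Type*} [MeasurableSpace β] {f g h : β → E d} (hf : Measurable f)
    (hg : Measurable g) (hh : Measurable h) : Measurable fun x => vStar (f x) (g x) (h x) := by
  unfold vStar; fun_prop

@[fun_prop]
lemma measurable_vStarOne {β : Type*} [MeasurableSpace β] {f g h : β → E d} (hf : Measurable f)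
    (hg : Measurable g) (hh : Measurable h) : Measurable fun x => vStarOne (f x) (g x) (h x) := by
  unfold vStarOne; fun_prop

@[fun_prop]
lemma measurable_bracket_comp {β : Type*} [MeasurableSpace β] {f : β → E d} (hf : Measurable f) :
    Measurable fun x => bracket (f x) := measurable_bracket.comp hf

@[fun_prop]
lemma measurable_halfSum {β : Type*} [MeasurableSpace β] {f g : β → E d} (hf : Measurable f)
    (hg : Measurable g) : Measurable fun x => halfSum (f x) (g x) := by
  unfold halfSum; fun_prop

lemma energy_conservation {σ : E d} (hσ : ‖σ‖ = 1) (v v₁ : E d) :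
    ‖vStar v v₁ σ‖ ^ 2 + ‖vStarOne v v₁ σ‖ ^ 2 = ‖v‖ ^ 2 + ‖v₁‖ ^ 2 := by
  rw [vStar, vStarOne, norm_add_sq_real, norm_sub_sq_real, norm_smul, norm_smul, hσ, mul_pow,
    norm_add_sq_real, mul_pow]
  simp only [Real.norm_eq_abs, sq_abs]
  have h := norm_sub_sq_real v₁ v
  rw [real_inner_comm] at h
  linear_combination h / 2

lemma norm_vStar_sub_vStarOne {σ : E d} (hσ : ‖σ‖ = 1) (v v₁ : E d) :
    ‖vStar v v₁ σ - vStarOne v v₁ σ‖ = ‖v₁ - v‖ := by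
  have : vStar v v₁ σ - vStarOne v v₁ σ = ‖v₁ - v‖ • σ := by
    rw [vStar, vStarOne, add_sub_sub_cancel, ← add_smul]; ring_nf
  rw [this, norm_smul, hσ]; simp

/-- The larger outgoing bracket `b` dominates both the incoming one and the relative speed up to a
factor 2, so `c^{q-m} r^m ≤ (2b)^q` cancels `b^q`. The power `r^m` is absorbed here so that it can
be taken out of the kernel as `‖u‖^{-m}`. -/
lemma bracket_ratio_le_aux {m q a b c r : ℝ} (hm : 0 ≤ m) (hmq : m ≤ q) (ha : 0 < a) (hb : 0 < b)
    (hc : 0 < c) (hr : 0 ≤ r) (hab : a ≤ b) (h1 : c ^ 2 ≤ a ^ 2 + b ^ 2)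
    (h2 : r ≤ a + b) :
    c ^ q / (a ^ q * b ^ q) * r ^ m ≤ 2 ^ q * c ^ m * a ^ (-q) := by
  have hcb : c ≤ 2 * b := le_of_sq_le_sq (by nlinarith) (by positivity)
  have hrb : r ≤ 2 * b := by linarith
  have h3 : c ^ q * r ^ m ≤ 2 ^ q * c ^ m * b ^ q := by
    calc c ^ q * r ^ m = c ^ m * c ^ (q - m) * r ^ m := by
          rw [← Real.rpow_add hc]; ring_nf
      _ ≤ c ^ m * (2 * b) ^ (q - m) * (2 * b) ^ m := by
          gcongr
      _ = c ^ m * (2 * b) ^ q := by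
          rw [mul_assoc, ← Real.rpow_add (by positivity)]; ring_nf
      _ = _ := by rw [Real.mul_rpow zero_le_two hb.le]; ring
  rw [Real.rpow_neg ha.le]
  have haq : 0 < a ^ q := by positivity
  have hbq : 0 < b ^ q := by positivity
  rw [div_mul_eq_mul_div, div_le_iff₀ (by positivity)]
  calc _ ≤ _ := h3
    _ = _ := by field_simp

lemma bracket_ratio_le {m q : ℝ} (hm : 0 ≤ m) (hmq : m ≤ q) {σ : E d} (hσ : ‖σ‖ = 1)
    (v v₁ : E d) :
    bracket v ^ q / (bracket (vStar v v₁ σ) ^ q * bracket (vStarOne v v₁ σ) ^ q) * ‖v₁ - v‖ ^ m ≤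
      2 ^ q * bracket v ^ m * (bracket (vStar v v₁ σ) ^ (-q) + bracket (vStarOne v v₁ σ) ^ (-q)) := by
  set x := vStar v v₁ σ with hx
  set y := vStarOne v v₁ σ with hy
  have hxp := bracket_pos x
  have hyp := bracket_pos y
  have hvp := bracket_pos v
  have h1 : bracket v ^ 2 ≤ bracket x ^ 2 + bracket y ^ 2 := by
    have := energy_conservation hσ v v₁
    rw [← hx, ← hy] at this
    simp only [bracket_sq]; nlinarith [sq_nonneg ‖v₁‖]
  have h2 : ‖v₁ - v‖ ≤ bracket x + bracket y := by
    rw [← norm_vStar_sub_vStarOne hσ]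
    exact (norm_sub_le _ _).trans (add_le_add (norm_le_bracket x) (norm_le_bracket y))
  rw [mul_add]
  rcases le_total (bracket x) (bracket y) with h | h
  · refine (bracket_ratio_le_aux hm hmq hxp hyp hvp (norm_nonneg _) h h1 h2).trans ?_
    exact le_add_of_nonneg_right (by positivity)
  · rw [mul_comm (bracket x ^ q)]
    refine (bracket_ratio_le_aux hm hmq hyp hxp hvp (norm_nonneg _) h (by linarith)
      (by linarith)).trans ?_
    exact le_add_of_nonneg_left (by positivity)

/-! ### Finiteness of the velocity integral -/

/-- The growth of `⟨v⟩^m` is shared by `⟨v⟩ ≤ ⟨v+z⟩ + ‖z‖`: it lowers either the decay `q` or the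
singularity `n` by `m`, and both resulting kernels have total exponent `n + q - m > d`. -/
lemma exists_lintegral_norm_mul_bracket_mul_le {m n q : ℝ} (hm : 0 ≤ m) (hmn : m ≤ n)
    (hnd : n < d) (hmq : m ≤ q) (h : d < n + q - m) :
    ∃ K < ∞, ∀ v : E d,
      ∫⁻ z : E d, ENNReal.ofReal (‖z‖ ^ (-n) * (bracket v ^ m * bracket (v + z) ^ (-q))) ≤ K := by
  obtain ⟨K1, hK1, h1⟩ := exists_lintegral_norm_sub_mul_bracket_le (d := d) (a := n) (c := q - m)
    (hm.trans hmn) hnd (by linarith) (by linarith)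
  obtain ⟨K2, hK2, h2⟩ := exists_lintegral_norm_sub_mul_bracket_le (d := d) (a := n - m) (c := q)
    (by linarith) (by linarith) (by linarith) (by linarith)
  refine ⟨ENNReal.ofReal (2 ^ m) * (K1 + K2), by finiteness, fun v => ?_⟩
  rw [← lintegral_sub_right_eq_self _ v]
  calc _ ≤ ∫⁻ z : E d, ENNReal.ofReal (2 ^ m) *
        (ENNReal.ofReal (‖z - v‖ ^ (-n) * bracket z ^ (-(q - m))) +
          ENNReal.ofReal (‖z - v‖ ^ (-(n - m)) * bracket z ^ (-q))) := by
        refine lintegral_mono fun z => ?_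
        simp only [add_sub_cancel]
        have hv := bracket_pos v
        have hz := bracket_pos z
        have hle : bracket v ≤ bracket z + ‖z - v‖ := by
          apply le_of_sq_le_sq _ (by positivity)
          have h3 : ‖v‖ ≤ ‖z‖ + ‖z - v‖ := by
            have := norm_sub_norm_le v z
            rw [norm_sub_rev] at this
            linarith
          have h4 := norm_le_bracket z
          have h5 := bracket_sq z
          have h6 := bracket_sq v
          nlinarith [norm_nonneg (z - v), norm_nonneg v]
        have h3 : bracket v ^ m ≤ 2 ^ m * (bracket z ^ m + ‖z - v‖ ^ m) := by
          rcases le_total (bracket z) ‖z - v‖ with h | h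
          · calc bracket v ^ m ≤ (2 * ‖z - v‖) ^ m := by gcongr; linarith
              _ = 2 ^ m * ‖z - v‖ ^ m := Real.mul_rpow zero_le_two (norm_nonneg _)
              _ ≤ _ := by gcongr; exact le_add_of_nonneg_left (by positivity)
          · calc bracket v ^ m ≤ (2 * bracket z) ^ m := by gcongr; linarith
              _ = 2 ^ m * bracket z ^ m := Real.mul_rpow zero_le_two hz.le
              _ ≤ _ := by gcongr; exact le_add_of_nonneg_right (by positivity)
        rw [← ENNReal.ofReal_add (by positivity) (by positivity),
          ← ENNReal.ofReal_mul (by positivity)]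
        apply ENNReal.ofReal_le_ofReal
        have h4 : ‖z - v‖ ^ (-n) * ‖z - v‖ ^ m ≤ ‖z - v‖ ^ (-(n - m)) := by
          rcases eq_or_lt_of_le (norm_nonneg (z - v)) with h0 | h0
          · rw [← h0]
            rcases eq_or_ne n 0 with rfl | hn
            · have : m = 0 := le_antisymm hmn hm
              subst this; simp
            · rw [Real.zero_rpow (neg_ne_zero.2 hn), zero_mul]; positivity
          · rw [← Real.rpow_add h0]; apply le_of_eq; ring_nf
        have h5 : bracket z ^ m * bracket z ^ (-q) = bracket z ^ (-(q - m)) := by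
          rw [← Real.rpow_add hz]; ring_nf
        calc ‖z - v‖ ^ (-n) * (bracket v ^ m * bracket z ^ (-q))
            ≤ ‖z - v‖ ^ (-n) * (2 ^ m * (bracket z ^ m + ‖z - v‖ ^ m) * bracket z ^ (-q)) := by
              gcongr
          _ = 2 ^ m * (‖z - v‖ ^ (-n) * (bracket z ^ m * bracket z ^ (-q)) +
              ‖z - v‖ ^ (-n) * ‖z - v‖ ^ m * bracket z ^ (-q)) := by ring
          _ ≤ _ := by rw [h5]; gcongr
    _ ≤ _ := by
        rw [lintegral_const_mul _ (by fun_prop), lintegral_add_left (by fun_prop)]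
        gcongr
        · exact h1 v
        · exact h2 v

/-- After the change of variables for fixed `σ`, exchanging the integrals separates an angular
integral, bounded uniformly in the direction of `z`, from a kernel in `z`. The signs `ε = 1` and `ε
= -1` serve `v^*` and `v₁^*`. -/
lemma exists_lintegral_collision_le (hd : 3 ≤ d) {m n q : ℝ} (hm : 0 ≤ m) (hmn : m ≤ n)
    (hn : 2 < n) (hnd : n < d) (hmq : m ≤ q) (h : d < n + q - m) :
    ∃ K < ∞, ∀ (ε : ℝ) (v : E d), |ε| = 1 →
      ∫⁻ σ : Metric.sphere (0 : E d) 1, (∫⁻ u : E d,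
        ENNReal.ofReal (‖u‖ ^ (-n) / Real.sqrt (1 - cosAngle (ε • (σ : E d)) u ^ 2)) *
          ENNReal.ofReal (bracket v ^ m * bracket (v + halfSum (ε • (σ : E d)) u) ^ (-q)))
        ∂(sphereMeasure d) ≤ K := by
  obtain ⟨K1, hK1, h1⟩ := exists_lintegral_angularWeight_le hd hn
  obtain ⟨K2, hK2, h2⟩ := exists_lintegral_norm_mul_bracket_mul_le (d := d) hm hmn hnd hmq h
  have haw := measurable_angularWeight n
  have : SFinite (sphereMeasure d) := by unfold sphereMeasure; infer_instance
  refine ⟨ENNReal.ofReal (2 ^ ((d : ℝ) - 2)) * (K1 * K2), ENNReal.mul_lt_top ENNReal.ofReal_lt_top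
    (ENNReal.mul_lt_top hK1 hK2), fun ε v hε => ?_⟩
  have hεn : ∀ x : E d, ‖ε • x‖ = ‖x‖ := fun x => by
    rw [norm_smul, Real.norm_eq_abs, hε, one_mul]
  calc _ ≤ ∫⁻ σ : Metric.sphere (0 : E d) 1, (∫⁻ z : E d,
          ENNReal.ofReal (2 ^ ((d : ℝ) - 2) * ‖z‖ ^ (-n) *
            angularWeight n (cosAngle (ε • (σ : E d)) z)) *
          ENNReal.ofReal (bracket v ^ m * bracket (v + z) ^ (-q))) ∂(sphereMeasure d) := by
        refine lintegral_mono fun σ => ?_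
        have hσ : ‖ε • (σ : E d)‖ = 1 := by rw [hεn]; simp
        exact lintegral_halfSum_le (by linarith) hσ
          (fun z => ENNReal.ofReal (bracket v ^ m * bracket (v + z) ^ (-q)))
    _ = ∫⁻ z : E d, ∫⁻ σ : Metric.sphere (0 : E d) 1,
          ENNReal.ofReal (2 ^ ((d : ℝ) - 2) * ‖z‖ ^ (-n) *
            angularWeight n (cosAngle (ε • (σ : E d)) z)) *
          ENNReal.ofReal (bracket v ^ m * bracket (v + z) ^ (-q)) ∂(sphereMeasure d) := by
        apply lintegral_lintegral_swap
        apply Measurable.aemeasurable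
        simp only [Function.uncurry_def]
        fun_prop
    _ ≤ ∫⁻ z : E d, ENNReal.ofReal (2 ^ ((d : ℝ) - 2)) * (K1 *
          ENNReal.ofReal (‖z‖ ^ (-n) * (bracket v ^ m * bracket (v + z) ^ (-q)))) := by
        refine lintegral_mono fun z => ?_
        have hb1 := bracket_pos v
        have hb2 := bracket_pos (v + z)
        rcases eq_or_ne z 0 with rfl | hz
        · rw [norm_zero, Real.zero_rpow (by linarith)]; simp
        have hzp : 0 < ‖z‖ := norm_pos_iff.2 hz
        have h3 := h1 (ε • ‖z‖⁻¹ • z) (by rw [hεn, norm_smul]; simp [hz])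
        have h4 : ∀ σ : E d, cosAngle (ε • σ) z = inner ℝ (ε • ‖z‖⁻¹ • z) σ := by
          intro σ
          rw [cosAngle, inner_smul_right, real_inner_smul_left, real_inner_smul_left,
            real_inner_smul_left]
        simp_rw [h4]
        have hm1 : Measurable fun σ : Metric.sphere (0 : E d) 1 =>
            angularWeight n (inner ℝ (ε • ‖z‖⁻¹ • z) (σ : E d)) := by fun_prop
        rw [lintegral_mul_const _ (by fun_prop)]
        have h5 : ∀ x : ℝ, ENNReal.ofReal (2 ^ ((d : ℝ) - 2) * ‖z‖ ^ (-n) * x) =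
            ENNReal.ofReal (2 ^ ((d : ℝ) - 2)) * ENNReal.ofReal (‖z‖ ^ (-n)) *
              ENNReal.ofReal x := by
          intro x
          rw [ENNReal.ofReal_mul (by positivity), ENNReal.ofReal_mul (by positivity)]
        simp_rw [h5]
        rw [lintegral_const_mul _ (by fun_prop), ENNReal.ofReal_mul (p := ‖z‖ ^ (-n))
          (by positivity)]
        calc _ ≤ ENNReal.ofReal (2 ^ ((d : ℝ) - 2)) * ENNReal.ofReal (‖z‖ ^ (-n)) * K1 *
              ENNReal.ofReal (bracket v ^ m * bracket (v + z) ^ (-q)) := by gcongr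
          _ = _ := by ring
    _ ≤ _ := by
        rw [lintegral_const_mul _ (by fun_prop), lintegral_const_mul _ (by fun_prop)]
        gcongr
        exact h2 v

theorem velocitySup_lt_top (hd : 3 ≤ d) {γ q : ℝ} (hγ : γ ∈ Ioc (1 - (d : ℝ)) 1)
    (hq : max ((d : ℝ) - 1 + γ) ((d : ℝ) - 1) < q) : velocitySup d γ q < ∞ := by
  have hd' : (3 : ℝ) ≤ d := by exact_mod_cast hd
  have hγ1 := hγ.1
  have hγ2 := hγ.2
  have hq1 := (le_max_left _ _).trans_lt hq
  have hq2 := (le_max_right _ _).trans_lt hq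
  -- For `n = m + 1 - γ` the two bounds on `m` say `2 < n` and `n < d`, the angular and the radial
  -- integrability conditions. Such an `m` exists because `d ≥ 3` is greater than 2 and `γ > 1 - d`.
  obtain ⟨m, hm1, hm2⟩ := exists_between (show max (γ + 1) 0 < γ + d - 1 by
    apply max_lt <;> linarith)
  have hm3 := (le_max_left _ _).trans_lt hm1
  have hm4 := (le_max_right _ _).trans_lt hm1
  obtain ⟨K, hK, h⟩ := exists_lintegral_collision_le hd (m := m) (n := m + 1 - γ) (q := q)
    hm4.le (by linarith) (by linarith) (by linarith) (by linarith) (by linarith)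
  have : SFinite (sphereMeasure d) := by unfold sphereMeasure; infer_instance
  have : Nonempty (Fin d) := ⟨⟨0, by omega⟩⟩
  refine lt_of_le_of_lt (b := ENNReal.ofReal (2 ^ q) * (K + K)) (iSup_le fun v => ?_)
    (by finiteness)
  rw [lintegral_prod_symm _ (by fun_prop)]
  calc _ ≤ ∫⁻ σ : Metric.sphere (0 : E d) 1, ENNReal.ofReal (2 ^ q) *
        ((∫⁻ u : E d,
        ENNReal.ofReal (‖u‖ ^ (-(m + 1 - γ)) / Real.sqrt (1 - cosAngle ((1 : ℝ) • (σ : E d)) u ^ 2)) *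
          ENNReal.ofReal (bracket v ^ m * bracket (v + halfSum ((1 : ℝ) • (σ : E d)) u) ^ (-q)))
        + ∫⁻ u : E d,
        ENNReal.ofReal (‖u‖ ^ (-(m + 1 - γ)) / Real.sqrt (1 - cosAngle ((-1 : ℝ) • (σ : E d)) u ^ 2)) *
          ENNReal.ofReal (bracket v ^ m * bracket (v + halfSum ((-1 : ℝ) • (σ : E d)) u) ^ (-q)))
        ∂(sphereMeasure d) := by
        refine lintegral_mono fun σ => ?_
        have hσ : ‖(σ : E d)‖ = 1 := by simp
        rw [← lintegral_add_left (by fun_prop), ← lintegral_const_mul _ (by fun_prop)]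
        refine le_trans ?_ (lintegral_sub_right_eq_self _ v).le
        refine lintegral_mono_ae ?_
        filter_upwards [Measure.ae_ne volume v] with v₁ hv₁
        have hu : 0 < ‖v₁ - v‖ := norm_pos_iff.2 (sub_ne_zero.2 hv₁)
        simp only [one_smul, neg_smul, cosAngle_neg, neg_sq, ← vStarOne_eq]
        simp only [← vStar_eq]
        have hb0 := bracket_pos v
        have hb1 := bracket_pos (vStar v v₁ σ)
        have hb2 := bracket_pos (vStarOne v v₁ σ)
        rw [← mul_add, ← ENNReal.ofReal_add (by positivity) (by positivity),
          ← ENNReal.ofReal_mul (by positivity), ← ENNReal.ofReal_mul (by positivity)]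
        apply ENNReal.ofReal_le_ofReal
        have h1 : ‖v₁ - v‖ ^ (γ - 1) = ‖v₁ - v‖ ^ (-(m + 1 - γ)) * ‖v₁ - v‖ ^ m := by
          rw [← Real.rpow_add hu]; ring_nf
        have h2 := bracket_ratio_le hm4.le (by linarith : m ≤ q) hσ v v₁
        rw [h1]
        calc _ = ‖v₁ - v‖ ^ (-(m + 1 - γ)) / Real.sqrt (1 - cosAngle (σ : E d) (v₁ - v) ^ 2) *
              (bracket v ^ q / (bracket (vStar v v₁ σ) ^ q * bracket (vStarOne v v₁ σ) ^ q)
                * ‖v₁ - v‖ ^ m) := by ring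
          _ ≤ ‖v₁ - v‖ ^ (-(m + 1 - γ)) / Real.sqrt (1 - cosAngle (σ : E d) (v₁ - v) ^ 2) *
              (2 ^ q * bracket v ^ m * (bracket (vStar v v₁ σ) ^ (-q) +
                bracket (vStarOne v v₁ σ) ^ (-q))) := by gcongr
          _ = _ := by ring
    _ ≤ _ := by
        rw [lintegral_const_mul _ ?_, lintegral_add_left ?_]
        · gcongr
          · exact h 1 v (by simp)
          · exact h (-1) v (by simp)
        · refine Measurable.lintegral_prod_right' (f := fun z : Metric.sphere (0 : E d) 1 × E d =>
            ENNReal.ofReal (‖z.2‖ ^ (-(m + 1 - γ)) /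
              Real.sqrt (1 - cosAngle ((1 : ℝ) • (z.1 : E d)) z.2 ^ 2)) *
            ENNReal.ofReal (bracket v ^ m *
              bracket (v + halfSum ((1 : ℝ) • (z.1 : E d)) z.2) ^ (-q))) ?_
          fun_prop
        · refine Measurable.add (Measurable.lintegral_prod_right'
            (f := fun z : Metric.sphere (0 : E d) 1 × E d =>
            ENNReal.ofReal (‖z.2‖ ^ (-(m + 1 - γ)) /
              Real.sqrt (1 - cosAngle ((1 : ℝ) • (z.1 : E d)) z.2 ^ 2)) *
            ENNReal.ofReal (bracket v ^ m *
              bracket (v + halfSum ((1 : ℝ) • (z.1 : E d)) z.2) ^ (-q))) ?_)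
            (Measurable.lintegral_prod_right'
            (f := fun z : Metric.sphere (0 : E d) 1 × E d =>
            ENNReal.ofReal (‖z.2‖ ^ (-(m + 1 - γ)) /
              Real.sqrt (1 - cosAngle ((-1 : ℝ) • (z.1 : E d)) z.2 ^ 2)) *
            ENNReal.ofReal (bracket v ^ m *
              bracket (v + halfSum ((-1 : ℝ) • (z.1 : E d)) z.2) ^ (-q))) ?_)
          all_goals fun_prop

/-! ### A bounded Borel representative of the angular cross-section -/

instance isFiniteMeasure_sphereMeasure : IsFiniteMeasure (sphereMeasure d) := by
  unfold sphereMeasure; infer_instance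

lemma ae_cosAngle_notMem (hd : 2 ≤ d) {N : Set ℝ} (hN : volume N = 0) (v : E d) :
    ∀ᵐ z : E d × Metric.sphere (0 : E d) 1 ∂(volume.prod (sphereMeasure d)),
      cosAngle (z.2 : E d) (z.1 - v) ∉ N := by
  have h : ∀ᵐ z : E d × Metric.sphere (0 : E d) 1 ∂(volume.prod (sphereMeasure d)),
      cosAngle (z.2 : E d) (z.1 - v) ∉ toMeasurable volume N := by
    have hm : MeasurableSet {z : E d × Metric.sphere (0 : E d) 1 |
        cosAngle (z.2 : E d) (z.1 - v) ∈ toMeasurable volume N} :=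
      (show Measurable fun z : E d × Metric.sphere (0 : E d) 1 =>
        cosAngle (z.2 : E d) (z.1 - v) by fun_prop) (measurableSet_toMeasurable _ _)
    rw [ae_iff]
    simp only [not_not]
    rw [Measure.prod_apply_symm hm]
    simp only [lintegral_eq_zero_iff (measurable_measure_prodMk_right hm)]
    refine Eventually.of_forall fun σ => ?_
    have h1 := volume_cosAngle_preimage_eq_zero hd (N := toMeasurable volume N)
      (by rwa [measure_toMeasurable]) (σ := (σ : E d)) (by simp)
    have h2 := (measurePreserving_sub_right (volume : Measure (E d)) v).quasiMeasurePreserving.preimage_null h1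
    exact h2
  filter_upwards [h] with z hz hz'
  exact hz (subset_toMeasurable _ _ hz')

/-- Clamping a measurable version of `b` to `[0, ‖b‖_∞]` turns its almost-everywhere properties into
pointwise ones. -/
lemma exists_measurable_representative {b : ℝ → ℝ} (hb : IsAngularCrossSection b) :
    ∃ b' : ℝ → ℝ, Measurable b' ∧ (∀ x, 0 ≤ b' x) ∧ (∀ x, b' x ≤ angularNorm b) ∧
      volume {x | x ∈ Icc (-1 : ℝ) 1 ∧ b x ≠ b' x} = 0 := by
  have hm := hb.memLp_top.aestronglyMeasurable.aemeasurable
  have h0 : 0 ≤ angularNorm b := ENNReal.toReal_nonneg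
  refine ⟨fun x => max 0 (min (hm.mk b x) (angularNorm b)),
    measurable_const.max (hm.measurable_mk.min measurable_const), fun x => le_max_left _ _,
    fun x => max_le h0 (min_le_right _ _), ?_⟩
  have h1 := hm.ae_eq_mk
  have h2 := ae_le_eLpNormEssSup (f := b) (μ := volume.restrict (Icc (-1 : ℝ) 1))
  have h3 : ∀ᵐ x ∂(volume.restrict (Icc (-1 : ℝ) 1)),
      b x = max 0 (min (hm.mk b x) (angularNorm b)) := by
    filter_upwards [h1, h2, ae_restrict_mem measurableSet_Icc] with x hx1 hx2 hx3
    have hx4 : b x ≤ angularNorm b := by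
      rw [angularNorm, eLpNorm_exponent_top]
      have h4 : eLpNormEssSup b (volume.restrict (Icc (-1 : ℝ) 1)) ≠ ∞ := by
        have := hb.memLp_top.eLpNorm_ne_top
        rwa [eLpNorm_exponent_top] at this
      have h5 := ENNReal.toReal_mono h4 hx2
      rw [toReal_enorm] at h5
      exact (le_abs_self _).trans h5
    rw [← hx1, min_eq_left hx4, max_eq_right (hb.nonneg x hx3)]
  rw [ae_restrict_iff' measurableSet_Icc, ae_iff] at h3
  simp only [Classical.not_imp] at h3
  exact h3

lemma ae_angular_eq (hd : 2 ≤ d) {b b' : ℝ → ℝ}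
    (h : volume {x | x ∈ Icc (-1 : ℝ) 1 ∧ b x ≠ b' x} = 0) (v : E d) :
    ∀ᵐ z : E d × Metric.sphere (0 : E d) 1 ∂(volume.prod (sphereMeasure d)),
      b (cosAngle (z.2 : E d) (z.1 - v)) = b' (cosAngle (z.2 : E d) (z.1 - v)) := by
  filter_upwards [ae_cosAngle_notMem hd h v] with z hz
  by_contra hne
  exact hz ⟨abs_le.1 (abs_cosAngle_le (by simp) _), hne⟩

/-- A null set of angles is invisible to the collision integrals, so the operators agree at every
point and `b` may be replaced by its representative. -/
lemma collision_congr_angular (hd : 2 ≤ d) (γ : ℝ) {b b' : ℝ → ℝ}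
    (h : volume {x | x ∈ Icc (-1 : ℝ) 1 ∧ b x ≠ b' x} = 0) {k : ℕ} (f : Density d (k + 1)) :
    collision γ b f = collision γ b' f := by
  funext X V
  unfold collision
  refine Finset.sum_congr rfl fun j _ => ?_
  congr 1
  all_goals
    apply integral_congr_ae
    filter_upwards [ae_angular_eq hd h (V j)] with z hz
    simp only [crossSection, hz]

/-! ### Comparison of the loss and gain integrals for hard spheres -/

/-- Average the integral defining `velocitySup` against `Ψ(v) = ⟨v⟩^{-q}`. For each `σ` the integral
of `Ψ(v^*)Ψ(v₁^*)` over both velocities is `W²`, and `1/√(1-cos²) ≥ 1`; hence `|S^{d-1}| W² ≤ W ·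
velocitySup`, and `W` cancels. -/
lemma sphereMeasure_mul_lintegral_bracket_le (hd : 3 ≤ d) {q : ℝ} (hq : (d : ℝ) < q) :
    sphereMeasure d univ * ∫⁻ z : E d, ENNReal.ofReal (bracket z ^ (-q)) ≤ velocitySup d 1 q := by
  set Ψ : E d → ℝ≥0∞ := fun z => ENNReal.ofReal (bracket z ^ (-q)) with hΨ
  have hΨm : Measurable Ψ := by fun_prop
  have hΨr : ∀ x y : E d, ‖x‖ = ‖y‖ → Ψ x = Ψ y := by
    intro x y h
    simp only [hΨ, bracket, h]
  set W := ∫⁻ z, Ψ z with hW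
  have hWtop : W < ∞ := lintegral_bracket_rpow_lt_top hq
  have hW0 : W ≠ 0 := by
    rw [hW, Ne, lintegral_eq_zero_iff hΨm]
    intro h0
    have : ∀ᵐ z : E d, False := by
      filter_upwards [h0] with z hz
      have h2 := Real.rpow_pos_of_pos (bracket_pos z) (-q)
      simp only [hΨ, Pi.zero_apply, ENNReal.ofReal_eq_zero] at hz
      linarith
    rw [ae_iff] at this
    exact NeZero.ne (volume : Measure (E d)) (by simpa using this)
  -- the radial correlation function
  have hrad : ∀ x y : E d, ‖x‖ = ‖y‖ →
      ∫⁻ v, Ψ (v + x) * Ψ (v - x) = ∫⁻ v, Ψ (v + y) * Ψ (v - y) := by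
    intro x y hxy
    let e := Submodule.reflection (ℝ ∙ (x - y))ᗮ
    have hex : e x = y := Submodule.reflection_sub hxy
    rw [← e.measurePreserving.lintegral_comp_emb e.toHomeomorph.measurableEmbedding
      (fun v => Ψ (v + y) * Ψ (v - y))]
    refine lintegral_congr fun v => ?_
    rw [← hex, ← map_add, ← map_sub]
    congr 1 <;> exact hΨr _ _ (e.norm_map _).symm
  -- By radial symmetry the direction `σ` in `v ± (‖u‖/2)σ` may be replaced by that of `u`. The
  -- outgoing velocities then become a linear image of the incoming pair.
  have hconv : ∀ σ : Metric.sphere (0 : E d) 1,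
      ∫⁻ v, ∫⁻ v₁, Ψ (vStar v v₁ σ) * Ψ (vStarOne v v₁ σ) = W * W := by
    intro σ
    calc ∫⁻ v, ∫⁻ v₁, Ψ (vStar v v₁ σ) * Ψ (vStarOne v v₁ σ)
        = ∫⁻ v, ∫⁻ u, Ψ (vStar v (u + v) σ) * Ψ (vStarOne v (u + v) σ) := by
          refine lintegral_congr fun v => ?_
          rw [lintegral_add_right_eq_self
            (fun v₁ => Ψ (vStar v v₁ σ) * Ψ (vStarOne v v₁ σ)) v]
      _ = ∫⁻ u, ∫⁻ v, Ψ (vStar v (u + v) σ) * Ψ (vStarOne v (u + v) σ) := by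
          apply lintegral_lintegral_swap
          simp only [Function.uncurry_def]
          fun_prop
      _ = ∫⁻ u, ∫⁻ v, Ψ (v + (‖u‖ / 2) • σ) * Ψ (v - (‖u‖ / 2) • σ) := by
          refine lintegral_congr fun u => ?_
          rw [← lintegral_add_right_eq_self
            (fun v => Ψ (v + (‖u‖ / 2) • σ) * Ψ (v - (‖u‖ / 2) • σ)) ((1 / 2 : ℝ) • u)]
          refine lintegral_congr fun v => ?_
          have h1 : (1 / 2 : ℝ) • (v + (u + v)) = v + (1 / 2 : ℝ) • u := by module
          simp only [vStar, vStarOne, add_sub_cancel_right, h1]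
      _ = ∫⁻ u, ∫⁻ v, Ψ (v + (1 / 2 : ℝ) • u) * Ψ (v - (1 / 2 : ℝ) • u) := by
          refine lintegral_congr fun u => hrad _ _ ?_
          rw [norm_smul, norm_smul]; simp; ring
      _ = ∫⁻ u, ∫⁻ v, Ψ (v + u) * Ψ v := by
          refine lintegral_congr fun u => ?_
          rw [← lintegral_sub_right_eq_self (fun v => Ψ (v + u) * Ψ v) ((1 / 2 : ℝ) • u)]
          refine lintegral_congr fun v => ?_
          congr 2
          module
      _ = ∫⁻ v, ∫⁻ u, Ψ (v + u) * Ψ v := by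
          apply lintegral_lintegral_swap
          simp only [Function.uncurry_def]
          fun_prop
      _ = W * W := by
          have : ∀ v, ∫⁻ u, Ψ (v + u) * Ψ v = W * Ψ v := by
            intro v
            rw [lintegral_mul_const _ (by fun_prop), lintegral_add_left_eq_self Ψ v]
          simp_rw [this]
          rw [lintegral_const_mul _ hΨm]
  have hmain : sphereMeasure d univ * (W * W) ≤ W * velocitySup d 1 q := by
    calc sphereMeasure d univ * (W * W)
        = ∫⁻ _ : Metric.sphere (0 : E d) 1, W * W ∂(sphereMeasure d) := by
          rw [lintegral_const, mul_comm]
      _ = ∫⁻ σ : Metric.sphere (0 : E d) 1,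
            (∫⁻ v, ∫⁻ v₁, Ψ (vStar v v₁ σ) * Ψ (vStarOne v v₁ σ)) ∂(sphereMeasure d) := by
          simp_rw [hconv]
      _ = ∫⁻ v, ∫⁻ σ : Metric.sphere (0 : E d) 1,
            (∫⁻ v₁, Ψ (vStar v v₁ σ) * Ψ (vStarOne v v₁ σ)) ∂(sphereMeasure d) := by
          apply lintegral_lintegral_swap
          apply Measurable.aemeasurable
          refine Measurable.lintegral_prod_right'
            (f := fun z : (Metric.sphere (0 : E d) 1 × E d) × E d =>
              Ψ (vStar z.1.2 z.2 z.1.1) * Ψ (vStarOne z.1.2 z.2 z.1.1)) ?_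
          fun_prop
      _ ≤ ∫⁻ v, Ψ v * velocitySup d 1 q := by
          refine lintegral_mono fun v => ?_
          have h1 := le_iSup (fun v : E d => ∫⁻ z : E d × Metric.sphere (0 : E d) 1,
            ENNReal.ofReal (‖z.1 - v‖ ^ ((1 : ℝ) - 1) /
              Real.sqrt (1 - cosAngle (z.2 : E d) (z.1 - v) ^ 2) *
              (bracket v ^ q / (bracket (vStar v z.1 z.2) ^ q * bracket (vStarOne v z.1 z.2) ^ q)))
            ∂((volume : Measure (E d)).prod (sphereMeasure d))) v
          refine le_trans ?_ (mul_le_mul' le_rfl h1)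
          rw [← lintegral_const_mul _ (by fun_prop), ← lintegral_prod_symm
            (fun z : E d × Metric.sphere (0 : E d) 1 =>
              Ψ (vStar v z.1 z.2) * Ψ (vStarOne v z.1 z.2)) (by fun_prop)]
          refine lintegral_mono_ae ?_
          filter_upwards [ae_cosAngle_notMem (by omega : 2 ≤ d) (N := {1, -1})
            (Set.Finite.measure_zero (by simp) _) v] with z hz
          have hb0 := bracket_pos v
          have hb1 := bracket_pos (vStar v z.1 z.2)
          have hb2 := bracket_pos (vStarOne v z.1 z.2)
          simp only [hΨ]
          rw [← ENNReal.ofReal_mul (by positivity), ← ENNReal.ofReal_mul (by positivity)]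
          apply ENNReal.ofReal_le_ofReal
          rw [sub_self, Real.rpow_zero, Real.rpow_neg hb0.le, Real.rpow_neg hb1.le,
            Real.rpow_neg hb2.le]
          have hsq : cosAngle (z.2 : E d) (z.1 - v) ^ 2 < 1 := by
            refine lt_of_le_of_ne (cosAngle_sq_le (by simp) _) fun h => hz ?_
            have h3 : (cosAngle (z.2 : E d) (z.1 - v) - 1) *
                (cosAngle (z.2 : E d) (z.1 - v) + 1) = 0 := by linear_combination h
            rcases mul_eq_zero.1 h3 with h4 | h4
            · exact Or.inl (sub_eq_zero.1 h4)
            · exact Or.inr (eq_neg_of_add_eq_zero_left h4)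
          have hs : 1 ≤ 1 / Real.sqrt (1 - cosAngle (z.2 : E d) (z.1 - v) ^ 2) := by
            rw [le_div_iff₀ (Real.sqrt_pos.2 (by linarith)), one_mul]
            exact Real.sqrt_le_one.2 (by nlinarith [sq_nonneg (cosAngle (z.2 : E d) (z.1 - v))])
          calc (bracket (vStar v z.1 z.2) ^ q)⁻¹ * (bracket (vStarOne v z.1 z.2) ^ q)⁻¹
              ≤ 1 / Real.sqrt (1 - cosAngle (z.2 : E d) (z.1 - v) ^ 2) *
                ((bracket (vStar v z.1 z.2) ^ q)⁻¹ * (bracket (vStarOne v z.1 z.2) ^ q)⁻¹) :=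
                le_mul_of_one_le_left (by positivity) hs
            _ = _ := by field_simp
      _ = W * velocitySup d 1 q := lintegral_mul_const _ hΨm
  have h2 : W * (sphereMeasure d univ * W) ≤ W * velocitySup d 1 q := by
    calc _ = sphereMeasure d univ * (W * W) := by ring
      _ ≤ _ := hmain
  exact (ENNReal.mul_le_mul_iff_right hW0 hWtop.ne).1 h2

/-! ### Time integrals of brackets along free transport -/

/-- On a half-line, bound by 1 up to `s = 1` and by `s^{-p}` beyond: `1 + 1/(p-1) = p/(p-1)`. -/
lemma lintegral_one_add_sq_rpow_le {p : ℝ} (hp : 1 < p) :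
    ∫⁻ s : ℝ, ENNReal.ofReal ((1 + s ^ 2) ^ (-p / 2)) ≤ ENNReal.ofReal (2 * p / (p - 1)) := by
  have hp1 : 0 < p - 1 := by linarith
  have hle1 : ∀ s : ℝ, (1 + s ^ 2) ^ (-p / 2) ≤ 1 := fun s =>
    Real.rpow_le_one_of_one_le_of_nonpos (by nlinarith [sq_nonneg s]) (by linarith)
  have hpos : ∫⁻ s in Ioi (0 : ℝ), ENNReal.ofReal ((1 + s ^ 2) ^ (-p / 2))
      ≤ ENNReal.ofReal (p / (p - 1)) := by
    rw [← Ioc_union_Ioi_eq_Ioi zero_le_one, lintegral_union measurableSet_Ioi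
      (Set.Ioc_disjoint_Ioi le_rfl)]
    have h1 : ∫⁻ s in Ioc (0 : ℝ) 1, ENNReal.ofReal ((1 + s ^ 2) ^ (-p / 2)) ≤ 1 := by
      calc _ ≤ ∫⁻ _ in Ioc (0 : ℝ) 1, (1 : ℝ≥0∞) := lintegral_mono fun s => by
            simpa using ENNReal.ofReal_le_ofReal (hle1 s)
        _ = 1 := by simp
    have h2 : ∫⁻ s in Ioi (1 : ℝ), ENNReal.ofReal ((1 + s ^ 2) ^ (-p / 2)) ≤
        ENNReal.ofReal (1 / (p - 1)) := by
      calc _ ≤ ∫⁻ s in Ioi (1 : ℝ), ENNReal.ofReal (s ^ (-p)) := by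
            refine setLIntegral_mono' measurableSet_Ioi fun s hs => ?_
            have hs0 : (0 : ℝ) < s := lt_trans zero_lt_one hs
            apply ENNReal.ofReal_le_ofReal
            calc (1 + s ^ 2) ^ (-p / 2) ≤ (s ^ 2) ^ (-p / 2) :=
                  Real.rpow_le_rpow_of_nonpos (by positivity) (by linarith) (by linarith)
              _ = s ^ (-p) := by
                  rw [← Real.rpow_natCast, ← Real.rpow_mul hs0.le]; congr 1; push_cast; ring
        _ = ENNReal.ofReal (∫ s in Ioi (1 : ℝ), s ^ (-p)) := by
            rw [ofReal_integral_eq_lintegral_ofReal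
              (integrableOn_Ioi_rpow_of_lt (by linarith) one_pos)]
            filter_upwards [ae_restrict_mem measurableSet_Ioi] with s hs
            exact Real.rpow_nonneg (lt_trans zero_lt_one hs).le _
        _ ≤ _ := by
            rw [integral_Ioi_rpow_of_lt (by linarith) one_pos, Real.one_rpow]
            apply le_of_eq; congr 1
            rw [show -p + 1 = -(p - 1) by ring, neg_div_neg_eq]
    calc _ ≤ 1 + ENNReal.ofReal (1 / (p - 1)) := add_le_add h1 h2
      _ = _ := by
        rw [← ENNReal.ofReal_one, ← ENNReal.ofReal_add zero_le_one (by positivity)]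
        congr 1; field_simp; ring
  have hneg : ∫⁻ s in Iio (0 : ℝ), ENNReal.ofReal ((1 + s ^ 2) ^ (-p / 2)) =
      ∫⁻ s in Ioi (0 : ℝ), ENNReal.ofReal ((1 + s ^ 2) ^ (-p / 2)) := by
    have h := (Measure.measurePreserving_neg (volume : Measure ℝ)).setLIntegral_comp_preimage_emb
      (MeasurableEquiv.neg ℝ).measurableEmbedding
      (fun s : ℝ => ENNReal.ofReal ((1 + s ^ 2) ^ (-p / 2))) (Ioi 0)
    simpa using h
  rw [← setLIntegral_univ, ← Iic_union_Ioi (a := (0 : ℝ)), lintegral_union measurableSet_Ioi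
    (Set.Iic_disjoint_Ioi le_rfl), setLIntegral_congr (Iio_ae_eq_Iic (a := (0 : ℝ))).symm, hneg]
  calc _ ≤ ENNReal.ofReal (p / (p - 1)) + ENNReal.ofReal (p / (p - 1)) := add_le_add hpos hpos
    _ = _ := by
      rw [← ENNReal.ofReal_add (by positivity) (by positivity)]
      congr 1; ring

lemma lintegral_affine_le {p κ : ℝ} (hp : 1 < p) (hκ : 0 < κ) (ξ : ℝ) :
    ∫⁻ s : ℝ, ENNReal.ofReal ((1 + (s * κ - ξ) ^ 2) ^ (-p / 2)) ≤
      ENNReal.ofReal (2 * p / (p - 1) / κ) := by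
  set f : ℝ → ℝ≥0∞ := fun s => ENNReal.ofReal ((1 + s ^ 2) ^ (-p / 2)) with hf
  have hfm : Measurable f := by fun_prop
  have h1 : ∫⁻ s : ℝ, f (s * κ - ξ) = ENNReal.ofReal κ⁻¹ * ∫⁻ s, f s := by
    have h2 := lintegral_map (μ := (volume : Measure ℝ)) (f := fun t => f (t - ξ)) (g := fun s => s * κ)
      (by fun_prop) (by fun_prop)
    rw [Real.map_volume_mul_right hκ.ne', lintegral_smul_measure,
      lintegral_sub_right_eq_self f ξ, abs_of_pos (inv_pos.2 hκ)] at h2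
    exact h2.symm
  change ∫⁻ s : ℝ, f (s * κ - ξ) ≤ _
  rw [h1, div_eq_inv_mul (2 * p / (p - 1)), ENNReal.ofReal_mul (by positivity)]
  gcongr
  exact lintegral_one_add_sq_rpow_le hp

/-- By Bessel's inequality for the orthogonal directions `a` and `b`, the components `ξ`, `η` of `x`
satisfy `ξ² + η² ≤ ‖x‖²`. Motion along one direction cannot remove the component along the other, so
the product keeps a full factor `⟨x⟩²`. -/
lemma bracket_product_lower {x a b : E d} (ha : a ≠ 0) (hb : b ≠ 0) (hab : inner ℝ a b = 0)
    (s : ℝ) :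
    bracket x ^ 2 * (1 + min ((s * ‖a‖ - inner ℝ x a / ‖a‖) ^ 2)
      ((s * ‖b‖ - inner ℝ x b / ‖b‖) ^ 2)) ≤ bracket (x - s • a) ^ 2 * bracket (x - s • b) ^ 2 := by
  have hap : 0 < ‖a‖ := norm_pos_iff.2 ha
  have hbp : 0 < ‖b‖ := norm_pos_iff.2 hb
  set ξ := inner ℝ x a / ‖a‖ with hξ
  set η := inner ℝ x b / ‖b‖ with hη
  have hxa : inner ℝ x a = ξ * ‖a‖ := by rw [hξ]; field_simp
  have hxb : inner ℝ x b = η * ‖b‖ := by rw [hη]; field_simp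
  have hbessel : ξ ^ 2 + η ^ 2 ≤ ‖x‖ ^ 2 := by
    have h0 : 0 ≤ ‖x - (ξ / ‖a‖) • a - (η / ‖b‖) • b‖ ^ 2 := sq_nonneg _
    rw [norm_sub_sq_real, norm_sub_sq_real, inner_sub_left, inner_smul_right, inner_smul_right,
      real_inner_smul_left, inner_smul_right, hab, norm_smul, norm_smul, hxa, hxb] at h0
    simp only [Real.norm_eq_abs, mul_pow, sq_abs] at h0
    have e1 : ξ / ‖a‖ * (ξ * ‖a‖) = ξ ^ 2 := by field_simp
    have e2 : η / ‖b‖ * (η * ‖b‖) = η ^ 2 := by field_simp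
    have e3 : (ξ / ‖a‖) ^ 2 * ‖a‖ ^ 2 = ξ ^ 2 := by field_simp
    have e4 : (η / ‖b‖) ^ 2 * ‖b‖ ^ 2 = η ^ 2 := by field_simp
    rw [e1, e2, e3, e4] at h0
    linarith
  have hA : bracket (x - s • a) ^ 2 = 1 + (‖x‖ ^ 2 - ξ ^ 2) + (s * ‖a‖ - ξ) ^ 2 := by
    rw [bracket_sq, norm_sub_sq_real, inner_smul_right, norm_smul, hxa, Real.norm_eq_abs, mul_pow,
      sq_abs]
    ring
  have hB : bracket (x - s • b) ^ 2 = 1 + (‖x‖ ^ 2 - η ^ 2) + (s * ‖b‖ - η) ^ 2 := by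
    rw [bracket_sq, norm_sub_sq_real, inner_smul_right, norm_smul, hxb, Real.norm_eq_abs, mul_pow,
      sq_abs]
    ring
  rw [hA, hB, bracket_sq]
  set P := (s * ‖a‖ - ξ) ^ 2
  set R := (s * ‖b‖ - η) ^ 2
  have hP : 0 ≤ P := sq_nonneg _
  have hR : 0 ≤ R := sq_nonneg _
  set μ := min P R
  have hμP : μ ≤ P := min_le_left _ _
  have hμR : μ ≤ R := min_le_right _ _
  have hμ0 : 0 ≤ μ := le_min hP hR
  have hξ0 := sq_nonneg ξ
  have hη0 := sq_nonneg η
  set N := ‖x‖ ^ 2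
  have i1 : 0 ≤ N - ξ ^ 2 := by linarith
  have i2 : 0 ≤ N - η ^ 2 := by linarith
  have j1 : (1 + (N - ξ ^ 2)) * (1 + (N - η ^ 2)) ≥ 1 + N := by nlinarith [mul_nonneg i1 i2]
  have j2 : P * (1 + (N - η ^ 2)) ≥ μ * (1 + (N - η ^ 2)) := by gcongr
  have j3 : R * (1 + (N - ξ ^ 2)) ≥ μ * (1 + (N - ξ ^ 2)) := by gcongr
  have j4 : μ * (N - ξ ^ 2 - η ^ 2) ≥ 0 := mul_nonneg hμ0 (by linarith)
  nlinarith [mul_nonneg hP hR]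

lemma bracket_product_rpow_le {p : ℝ} (hp : 0 < p) {x a b : E d} (ha : a ≠ 0) (hb : b ≠ 0)
    (hab : inner ℝ a b = 0) (s : ℝ) :
    bracket (x - s • a) ^ (-p) * bracket (x - s • b) ^ (-p) ≤ bracket x ^ (-p) *
      ((1 + min ((s * ‖a‖ - inner ℝ x a / ‖a‖) ^ 2)
      ((s * ‖b‖ - inner ℝ x b / ‖b‖) ^ 2)) ^ (-p / 2)) := by
  have hx := bracket_pos x
  have h1 := bracket_pos (x - s • a)
  have h2 := bracket_pos (x - s • b)
  have hsq : ∀ y : ℝ, 0 < y → y ^ (-p) = (y ^ 2) ^ (-p / 2) := by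
    intro y hy
    rw [← Real.rpow_natCast, ← Real.rpow_mul hy.le]; congr 1; push_cast; ring
  have hmin : 0 ≤ min ((s * ‖a‖ - inner ℝ x a / ‖a‖) ^ 2) ((s * ‖b‖ - inner ℝ x b / ‖b‖) ^ 2) :=
    le_min (sq_nonneg _) (sq_nonneg _)
  rw [hsq _ hx, hsq _ h1, hsq _ h2, ← Real.mul_rpow (by positivity) (by positivity),
    ← Real.mul_rpow (by positivity) (by positivity)]
  exact Real.rpow_le_rpow_of_nonpos (by positivity) (bracket_product_lower ha hb hab s)
    (by linarith)

/-- The weight at `x` comes out of the time integral; the rest is at most 1, or at most a sum of two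
one-dimensional integrals, since the minimum of the two squares is one of them. -/
lemma lintegral_bracket_product_le {p : ℝ} (hp : 1 < p) {x a b : E d} (ha : a ≠ 0) (hb : b ≠ 0)
    (hab : inner ℝ a b = 0) (I : Set ℝ) :
    ∫⁻ s in I, ENNReal.ofReal (bracket (x - s • a) ^ (-p) * bracket (x - s • b) ^ (-p)) ≤
      ENNReal.ofReal (bracket x ^ (-p)) *
        min (volume I) (ENNReal.ofReal (2 * p / (p - 1) * (1 / ‖a‖ + 1 / ‖b‖))) := by
  have hap : 0 < ‖a‖ := norm_pos_iff.2 ha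
  have hbp : 0 < ‖b‖ := norm_pos_iff.2 hb
  have hx := bracket_pos x
  have hp1 : 0 < p - 1 := by linarith
  have key := fun s => bracket_product_rpow_le (by linarith : 0 < p) (x := x) ha hb hab s
  have hmin : ∀ s : ℝ, 0 ≤ min ((s * ‖a‖ - inner ℝ x a / ‖a‖) ^ 2)
      ((s * ‖b‖ - inner ℝ x b / ‖b‖) ^ 2) := fun s => le_min (sq_nonneg _) (sq_nonneg _)
  rw [mul_min]
  refine le_min ?_ ?_
  · calc _ ≤ ∫⁻ _ in I, ENNReal.ofReal (bracket x ^ (-p)) := by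
          refine lintegral_mono fun s => ENNReal.ofReal_le_ofReal ((key s).trans ?_)
          exact mul_le_of_le_one_right (by positivity)
            (Real.rpow_le_one_of_one_le_of_nonpos (by linarith [hmin s]) (by linarith))
      _ = _ := by simp
  · refine (setLIntegral_le_lintegral _ _).trans ?_
    calc _ ≤ ∫⁻ s : ℝ, ENNReal.ofReal (bracket x ^ (-p)) *
          (ENNReal.ofReal ((1 + (s * ‖a‖ - inner ℝ x a / ‖a‖) ^ 2) ^ (-p / 2)) +
            ENNReal.ofReal ((1 + (s * ‖b‖ - inner ℝ x b / ‖b‖) ^ 2) ^ (-p / 2))) := by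
          refine lintegral_mono fun s => ?_
          rw [← ENNReal.ofReal_add (by positivity) (by positivity),
            ← ENNReal.ofReal_mul (by positivity)]
          refine ENNReal.ofReal_le_ofReal ((key s).trans ?_)
          gcongr
          rcases min_choice ((s * ‖a‖ - inner ℝ x a / ‖a‖) ^ 2)
            ((s * ‖b‖ - inner ℝ x b / ‖b‖) ^ 2) with h | h
          · rw [h]; exact le_add_of_nonneg_right (by positivity)
          · rw [h]; exact le_add_of_nonneg_left (by positivity)
      _ ≤ ENNReal.ofReal (bracket x ^ (-p)) * (ENNReal.ofReal (2 * p / (p - 1) / ‖a‖) +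
            ENNReal.ofReal (2 * p / (p - 1) / ‖b‖)) := by
          rw [lintegral_const_mul _ (by fun_prop), lintegral_add_left (by fun_prop)]
          gcongr
          · exact lintegral_affine_le hp hap _
          · exact lintegral_affine_le hp hbp _
      _ = _ := by
          rw [← ENNReal.ofReal_add (by positivity) (by positivity)]
          congr 2; ring

lemma lintegral_bracket_line_le {p : ℝ} (hp : 1 < p) (x : E d) {u : E d} (hu : u ≠ 0)
    (I : Set ℝ) :
    ∫⁻ s in I, ENNReal.ofReal (bracket (x - s • u) ^ (-p)) ≤
      min (volume I) (ENNReal.ofReal (2 * p / (p - 1) / ‖u‖)) := by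
  have hup : 0 < ‖u‖ := norm_pos_iff.2 hu
  refine le_min ?_ ?_
  · calc _ ≤ ∫⁻ _ in I, (1 : ℝ≥0∞) := by
          refine lintegral_mono fun s => ?_
          rw [← ENNReal.ofReal_one]
          exact ENNReal.ofReal_le_ofReal
            (Real.rpow_le_one_of_one_le_of_nonpos (one_le_bracket _) (by linarith))
      _ = _ := by simp
  · refine (setLIntegral_le_lintegral _ _).trans ?_
    refine le_trans (lintegral_mono fun s => ENNReal.ofReal_le_ofReal ?_)
      (lintegral_affine_le hp hup (inner ℝ x u / ‖u‖))
    rw [bracket_rpow]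
    refine Real.rpow_le_rpow_of_nonpos (by positivity) ?_ (by linarith)
    rw [norm_sub_sq_real, inner_smul_right, norm_smul, Real.norm_eq_abs, mul_pow, sq_abs]
    have h1 : (inner ℝ x u / ‖u‖) ^ 2 ≤ ‖x‖ ^ 2 := by
      rw [div_pow, div_le_iff₀ (by positivity), ← mul_pow]
      exact sq_le_sq' (by linarith [(abs_le.1 (abs_real_inner_le_norm x u)).1])
        (real_inner_le_norm x u)
    have h2 : inner ℝ x u / ‖u‖ * ‖u‖ = inner ℝ x u := by field_simp
    have h3 : (s * ‖u‖ - inner ℝ x u / ‖u‖) ^ 2 =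
        s ^ 2 * ‖u‖ ^ 2 - 2 * (s * inner ℝ x u) + (inner ℝ x u / ‖u‖) ^ 2 := by
      linear_combination (-2 * s) * h2
    linarith

/-! ### The one-particle weight and its collision rate -/

/-- The weight `⟨αx⟩^{-p} ⟨βv⟩^{-q}`. -/
def weight (p q α β : ℝ) (x v : E d) : ℝ := bracket (α • x) ^ (-p) * bracket (β • v) ^ (-q)

lemma weight_pos (p q α β : ℝ) (x v : E d) : 0 < weight p q α β x v :=
  mul_pos (Real.rpow_pos_of_pos (bracket_pos _) _) (Real.rpow_pos_of_pos (bracket_pos _) _)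

@[fun_prop]
lemma measurable_weight {δ : Type*} [MeasurableSpace δ] {p q α β : ℝ} {f g : δ → E d}
    (hf : Measurable f) (hg : Measurable g) : Measurable fun x => weight p q α β (f x) (g x) := by
  unfold weight; fun_prop

/-- The integrand of the gain part of `collisionRate`. -/
def gainRate (p q α β : ℝ) (s : ℝ) (x v v₁ σ : E d) : ℝ≥0∞ :=
  ENNReal.ofReal (weight p q α β (x - s • (vStar v v₁ σ - v)) (vStar v v₁ σ)) *
    ENNReal.ofReal (weight p q α β (x - s • (vStarOne v v₁ σ - v)) (vStarOne v v₁ σ))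

/-- The integrand of the loss part of `collisionRate`. -/
def lossRate (p q α β : ℝ) (s : ℝ) (x v v₁ : E d) : ℝ≥0∞ :=
  ENNReal.ofReal (weight p q α β x v) * ENNReal.ofReal (weight p q α β (x - s • (v₁ - v)) v₁)

/-- The total (gain plus loss) rate of collisions at time `s`, along free transport, of particles
distributed according to `weight`. -/
def collisionRate (γ : ℝ) (b : ℝ → ℝ) (p q α β : ℝ) (s : ℝ) (x v : E d) : ℝ≥0∞ :=
  ∫⁻ z : E d × Metric.sphere (0 : E d) 1, ENNReal.ofReal (crossSection γ b (z.2 : E d) (z.1 - v)) *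
    (gainRate p q α β s x v z.1 z.2 + lossRate p q α β s x v z.1)
    ∂(volume.prod (sphereMeasure d))

/-- A minimum is below every weighted geometric mean. A positive `ε` buys smallness in the time
length `τ` at the price of part of the dispersive gain in `‖u‖`. -/
lemma min_le_rpow_mul_rpow {τ D ε : ℝ} (hτ : 0 ≤ τ) (hD : 0 ≤ D) (hε : 0 ≤ ε) (hε1 : ε ≤ 1) :
    min (ENNReal.ofReal τ) (ENNReal.ofReal D) ≤ ENNReal.ofReal (τ ^ ε * D ^ (1 - ε)) := by
  rw [← ENNReal.ofReal_min]
  apply ENNReal.ofReal_le_ofReal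
  set m := min τ D with hm
  have hmτ : m ≤ τ := min_le_left _ _
  have hmD : m ≤ D := min_le_right _ _
  rcases eq_or_lt_of_le (le_min hτ hD) with h | h
  · rw [hm, ← h]; positivity
  · calc m = m ^ ε * m ^ (1 - ε) := by rw [← Real.rpow_add (by rwa [hm])]; simp
      _ ≤ _ := by
        have : 0 ≤ 1 - ε := by linarith
        gcongr

lemma inner_halfSum_halfSum_neg {σ : E d} (hσ : ‖σ‖ = 1) (u : E d) :
    inner ℝ (halfSum σ u) (halfSum (-σ) u) = 0 := by
  rw [halfSum, halfSum, real_inner_smul_left, inner_smul_right, smul_neg, ← sub_eq_add_neg,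
    inner_sub_right, inner_add_left, inner_add_left, real_inner_smul_left, inner_smul_right,
    real_inner_smul_left, inner_smul_right, real_inner_self_eq_norm_sq,
    real_inner_self_eq_norm_sq, hσ, real_inner_comm]
  ring

lemma halfSum_bounds {σ u : E d} (hσ : ‖σ‖ = 1) (hu : u ≠ 0) (hc : cosAngle σ u ^ 2 < 1) :
    halfSum σ u ≠ 0 ∧ halfSum (-σ) u ≠ 0 ∧ 1 / ‖halfSum σ u‖ + 1 / ‖halfSum (-σ) u‖ ≤
      3 / (‖u‖ * Real.sqrt (1 - cosAngle σ u ^ 2)) := by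
  have hup : 0 < ‖u‖ := norm_pos_iff.2 hu
  set c := cosAngle σ u with hcdef
  have hin : inner ℝ u σ = c * ‖u‖ := by rw [hcdef, cosAngle_eq]; field_simp
  have hc1 := abs_lt.1 ((sq_lt_one_iff_abs_lt_one c).1 hc)
  have ha : ‖halfSum σ u‖ ^ 2 = ‖u‖ ^ 2 * (1 + c) / 2 := by
    rw [norm_halfSum_sq hσ, hin]; ring
  have hb : ‖halfSum (-σ) u‖ ^ 2 = ‖u‖ ^ 2 * (1 - c) / 2 := by
    rw [norm_halfSum_sq (by rwa [norm_neg]), inner_neg_right, hin]; ring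
  have ha0 : 0 < ‖halfSum σ u‖ ^ 2 := by
    rw [ha]; have : 0 < 1 + c := by linarith
    positivity
  have hb0 : 0 < ‖halfSum (-σ) u‖ ^ 2 := by
    rw [hb]; have : 0 < 1 - c := by linarith
    positivity
  have ha1 : halfSum σ u ≠ 0 := fun h => by rw [h] at ha0; simp at ha0
  have hb1 : halfSum (-σ) u ≠ 0 := fun h => by rw [h] at hb0; simp at hb0
  refine ⟨ha1, hb1, ?_⟩
  have hap : 0 < ‖halfSum σ u‖ := norm_pos_iff.2 ha1
  have hbp : 0 < ‖halfSum (-σ) u‖ := norm_pos_iff.2 hb1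
  set a := ‖halfSum σ u‖
  set b := ‖halfSum (-σ) u‖
  have hS : 0 < 1 - c ^ 2 := by linarith
  have hSp := Real.sqrt_pos.2 hS
  have hprod : a * b = ‖u‖ ^ 2 * Real.sqrt (1 - c ^ 2) / 2 := by
    rw [← Real.sqrt_sq (by positivity : 0 ≤ a * b), mul_pow, ha, hb,
      show ‖u‖ ^ 2 * (1 + c) / 2 * (‖u‖ ^ 2 * (1 - c) / 2) =
        (‖u‖ ^ 2 / 2) ^ 2 * (1 - c ^ 2) by ring, Real.sqrt_mul (by positivity),
      Real.sqrt_sq (by positivity)]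
    ring
  -- From `a² + b² = ‖u‖²` the sharp factor is `√2`. The rounding to `3/2` produces the 3 in the
  -- statement, hence `6p = 2p · 3` in the gain bound.
  have hsum : a + b ≤ 3 / 2 * ‖u‖ := by
    apply le_of_sq_le_sq _ (by positivity)
    nlinarith [sq_nonneg (a - b)]
  have h1 : 1 / a + 1 / b = (a + b) / (a * b) := by field_simp; ring
  rw [h1, hprod, div_le_div_iff₀ (by positivity) (by positivity)]
  have h2 : (a + b) * (‖u‖ * Real.sqrt (1 - c ^ 2)) ≤
      3 / 2 * ‖u‖ * (‖u‖ * Real.sqrt (1 - c ^ 2)) := by gcongr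
  linarith

lemma bracket_smul_le_max {β : ℝ} (hβ : 0 < β) (v : E d) :
    bracket (β • v) ≤ max β 1 * bracket v := by
  apply le_of_sq_le_sq _ (by have := bracket_pos v; positivity)
  rw [mul_pow, bracket_sq, bracket_sq, norm_smul, Real.norm_of_nonneg hβ.le, mul_pow]
  have h1 : β ^ 2 ≤ (max β 1) ^ 2 := by gcongr; exact le_max_left _ _
  have h2 : 1 ≤ (max β 1) ^ 2 := one_le_pow₀ (le_max_right _ _)
  nlinarith [sq_nonneg ‖v‖]

lemma min_mul_bracket_le {β : ℝ} (hβ : 0 < β) (v : E d) :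
    min β 1 * bracket v ≤ bracket (β • v) := by
  have hm : 0 < min β 1 := lt_min hβ one_pos
  apply le_of_sq_le_sq _ (bracket_pos _).le
  rw [mul_pow, bracket_sq, bracket_sq, norm_smul, Real.norm_of_nonneg hβ.le, mul_pow]
  have h1 : (min β 1) ^ 2 ≤ β ^ 2 := by gcongr; exact min_le_left _ _
  have h2 : (min β 1) ^ 2 ≤ 1 := pow_le_one₀ hm.le (min_le_right _ _)
  nlinarith [sq_nonneg ‖v‖]

lemma bracket_smul_rpow_neg_le {β q : ℝ} (hβ : 0 < β) (hq : 0 ≤ q) (v : E d) :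
    bracket (β • v) ^ (-q) ≤ max (β ^ q) (β ^ (-2 * q)) * bracket v ^ (-q) := by
  have hv := bracket_pos v
  calc bracket (β • v) ^ (-q) ≤ (min β 1 * bracket v) ^ (-q) :=
        Real.rpow_le_rpow_of_nonpos (mul_pos (lt_min hβ one_pos) hv) (min_mul_bracket_le hβ v)
          (by linarith)
    _ = (min β 1) ^ (-q) * bracket v ^ (-q) :=
        Real.mul_rpow (le_min hβ.le zero_le_one) hv.le
    _ ≤ _ := by
        gcongr
        rcases le_total β 1 with h | h
        · rw [min_eq_left h]
          exact le_max_of_le_right (Real.rpow_le_rpow_of_exponent_ge hβ h (by linarith))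
        · rw [min_eq_right h, Real.one_rpow]
          exact le_max_of_le_left (Real.one_le_rpow h hq)

/-- Compare `⟨βv⟩` with `⟨v⟩` through `min β 1` and `max β 1`. Two outgoing and one incoming bracket
cost `min(β,1)^{-2q} max(β,1)^q`, which is the maximum in the constant. -/
lemma bracket_smul_ratio_le {β q : ℝ} (hβ : 0 < β) (hq : 0 ≤ q) (v v' v₁' : E d) :
    bracket (β • v') ^ (-q) * bracket (β • v₁') ^ (-q) ≤
      max (β ^ q) (β ^ (-2 * q)) * bracket (β • v) ^ (-q) *
        (bracket v ^ q / (bracket v' ^ q * bracket v₁' ^ q)) := by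
  have h0 := bracket_pos v
  have h1 := bracket_pos v'
  have h2 := bracket_pos v₁'
  have h3 := bracket_pos (β • v)
  have hmin : 0 < min β 1 := lt_min hβ one_pos
  have i1 : ∀ w : E d, bracket (β • w) ^ (-q) ≤ (min β 1) ^ (-q) * bracket w ^ (-q) := by
    intro w
    rw [← Real.mul_rpow hmin.le (bracket_pos w).le]
    exact Real.rpow_le_rpow_of_nonpos (mul_pos hmin (bracket_pos w)) (min_mul_bracket_le hβ w)
      (by linarith)
  have i2 : 1 ≤ bracket (β • v) ^ (-q) * ((max β 1) ^ q * bracket v ^ q) := by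
    rw [← Real.mul_rpow (by positivity) h0.le, Real.rpow_neg h3.le, ← div_eq_inv_mul,
      one_le_div (by positivity)]
    exact Real.rpow_le_rpow h3.le (bracket_smul_le_max hβ v) hq
  have i3 : (min β 1) ^ (-q) * (min β 1) ^ (-q) * (max β 1) ^ q = max (β ^ q) (β ^ (-2 * q)) := by
    rcases le_total β 1 with h | h
    · rw [min_eq_left h, max_eq_right h, Real.one_rpow, ← Real.rpow_add hβ, mul_one,
        max_eq_right (Real.rpow_le_rpow_of_exponent_ge hβ h (by linarith))]
      congr 1; ring
    · rw [min_eq_right h, max_eq_left h, Real.one_rpow,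
        max_eq_left (Real.rpow_le_rpow_of_exponent_le h (by linarith))]
      ring
  calc bracket (β • v') ^ (-q) * bracket (β • v₁') ^ (-q)
      ≤ ((min β 1) ^ (-q) * bracket v' ^ (-q)) * ((min β 1) ^ (-q) * bracket v₁' ^ (-q)) := by
        have := bracket_pos (β • v₁')
        gcongr
        · exact i1 v'
        · exact i1 v₁'
    _ ≤ ((min β 1) ^ (-q) * bracket v' ^ (-q)) * ((min β 1) ^ (-q) * bracket v₁' ^ (-q)) *
        (bracket (β • v) ^ (-q) * ((max β 1) ^ q * bracket v ^ q)) :=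
        le_mul_of_one_le_right (by positivity) i2
    _ = _ := by
        rw [← i3, Real.rpow_neg h1.le, Real.rpow_neg h2.le]
        field_simp

lemma lintegral_gainRate_le {p q α β τ ε : ℝ} (hp : 1 < p) (hq : 0 ≤ q) (hα : 0 < α) (hβ : 0 < β)
    (hτ : 0 ≤ τ) (hε : 0 ≤ ε) (hε1 : ε ≤ 1) {I : Set ℝ} (hI : volume I ≤ ENNReal.ofReal τ)
    (x v v₁ : E d) {σ : E d} (hσ : ‖σ‖ = 1) (hu : v₁ ≠ v) (hc : cosAngle σ (v₁ - v) ^ 2 < 1) :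
    ∫⁻ s in I, gainRate p q α β s x v v₁ σ ≤
      ENNReal.ofReal (weight p q α β x v * max (β ^ q) (β ^ (-2 * q)) *
        (τ ^ ε * (6 * p / (α * (p - 1))) ^ (1 - ε)) *
        (‖v₁ - v‖ ^ (ε - 1) / Real.sqrt (1 - cosAngle σ (v₁ - v) ^ 2) *
        (bracket v ^ q / (bracket (vStar v v₁ σ) ^ q * bracket (vStarOne v v₁ σ) ^ q)))) := by
  have hu0 : v₁ - v ≠ 0 := sub_ne_zero.2 hu
  have hup : 0 < ‖v₁ - v‖ := norm_pos_iff.2 hu0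
  obtain ⟨ha, hb, hab⟩ := halfSum_bounds hσ hu0 hc
  set a := halfSum σ (v₁ - v)
  set b := halfSum (-σ) (v₁ - v)
  have horth : inner ℝ a b = 0 := inner_halfSum_halfSum_neg hσ _
  have hva : vStar v v₁ σ - v = a := by rw [vStar_eq]; abel
  have hvb : vStarOne v v₁ σ - v = b := by rw [vStarOne_eq]; abel
  set S := Real.sqrt (1 - cosAngle σ (v₁ - v) ^ 2) with hS
  have hSp : 0 < S := Real.sqrt_pos.2 (by linarith)
  have hS1 : S ≤ 1 := Real.sqrt_le_one.2 (by nlinarith [sq_nonneg (cosAngle σ (v₁ - v))])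
  have hp1 : 0 < p - 1 := by linarith
  set D := 6 * p / (α * (p - 1)) with hD
  have hDp : 0 < D := by positivity
  have hx := bracket_pos (α • x)
  have hb1 := bracket_pos (β • vStar v v₁ σ)
  have hb2 := bracket_pos (β • vStarOne v v₁ σ)
  have hw1 := bracket_pos (vStar v v₁ σ)
  have hw2 := bracket_pos (vStarOne v v₁ σ)
  have hv := bracket_pos v
  have hbv := bracket_pos (β • v)
  have key := lintegral_bracket_product_le hp (x := α • x) (a := α • a) (b := α • b)
    (smul_ne_zero hα.ne' ha) (smul_ne_zero hα.ne' hb)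
    (by rw [real_inner_smul_left, inner_smul_right, horth]; simp) I
  have htime : min (volume I) (ENNReal.ofReal (2 * p / (p - 1) * (1 / ‖α • a‖ + 1 / ‖α • b‖))) ≤
      ENNReal.ofReal (τ ^ ε * D ^ (1 - ε) * (‖v₁ - v‖ ^ (ε - 1) / S)) := by
    have h1 : 2 * p / (p - 1) * (1 / ‖α • a‖ + 1 / ‖α • b‖) ≤ D / (‖v₁ - v‖ * S) := by
      rw [norm_smul, norm_smul, Real.norm_of_nonneg hα.le]
      calc 2 * p / (p - 1) * (1 / (α * ‖a‖) + 1 / (α * ‖b‖))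
          = 2 * p / (α * (p - 1)) * (1 / ‖a‖ + 1 / ‖b‖) := by
            have := norm_pos_iff.2 ha
            have := norm_pos_iff.2 hb
            field_simp
        _ ≤ 2 * p / (α * (p - 1)) * (3 / (‖v₁ - v‖ * S)) := by gcongr
        _ = _ := by rw [hD]; field_simp; ring
    refine (min_le_min hI (ENNReal.ofReal_le_ofReal h1)).trans ?_
    refine (min_le_rpow_mul_rpow hτ (by positivity) hε hε1).trans (ENNReal.ofReal_le_ofReal ?_)
    rw [mul_assoc, Real.div_rpow hDp.le (by positivity), Real.mul_rpow hup.le hSp.le]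
    gcongr
    rw [div_eq_mul_inv, div_eq_mul_inv, mul_inv, ← Real.rpow_neg hup.le,
      show -(1 - ε) = ε - 1 by ring]
    gcongr
    -- The interpolation yields only `S^{-(1-ε)}`; as `S ≤ 1` this is weakened to `S^{-1}`, so that
    -- the same angular factor appears for every `ε`.
    calc S = S ^ (1 : ℝ) := (Real.rpow_one S).symm
      _ ≤ S ^ (1 - ε) := Real.rpow_le_rpow_of_exponent_ge hSp hS1 (by linarith)
  calc ∫⁻ s in I, gainRate p q α β s x v v₁ σ
      = ∫⁻ s in I, ENNReal.ofReal (bracket (β • vStar v v₁ σ) ^ (-q) *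
          bracket (β • vStarOne v v₁ σ) ^ (-q)) *
          ENNReal.ofReal (bracket (α • x - s • α • a) ^ (-p) *
            bracket (α • x - s • α • b) ^ (-p)) := by
        refine lintegral_congr fun s => ?_
        rw [gainRate, ← ENNReal.ofReal_mul (weight_pos _ _ _ _ _ _).le,
          ← ENNReal.ofReal_mul (by positivity), hva, hvb]
        congr 1
        unfold weight
        rw [smul_sub, smul_sub, smul_comm α s a, smul_comm α s b]
        ring
    _ ≤ ENNReal.ofReal (max (β ^ q) (β ^ (-2 * q)) * bracket (β • v) ^ (-q) *
        (bracket v ^ q / (bracket (vStar v v₁ σ) ^ q * bracket (vStarOne v v₁ σ) ^ q))) *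
        (ENNReal.ofReal (bracket (α • x) ^ (-p)) *
          ENNReal.ofReal (τ ^ ε * D ^ (1 - ε) * (‖v₁ - v‖ ^ (ε - 1) / S))) := by
        rw [lintegral_const_mul _ (by fun_prop)]
        exact mul_le_mul' (ENNReal.ofReal_le_ofReal (bracket_smul_ratio_le hβ hq _ _ _))
          (key.trans (mul_le_mul' le_rfl htime))
    _ = _ := by
        rw [← ENNReal.ofReal_mul (by positivity), ← ENNReal.ofReal_mul (by positivity)]
        congr 1
        unfold weight
        ring

lemma lintegral_lossRate_le {p q α β τ ε : ℝ} (hp : 1 < p) (hq : 0 ≤ q) (hα : 0 < α) (hβ : 0 < β)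
    (hτ : 0 ≤ τ) (hε : 0 ≤ ε) (hε1 : ε ≤ 1) {I : Set ℝ} (hI : volume I ≤ ENNReal.ofReal τ)
    (x v v₁ : E d) (hu : v₁ ≠ v) :
    ∫⁻ s in I, lossRate p q α β s x v v₁ ≤
      ENNReal.ofReal (weight p q α β x v * max (β ^ q) (β ^ (-2 * q)) *
        (τ ^ ε * (2 * p / (α * (p - 1))) ^ (1 - ε)) *
        (‖v₁ - v‖ ^ (ε - 1) * bracket v₁ ^ (-q))) := by
  have hu0 : v₁ - v ≠ 0 := sub_ne_zero.2 hu
  have hup : 0 < ‖v₁ - v‖ := norm_pos_iff.2 hu0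
  have hp1 : 0 < p - 1 := by linarith
  set D := 2 * p / (α * (p - 1)) with hD
  have hDp : 0 < D := by positivity
  have hw := weight_pos p q α β x v
  have hbv := bracket_pos (β • v₁)
  have hb := bracket_pos v₁
  have key := lintegral_bracket_line_le hp (α • x) (u := α • (v₁ - v)) (smul_ne_zero hα.ne' hu0) I
  have htime : min (volume I) (ENNReal.ofReal (2 * p / (p - 1) / ‖α • (v₁ - v)‖)) ≤
      ENNReal.ofReal (τ ^ ε * D ^ (1 - ε) * ‖v₁ - v‖ ^ (ε - 1)) := by
    have h1 : 2 * p / (p - 1) / ‖α • (v₁ - v)‖ = D / ‖v₁ - v‖ := by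
      rw [norm_smul, Real.norm_of_nonneg hα.le, hD]; field_simp
    rw [h1]
    refine (min_le_min_right _ hI).trans ((min_le_rpow_mul_rpow hτ (by positivity) hε hε1).trans
      (le_of_eq ?_))
    rw [mul_assoc, Real.div_rpow hDp.le hup.le, div_eq_mul_inv, ← Real.rpow_neg hup.le,
      show -(1 - ε) = ε - 1 by ring]
  calc ∫⁻ s in I, lossRate p q α β s x v v₁
      = ∫⁻ s in I, ENNReal.ofReal (weight p q α β x v * bracket (β • v₁) ^ (-q)) *
          ENNReal.ofReal (bracket (α • x - s • α • (v₁ - v)) ^ (-p)) := by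
        refine lintegral_congr fun s => ?_
        rw [lossRate, ← ENNReal.ofReal_mul hw.le, ← ENNReal.ofReal_mul (by positivity)]
        congr 1
        unfold weight
        rw [smul_sub α x, smul_comm α s]
        ring
    _ ≤ ENNReal.ofReal (weight p q α β x v * (max (β ^ q) (β ^ (-2 * q)) * bracket v₁ ^ (-q))) *
          ENNReal.ofReal (τ ^ ε * D ^ (1 - ε) * ‖v₁ - v‖ ^ (ε - 1)) := by
        rw [lintegral_const_mul _ (by fun_prop)]
        gcongr
        · exact bracket_smul_rpow_neg_le hβ hq _
        · exact key.trans htime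
    _ = _ := by
        rw [← ENNReal.ofReal_mul (by positivity)]
        congr 1
        ring

@[fun_prop]
lemma measurable_gainRate {δ : Type*} [MeasurableSpace δ] {p q α β : ℝ} {s : δ → ℝ}
    {x v v₁ σ : δ → E d} (hs : Measurable s) (hx : Measurable x) (hv : Measurable v)
    (hv₁ : Measurable v₁) (hσ : Measurable σ) :
    Measurable fun t => gainRate p q α β (s t) (x t) (v t) (v₁ t) (σ t) := by
  unfold gainRate; fun_prop

@[fun_prop]
lemma measurable_lossRate {δ : Type*} [MeasurableSpace δ] {p q α β : ℝ} {s : δ → ℝ}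
    {x v v₁ : δ → E d} (hs : Measurable s) (hx : Measurable x) (hv : Measurable v)
    (hv₁ : Measurable v₁) :
    Measurable fun t => lossRate p q α β (s t) (x t) (v t) (v₁ t) := by
  unfold lossRate; fun_prop

lemma measurable_crossSection {δ : Type*} [MeasurableSpace δ] {γ : ℝ} {b : ℝ → ℝ}
    (hb : Measurable b) {σ u : δ → E d} (hσ : Measurable σ) (hu : Measurable u) :
    Measurable fun t => crossSection γ b (σ t) (u t) := by
  unfold crossSection; fun_prop

lemma measurable_collisionRate {γ : ℝ} {b : ℝ → ℝ} (hb : Measurable b) (p q α β : ℝ)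
    (x v : E d) : Measurable fun s => collisionRate γ b p q α β s x v := by
  unfold collisionRate
  refine Measurable.lintegral_prod_right'
    (f := fun t : ℝ × (E d × Metric.sphere (0 : E d) 1) =>
      ENNReal.ofReal (crossSection γ b (t.2.2 : E d) (t.2.1 - v)) *
      (gainRate p q α β t.1 x v t.2.1 t.2.2 + lossRate p q α β t.1 x v t.2.1)) ?_
  have := measurable_crossSection (γ := γ) hb
    (σ := fun t : ℝ × (E d × Metric.sphere (0 : E d) 1) => (t.2.2 : E d))
    (u := fun t : ℝ × (E d × Metric.sphere (0 : E d) 1) => t.2.1 - v) (by fun_prop) (by fun_prop)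
  fun_prop

/-! ### The integrated collision rate -/

/-- The supremum over `v` of `∫ |u|^{γ-1} ⟨v₁⟩^{-q} dσ dv₁`. -/
def lossSup (d : ℕ) (γ q : ℝ) : ℝ≥0∞ :=
  ⨆ v : E d, ∫⁻ z : E d × Metric.sphere (0 : E d) 1,
    ENNReal.ofReal (‖z.1 - v‖ ^ (γ - 1) * bracket z.1 ^ (-q)) ∂(volume.prod (sphereMeasure d))

lemma lossSup_lt_top {γ q : ℝ} (hγ : γ ∈ Ioc (1 - (d : ℝ)) 1)
    (hq : max ((d : ℝ) - 1 + γ) ((d : ℝ) - 1) < q) (hq0 : 0 ≤ q) : lossSup d γ q < ∞ := by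
  have hq1 := (le_max_left _ _).trans_lt hq
  obtain ⟨K, hK, h⟩ := exists_lintegral_norm_sub_mul_bracket_le (d := d) (a := 1 - γ) (c := q)
    (by linarith [hγ.2]) (by linarith [hγ.1]) hq0 (by linarith)
  refine lt_of_le_of_lt (iSup_le fun v => ?_)
    (ENNReal.mul_lt_top (measure_lt_top (sphereMeasure d) univ) hK)
  rw [lintegral_prod_symm _ (by fun_prop)]
  calc _ ≤ ∫⁻ _ : Metric.sphere (0 : E d) 1, K ∂(sphereMeasure d) := by
        refine lintegral_mono fun σ => ?_
        simpa only [neg_sub] using h v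
    _ = _ := by rw [lintegral_const, mul_comm]

/-- At `γ = 1` the integrand depends on neither `v` nor `σ`, so the loss integral is the sphere
measure times a bracket integral. The loss term is thus controlled by `U_q` alone. -/
lemma lossSup_one_le (hd : 3 ≤ d) {q : ℝ} (hq : (d : ℝ) < q) :
    lossSup d 1 q ≤ velocitySup d 1 q := by
  refine iSup_le fun v => ?_
  simp only [sub_self, Real.rpow_zero, one_mul]
  rw [lintegral_prod_symm _ (by fun_prop)]
  simp only [lintegral_const]
  rw [mul_comm]
  exact sphereMeasure_mul_lintegral_bracket_le hd hq

/-- Integrate in time first, for fixed collision parameters: dispersion replaces `‖u‖^γ` by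
`‖u‖^{γ+ε-1}`. What remains are the velocity integrals with exponent `γ + ε`. -/
lemma lintegral_collisionRate_le (hd : 3 ≤ d) {γ p q α β τ ε N : ℝ} {b : ℝ → ℝ}
    (hbm : Measurable b) (hb0 : ∀ x, 0 ≤ b x) (hbN : ∀ x, b x ≤ N) (hp : 1 < p) (hq : 0 ≤ q)
    (hα : 0 < α) (hβ : 0 < β) (hτ : 0 ≤ τ) (hε : 0 ≤ ε) (hε1 : ε ≤ 1) {I : Set ℝ}
    (hI : volume I ≤ ENNReal.ofReal τ) (x v : E d) :
    ∫⁻ s in I, collisionRate γ b p q α β s x v ≤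
      ENNReal.ofReal (weight p q α β x v * (N * max (β ^ q) (β ^ (-2 * q)))) *
        (ENNReal.ofReal (τ ^ ε * (6 * p / (α * (p - 1))) ^ (1 - ε)) * velocitySup d (γ + ε) q +
         ENNReal.ofReal (τ ^ ε * (2 * p / (α * (p - 1))) ^ (1 - ε)) * lossSup d (γ + ε) q) := by
  have : Nonempty (Fin d) := ⟨⟨0, by omega⟩⟩
  have hp1 : 0 < p - 1 := by linarith
  have hN : 0 ≤ N := (hb0 0).trans (hbN 0)
  have hw := weight_pos p q α β x v
  set Mβ := max (β ^ q) (β ^ (-2 * q)) with hMβ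
  have hM : 0 ≤ Mβ := le_max_of_le_left (by positivity)
  set D1 := τ ^ ε * (6 * p / (α * (p - 1))) ^ (1 - ε) with hD1
  set D2 := τ ^ ε * (2 * p / (α * (p - 1))) ^ (1 - ε) with hD2
  have hD1p : 0 ≤ D1 := by positivity
  have hD2p : 0 ≤ D2 := by positivity
  have hcm : Measurable fun z : E d × Metric.sphere (0 : E d) 1 =>
      crossSection γ b (z.2 : E d) (z.1 - v) := measurable_crossSection hbm (by fun_prop) (by fun_prop)
  have hcm2 : Measurable fun z : ℝ × (E d × Metric.sphere (0 : E d) 1) =>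
      crossSection γ b (z.2.2 : E d) (z.2.1 - v) := hcm.comp measurable_snd
  unfold collisionRate
  rw [lintegral_lintegral_swap (by simp only [Function.uncurry_def]; fun_prop)]
  set J1 : E d × Metric.sphere (0 : E d) 1 → ℝ := fun z => ‖z.1 - v‖ ^ (γ + ε - 1) /
      Real.sqrt (1 - cosAngle (z.2 : E d) (z.1 - v) ^ 2) *
      (bracket v ^ q / (bracket (vStar v z.1 z.2) ^ q * bracket (vStarOne v z.1 z.2) ^ q))
    with hJ1
  set J2 : E d × Metric.sphere (0 : E d) 1 → ℝ := fun z =>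
    ‖z.1 - v‖ ^ (γ + ε - 1) * bracket z.1 ^ (-q) with hJ2
  have hJ1m : Measurable J1 := by fun_prop
  have hJ2m : Measurable J2 := by fun_prop
  calc _ ≤ ∫⁻ z : E d × Metric.sphere (0 : E d) 1,
        (ENNReal.ofReal (weight p q α β x v * (N * Mβ)) * (ENNReal.ofReal D1 * ENNReal.ofReal (J1 z)
          + ENNReal.ofReal D2 * ENNReal.ofReal (J2 z))) ∂(volume.prod (sphereMeasure d)) := by
        refine lintegral_mono_ae ?_
        have hne : ∀ᵐ z : E d × Metric.sphere (0 : E d) 1 ∂(volume.prod (sphereMeasure d)),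
            z.1 ≠ v :=
          Measure.quasiMeasurePreserving_fst.ae (Measure.ae_ne volume v)
        filter_upwards [hne, ae_cosAngle_notMem (by omega : 2 ≤ d) (N := {1, -1})
            (Set.Finite.measure_zero (by simp) _) v] with z hz hz'
        have hσ : ‖(z.2 : E d)‖ = 1 := by simp
        have hup : 0 < ‖z.1 - v‖ := norm_pos_iff.2 (sub_ne_zero.2 hz)
        have hsq : cosAngle (z.2 : E d) (z.1 - v) ^ 2 < 1 := by
          refine lt_of_le_of_ne (cosAngle_sq_le hσ _) fun h => hz' ?_
          have h3 : (cosAngle (z.2 : E d) (z.1 - v) - 1) *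
              (cosAngle (z.2 : E d) (z.1 - v) + 1) = 0 := by linear_combination h
          rcases mul_eq_zero.1 h3 with h4 | h4
          · exact Or.inl (sub_eq_zero.1 h4)
          · exact Or.inr (eq_neg_of_add_eq_zero_left h4)
        have hc0 : crossSection γ b (z.2 : E d) (z.1 - v) ≤ N * ‖z.1 - v‖ ^ γ := by
          rw [crossSection, mul_comm]
          gcongr
          exact hbN _
        have hg := lintegral_gainRate_le hp hq hα hβ hτ hε hε1 hI x v z.1 hσ hz hsq
        have hl := lintegral_lossRate_le hp hq hα hβ hτ hε hε1 hI x v z.1 hz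
        have hpow : ‖z.1 - v‖ ^ (γ + ε - 1) = ‖z.1 - v‖ ^ γ * ‖z.1 - v‖ ^ (ε - 1) := by
          rw [← Real.rpow_add hup]; ring_nf
        have hb0 := bracket_pos v
        have hb1 := bracket_pos (vStar v z.1 z.2)
        have hb2 := bracket_pos (vStarOne v z.1 z.2)
        have hb3 := bracket_pos z.1
        rw [lintegral_const_mul _ (by fun_prop), lintegral_add_left (by fun_prop)]
        refine (mul_le_mul' (ENNReal.ofReal_le_ofReal hc0) (add_le_add hg hl)).trans (le_of_eq ?_)
        have hJ1z : 0 ≤ J1 z := by simp only [hJ1]; positivity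
        have hJ2z : 0 ≤ J2 z := by simp only [hJ2]; positivity
        rw [← ENNReal.ofReal_add (by positivity) (by positivity),
          ← ENNReal.ofReal_mul (by positivity), ← ENNReal.ofReal_mul (by positivity),
          ← ENNReal.ofReal_mul (by positivity), ← ENNReal.ofReal_add (by positivity)
          (by positivity), ← ENNReal.ofReal_mul (by positivity)]
        congr 1
        simp only [hJ1, hJ2, hpow]
        ring
    _ ≤ _ := by
        rw [lintegral_const_mul _ (by fun_prop), lintegral_add_left (by fun_prop),
          lintegral_const_mul _ (by fun_prop), lintegral_const_mul _ (by fun_prop)]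
        gcongr
        · exact le_iSup (fun v : E d => ∫⁻ z : E d × Metric.sphere (0 : E d) 1,
            ENNReal.ofReal (‖z.1 - v‖ ^ (γ + ε - 1) /
              Real.sqrt (1 - cosAngle (z.2 : E d) (z.1 - v) ^ 2) *
              (bracket v ^ q / (bracket (vStar v z.1 z.2) ^ q * bracket (vStarOne v z.1 z.2) ^ q)))
            ∂((volume : Measure (E d)).prod (sphereMeasure d))) v
        · exact le_iSup (fun v : E d => ∫⁻ z : E d × Metric.sphere (0 : E d) 1,
            ENNReal.ofReal (‖z.1 - v‖ ^ (γ + ε - 1) * bracket z.1 ^ (-q))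
            ∂((volume : Measure (E d)).prod (sphereMeasure d))) v

/-- For hard spheres the collision rate is integrable in time with the constant of the theorem. -/
lemma lintegral_collisionRate_one_le (hd : 3 ≤ d) {p q α β U : ℝ} {b b' : ℝ → ℝ}
    (hbm : Measurable b') (hb0 : ∀ x, 0 ≤ b' x) (hbN : ∀ x, b' x ≤ angularNorm b) (hp : 1 < p)
    (hq : (d : ℝ) < q) (hα : 0 < α) (hβ : 0 < β) (hU : velocitySup d 1 q ≤ ENNReal.ofReal U)
    {I : Set ℝ} {τ : ℝ} (hτ : 0 ≤ τ) (hI : volume I ≤ ENNReal.ofReal τ) (x v : E d) :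
    ∫⁻ s in I, collisionRate 1 b' p q α β s x v ≤
      ENNReal.ofReal (hierarchyConst p q α β (max U 0) b) * ENNReal.ofReal (weight p q α β x v) := by
  have hp1 : 0 < p - 1 := by linarith
  have hq0 : 0 ≤ q := by have : (0 : ℝ) ≤ d := Nat.cast_nonneg _; linarith
  have hw := weight_pos p q α β x v
  have hN : 0 ≤ angularNorm b := ENNReal.toReal_nonneg
  have hM : 0 ≤ max (β ^ q) (β ^ (-2 * q)) := le_max_of_le_left (by positivity)
  have hU' : velocitySup d 1 q ≤ ENNReal.ofReal (max U 0) :=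
    hU.trans (ENNReal.ofReal_le_ofReal (le_max_left _ _))
  have hU0 : 0 ≤ max U 0 := le_max_right _ _
  -- With `ε = 0` only dispersion is used, so the bound is independent of `τ`. The two prefactors
  -- `6p` and `2p` add up to `8p`.
  have h := lintegral_collisionRate_le hd (γ := 1) hbm hb0 hbN hp hq0 hα hβ hτ (le_refl 0)
    zero_le_one hI x v
  simp only [Real.rpow_zero, sub_zero, Real.rpow_one, one_mul, add_zero] at h
  refine h.trans ?_
  calc _ ≤ ENNReal.ofReal (weight p q α β x v * (angularNorm b * max (β ^ q) (β ^ (-2 * q)))) *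
        (ENNReal.ofReal (6 * p / (α * (p - 1))) * ENNReal.ofReal (max U 0) +
         ENNReal.ofReal (2 * p / (α * (p - 1))) * ENNReal.ofReal (max U 0)) := by
        gcongr
        exact (lossSup_one_le hd hq).trans hU'
    _ = _ := by
        rw [← ENNReal.ofReal_mul (by positivity), ← ENNReal.ofReal_mul (by positivity),
          ← ENNReal.ofReal_add (by positivity) (by positivity),
          ← ENNReal.ofReal_mul (by positivity), ← ENNReal.ofReal_mul
          (by unfold hierarchyConst; positivity)]
        congr 1
        unfold hierarchyConst
        field_simp
        ring

/-- For soft and moderately hard potentials the collision rate is small over short times. -/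
lemma exists_time_collisionRate_le (hd : 3 ≤ d) {γ p q α β N : ℝ} (hγ : 1 - (d : ℝ) < γ)
    (hγ1 : γ < 1) {b : ℝ → ℝ} (hbm : Measurable b) (hb0 : ∀ x, 0 ≤ b x) (hbN : ∀ x, b x ≤ N)
    (hp : 1 < p) (hq : max ((d : ℝ) - 1 + γ) ((d : ℝ) - 1) < q) (hα : 0 < α) (hβ : 0 < β)
    {C : ℝ} (hC : 0 < C) :
    ∃ τ > 0, ∀ I : Set ℝ, volume I ≤ ENNReal.ofReal τ → ∀ x v : E d,
      ∫⁻ s in I, collisionRate γ b p q α β s x v ≤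
        ENNReal.ofReal C * ENNReal.ofReal (weight p q α β x v) := by
  have hd' : (3 : ℝ) ≤ d := by exact_mod_cast hd
  have hq1 := (le_max_left _ _).trans_lt hq
  have hq2 := (le_max_right _ _).trans_lt hq
  have hp1 : 0 < p - 1 := by linarith
  have hN : 0 ≤ N := (hb0 0).trans (hbN 0)
  have hM : 0 ≤ max (β ^ q) (β ^ (-2 * q)) := le_max_of_le_left (by positivity)
  -- The gaps in `γ < 1` and `q > d - 1 + γ` leave room to raise `γ` to `γ + ε` while the velocity
  -- integrals stay finite.
  obtain ⟨ε, hε0, hε⟩ := exists_between (show (0 : ℝ) < min (min (1 - γ) 1) (q - (d - 1 + γ)) by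
    apply lt_min (lt_min _ _) <;> linarith)
  have hε1 : ε ≤ 1 - γ := (hε.le.trans (min_le_left _ _)).trans (min_le_left _ _)
  have hε2 : ε ≤ 1 := (hε.le.trans (min_le_left _ _)).trans (min_le_right _ _)
  have hε3 : ε < q - (d - 1 + γ) := hε.trans_le (min_le_right _ _)
  have hγ' : γ + ε ∈ Ioc (1 - (d : ℝ)) 1 := ⟨by linarith, by linarith⟩
  have hq' : max ((d : ℝ) - 1 + (γ + ε)) ((d : ℝ) - 1) < q := max_lt (by linarith) hq2
  set V := (velocitySup d (γ + ε) q).toReal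
  set L := (lossSup d (γ + ε) q).toReal
  have hV : velocitySup d (γ + ε) q = ENNReal.ofReal V :=
    (ENNReal.ofReal_toReal (velocitySup_lt_top hd hγ' hq').ne).symm
  have hL : lossSup d (γ + ε) q = ENNReal.ofReal L :=
    (ENNReal.ofReal_toReal (lossSup_lt_top hγ' hq' (by linarith)).ne).symm
  have hV0 : 0 ≤ V := ENNReal.toReal_nonneg
  have hL0 : 0 ≤ L := ENNReal.toReal_nonneg
  set K := (N * max (β ^ q) (β ^ (-2 * q))) * ((6 * p / (α * (p - 1))) ^ (1 - ε) * V +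
    (2 * p / (α * (p - 1))) ^ (1 - ε) * L) with hK
  have hK0 : 0 ≤ K := by positivity
  refine ⟨(C / (K + 1)) ^ (1 / ε), by positivity, fun I hI x v => ?_⟩
  have hw := weight_pos p q α β x v
  refine (lintegral_collisionRate_le hd (γ := γ) hbm hb0 hbN hp (by linarith) hα hβ
    (by positivity) hε0.le hε2 hI x v).trans ?_
  have hτ : ((C / (K + 1)) ^ (1 / ε)) ^ ε = C / (K + 1) := by
    rw [← Real.rpow_mul (by positivity), one_div_mul_cancel hε0.ne', Real.rpow_one]
  rw [hτ, hV, hL, ← ENNReal.ofReal_mul (by positivity), ← ENNReal.ofReal_mul (by positivity),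
    ← ENNReal.ofReal_add (by positivity) (by positivity), ← ENNReal.ofReal_mul (by positivity),
    ← ENNReal.ofReal_mul hC.le]
  apply ENNReal.ofReal_le_ofReal
  calc _ = C / (K + 1) * K * weight p q α β x v := by rw [hK]; ring
    _ ≤ C * weight p q α β x v := by
        gcongr
        rw [div_mul_eq_mul_div, div_le_iff₀ (by positivity)]
        nlinarith

/-! ### The Leibniz rule for products of primitives -/

/-- The square is the union of the two triangles cut off by its diagonal, and the diagonal is null.
-/
lemma lintegral_mul_lintegral_eq_add {ν : Measure ℝ} [SFinite ν] [NullSingletonClass ν] {F G : ℝ → ℝ≥0∞}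
    (hF : Measurable F) (hG : Measurable G) :
    (∫⁻ s, F s ∂ν) * ∫⁻ s, G s ∂ν =
      ∫⁻ s, F s * (∫⁻ r in Iic s, G r ∂ν) ∂ν + ∫⁻ s, (∫⁻ r in Iic s, F r ∂ν) * G s ∂ν := by
  have hset : MeasurableSet {z : ℝ × ℝ | z.2 ≤ z.1} := measurableSet_le measurable_snd measurable_fst
  have hset' : MeasurableSet {z : ℝ × ℝ | z.1 ≤ z.2} := measurableSet_le measurable_fst measurable_snd
  have e1 : ∀ s, F s * (∫⁻ r in Iic s, G r ∂ν) =
      ∫⁻ r, {z : ℝ × ℝ | z.2 ≤ z.1}.indicator (fun z => F z.1 * G z.2) (s, r) ∂ν := by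
    intro s
    rw [← lintegral_const_mul _ hG, ← lintegral_indicator measurableSet_Iic]
    rfl
  have e2 : ∀ s, (∫⁻ r in Iic s, F r ∂ν) * G s =
      ∫⁻ r, {z : ℝ × ℝ | z.1 ≤ z.2}.indicator (fun z => F z.1 * G z.2) (r, s) ∂ν := by
    intro s
    rw [← lintegral_mul_const _ hF, ← lintegral_indicator measurableSet_Iic]
    rfl
  have hm : Measurable fun z : ℝ × ℝ => F z.1 * G z.2 := by fun_prop
  simp_rw [e1, e2]
  rw [lintegral_lintegral_swap (f := fun s r => {z : ℝ × ℝ | z.1 ≤ z.2}.indicator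
    (fun z => F z.1 * G z.2) (r, s)) ((hm.indicator hset').comp measurable_swap).aemeasurable,
    ← lintegral_add_left (Measurable.lintegral_prod_right' (hm.indicator hset))]
  rw [← lintegral_mul_const _ hF]
  refine lintegral_congr fun s => ?_
  have hm' : Measurable fun r => {z : ℝ × ℝ | z.2 ≤ z.1}.indicator (fun z => F z.1 * G z.2) (s, r) :=
    (hm.indicator hset).comp measurable_prodMk_left
  rw [← lintegral_add_left hm', ← lintegral_const_mul _ hG]
  refine lintegral_congr_ae ?_
  filter_upwards [Measure.ae_ne ν s] with r hr
  rcases lt_or_gt_of_ne hr with h | h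
  · rw [indicator_of_mem (show (s, r) ∈ {z : ℝ × ℝ | z.2 ≤ z.1} from h.le),
      indicator_of_notMem (show (s, r) ∉ {z : ℝ × ℝ | z.1 ≤ z.2} from not_le.2 h), add_zero]
  · rw [indicator_of_notMem (show (s, r) ∉ {z : ℝ × ℝ | z.2 ≤ z.1} from not_le.2 h),
      indicator_of_mem (show (s, r) ∈ {z : ℝ × ℝ | z.1 ≤ z.2} from h.le), zero_add]

/-- The primitive `w + ∫_{t₀}^t q`. -/
def primitive (t₀ : ℝ) (w : ℝ≥0∞) (q : ℝ → ℝ≥0∞) (t : ℝ) : ℝ≥0∞ := w + ∫⁻ s in Ioc t₀ t, q s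

lemma measurable_primitive (t₀ : ℝ) (w : ℝ≥0∞) (q : ℝ → ℝ≥0∞) : Measurable (primitive t₀ w q) := by
  apply Monotone.measurable
  intro s t h
  exact add_le_add le_rfl (lintegral_mono_set (Ioc_subset_Ioc_right h))

lemma primitive_mul_primitive (t₀ t : ℝ) (w w' : ℝ≥0∞) {F G : ℝ → ℝ≥0∞} (hF : Measurable F)
    (hG : Measurable G) :
    primitive t₀ w F t * primitive t₀ w' G t =
      primitive t₀ (w * w') (fun s => F s * primitive t₀ w' G s + primitive t₀ w F s * G s) t := by
  set ν := (volume : Measure ℝ).restrict (Ioc t₀ t) with hν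
  have e : ∀ K : ℝ → ℝ≥0∞, ∀ s ∈ Ioc t₀ t, ∫⁻ r in Ioc t₀ s, K r = ∫⁻ r in Iic s, K r ∂ν := by
    intro K s hs
    rw [hν, Measure.restrict_restrict measurableSet_Iic]
    congr 2
    ext r
    simp only [mem_Ioc, mem_inter_iff, mem_Iic]
    exact ⟨fun h => ⟨h.2, h.1, h.2.trans hs.2⟩, fun h => ⟨h.2.1, h.1⟩⟩
  have h1 : ∫⁻ s in Ioc t₀ t, (F s * primitive t₀ w' G s + primitive t₀ w F s * G s) =
      ∫⁻ s, ((F s * w' + w * G s) + (F s * (∫⁻ r in Iic s, G r ∂ν) +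
        (∫⁻ r in Iic s, F r ∂ν) * G s)) ∂ν := by
    refine setLIntegral_congr_fun measurableSet_Ioc fun s hs => ?_
    simp only [primitive]
    rw [e G s hs, e F s hs]
    ring
  have hmono : ∀ K : ℝ → ℝ≥0∞, Measurable fun s => ∫⁻ r in Iic s, K r ∂ν := by
    intro K
    apply Monotone.measurable
    intro s t h
    exact lintegral_mono_set (Iic_subset_Iic.2 h)
  have m1 := hmono F
  have m2 := hmono G
  rw [primitive, primitive, primitive, h1, lintegral_add_left (by fun_prop),
    lintegral_add_left (by fun_prop), lintegral_mul_const _ hF, lintegral_const_mul _ hG,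
    lintegral_add_left (by fun_prop), ← lintegral_mul_lintegral_eq_add hF hG]
  ring

/-- The integrated Leibniz rule, valid for merely measurable and possibly infinite integrands. It
lets the sum over colliding particles integrate exactly to the product, without a factor `k`. -/
lemma prod_primitive_eq {ι : Type*} [DecidableEq ι] (S : Finset ι) (t₀ : ℝ) (w : ι → ℝ≥0∞)
    {q : ι → ℝ → ℝ≥0∞} (hq : ∀ i, Measurable (q i)) (t : ℝ) :
    ∏ i ∈ S, primitive t₀ (w i) (q i) t = primitive t₀ (∏ i ∈ S, w i)
      (fun s => ∑ j ∈ S, (∏ i ∈ S.erase j, primitive t₀ (w i) (q i) s) * q j s) t := by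
  induction S using Finset.induction_on generalizing t with
  | empty => simp [primitive]
  | insert a S ha ih =>
    have hm : ∀ i, Measurable (primitive t₀ (w i) (q i)) := fun i => measurable_primitive _ _ _
    have hm2 : Measurable fun s =>
        ∑ j ∈ S, (∏ i ∈ S.erase j, primitive t₀ (w i) (q i) s) * q j s := by fun_prop
    rw [Finset.prod_insert ha, ih, primitive_mul_primitive _ _ _ _ (hq a) hm2,
      Finset.prod_insert ha]
    congr 1
    funext s
    rw [← ih, Finset.sum_insert ha, Finset.erase_insert ha, Finset.mul_sum, mul_comm (q a s)]
    congr 1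
    refine Finset.sum_congr rfl fun j hj => ?_
    have hja : j ≠ a := fun h => ha (h ▸ hj)
    rw [Finset.erase_insert_of_ne hja.symm, Finset.prod_insert (fun h => ha (Finset.mem_of_mem_erase h)),
      mul_assoc]

lemma lintegral_sum_prod_le {ι : Type*} [DecidableEq ι] (S : Finset ι) (t₀ : ℝ) (w : ι → ℝ≥0∞)
    {q : ι → ℝ → ℝ≥0∞} (hq : ∀ i, Measurable (q i)) (t : ℝ) :
    ∫⁻ s in Ioc t₀ t, ∑ j ∈ S, (∏ i ∈ S.erase j, primitive t₀ (w i) (q i) s) * q j s ≤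
      ∏ i ∈ S, primitive t₀ (w i) (q i) t := by
  rw [prod_primitive_eq S t₀ w hq t]
  exact le_add_self

/-! ### Collision operators acting on product bounds -/

/-- The integrand of the gain operator. -/
def gainIntegrand (γ : ℝ) (b : ℝ → ℝ) {k : ℕ} (j : Fin k) (f : Density d (k + 1))
    (X V : Config d k) (z : E d × Metric.sphere (0 : E d) 1) : ℝ :=
  crossSection γ b (z.2 : E d) (z.1 - V j) *
    f (Fin.snoc (α := fun _ => E d) X (X j))
      (Fin.snoc (α := fun _ => E d) (Function.update V j (vStar (V j) z.1 z.2))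
        (vStarOne (V j) z.1 z.2))

/-- The integrand of the loss operator. -/
def lossIntegrand (γ : ℝ) (b : ℝ → ℝ) {k : ℕ} (j : Fin k) (f : Density d (k + 1))
    (X V : Config d k) (z : E d × Metric.sphere (0 : E d) 1) : ℝ :=
  crossSection γ b (z.2 : E d) (z.1 - V j) *
    f (Fin.snoc (α := fun _ => E d) X (X j)) (Fin.snoc (α := fun _ => E d) V z.1)

section IntegrandBounds

variable {γ : ℝ} {b : ℝ → ℝ} {p q α β : ℝ} {k : ℕ} {f : Density d (k + 1)} {s : ℝ} {c : ℝ≥0∞}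
  {ψ : E d → E d → ℝ≥0∞}

/-- Undoing the transport leaves the non-colliding factors at `(X i, V i)`, while the colliding pair
is displaced by `s` times its velocity change. Only on this pair is `ψ` replaced by `2w`, whence the
4. -/
lemma lintegral_enorm_gainIntegrand_le (hb0 : ∀ x, 0 ≤ b x)
    (hψ : ∀ x v, ψ x v ≤ 2 * ENNReal.ofReal (weight p q α β x v))
    (hf : ∀ X V, ‖transport (-s) f X V‖ₑ ≤ c * ∏ i, ψ (X i) (V i)) (X V : Config d k)
    (j : Fin k) :
    ∫⁻ z, ‖gainIntegrand γ b j f (X - (-s) • V) V z‖ₑ ∂(volume.prod (sphereMeasure d)) ≤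
      ∫⁻ z : E d × Metric.sphere (0 : E d) 1,
      c * (∏ i ∈ Finset.univ.erase j, ψ (X i) (V i)) * 4 *
        (ENNReal.ofReal (crossSection γ b (z.2 : E d) (z.1 - V j)) *
        gainRate p q α β s (X j) (V j) z.1 z.2) ∂(volume.prod (sphereMeasure d)) := by
  have hf' : ∀ Y V', ‖f Y V'‖ₑ ≤ c * ∏ i, ψ (Y i - s • V' i) (V' i) := by
    intro Y V'
    have h := hf (Y - s • V') V'
    simpa [transport] using h
  set Y : Config d k := X - (-s) • V with hY
  have hYi : ∀ i, Y i = X i + s • V i := by intro i; simp [hY]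
  set P := ∏ i ∈ Finset.univ.erase j, ψ (X i) (V i) with hP
  refine lintegral_mono fun z => ?_
  have hcs : 0 ≤ crossSection γ b (z.2 : E d) (z.1 - V j) :=
    mul_nonneg (by positivity) (hb0 _)
  rw [gainIntegrand, enorm_mul, Real.enorm_of_nonneg hcs]
  have h := hf' (Fin.snoc (α := fun _ => E d) Y (Y j))
      (Fin.snoc (α := fun _ => E d) (Function.update V j (vStar (V j) z.1 z.2))
        (vStarOne (V j) z.1 z.2))
  rw [Fin.prod_univ_castSucc] at h
  simp only [Fin.snoc_castSucc, Fin.snoc_last] at h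
  rw [← Finset.mul_prod_erase _ _ (Finset.mem_univ j), Function.update_self] at h
  have h2 : ∏ i ∈ Finset.univ.erase j, ψ (Y i - s • Function.update V j
      (vStar (V j) z.1 z.2) i) (Function.update V j (vStar (V j) z.1 z.2) i) = P := by
    refine Finset.prod_congr rfl fun i hi => ?_
    rw [Function.update_of_ne (Finset.ne_of_mem_erase hi), hYi, add_sub_cancel_right]
  have e1 : Y j - s • vStar (V j) z.1 z.2 = X j - s • (vStar (V j) z.1 z.2 - V j) := by
    rw [hYi]; module
  have e2 : Y j - s • vStarOne (V j) z.1 z.2 = X j - s • (vStarOne (V j) z.1 z.2 - V j) := by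
    rw [hYi]; module
  rw [h2, e1, e2] at h
  calc _ ≤ ENNReal.ofReal (crossSection γ b (z.2 : E d) (z.1 - V j)) * (c *
        ((2 * ENNReal.ofReal (weight p q α β (X j - s • (vStar (V j) z.1 z.2 - V j))
            (vStar (V j) z.1 z.2))) * P *
          (2 * ENNReal.ofReal (weight p q α β (X j - s • (vStarOne (V j) z.1 z.2 - V j))
            (vStarOne (V j) z.1 z.2))))) := by
        refine mul_le_mul' le_rfl (h.trans ?_)
        gcongr
        · exact hψ _ _
        · exact hψ _ _
    _ = _ := by unfold gainRate; ring

lemma lintegral_enorm_lossIntegrand_le (hb0 : ∀ x, 0 ≤ b x)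
    (hψ : ∀ x v, ψ x v ≤ 2 * ENNReal.ofReal (weight p q α β x v))
    (hf : ∀ X V, ‖transport (-s) f X V‖ₑ ≤ c * ∏ i, ψ (X i) (V i)) (X V : Config d k)
    (j : Fin k) :
    ∫⁻ z, ‖lossIntegrand γ b j f (X - (-s) • V) V z‖ₑ ∂(volume.prod (sphereMeasure d)) ≤
      ∫⁻ z : E d × Metric.sphere (0 : E d) 1,
      c * (∏ i ∈ Finset.univ.erase j, ψ (X i) (V i)) * 4 *
        (ENNReal.ofReal (crossSection γ b (z.2 : E d) (z.1 - V j)) *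
        lossRate p q α β s (X j) (V j) z.1) ∂(volume.prod (sphereMeasure d)) := by
  have hf' : ∀ Y V', ‖f Y V'‖ₑ ≤ c * ∏ i, ψ (Y i - s • V' i) (V' i) := by
    intro Y V'
    have h := hf (Y - s • V') V'
    simpa [transport] using h
  set Y : Config d k := X - (-s) • V with hY
  have hYi : ∀ i, Y i = X i + s • V i := by intro i; simp [hY]
  set P := ∏ i ∈ Finset.univ.erase j, ψ (X i) (V i) with hP
  refine lintegral_mono fun z => ?_
  have hcs : 0 ≤ crossSection γ b (z.2 : E d) (z.1 - V j) :=
    mul_nonneg (by positivity) (hb0 _)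
  rw [lossIntegrand, enorm_mul, Real.enorm_of_nonneg hcs]
  have h := hf' (Fin.snoc (α := fun _ => E d) Y (Y j)) (Fin.snoc (α := fun _ => E d) V z.1)
  rw [Fin.prod_univ_castSucc] at h
  simp only [Fin.snoc_castSucc, Fin.snoc_last] at h
  rw [← Finset.mul_prod_erase _ _ (Finset.mem_univ j)] at h
  have h2 : ∏ i ∈ Finset.univ.erase j, ψ (Y i - s • V i) (V i) = P := by
    refine Finset.prod_congr rfl fun i hi => ?_
    rw [hYi, add_sub_cancel_right]
  have e1 : Y j - s • V j = X j := by rw [hYi]; module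
  have e2 : Y j - s • z.1 = X j - s • (z.1 - V j) := by rw [hYi]; module
  rw [h2, e1, e2] at h
  calc _ ≤ ENNReal.ofReal (crossSection γ b (z.2 : E d) (z.1 - V j)) * (c *
        ((2 * ENNReal.ofReal (weight p q α β (X j) (V j))) * P *
          (2 * ENNReal.ofReal (weight p q α β (X j - s • (z.1 - V j)) z.1)))) := by
        refine mul_le_mul' le_rfl (h.trans ?_)
        gcongr
        · exact hψ _ _
        · exact hψ _ _
    _ = _ := by unfold lossRate; ring

/-- The gain and loss integrands together are controlled by the collision rate. -/
lemma lintegral_enorm_integrands_le (hb0 : ∀ x, 0 ≤ b x) (hc : c ≠ ∞)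
    (hψ : ∀ x v, ψ x v ≤ 2 * ENNReal.ofReal (weight p q α β x v))
    (hf : ∀ X V, ‖transport (-s) f X V‖ₑ ≤ c * ∏ i, ψ (X i) (V i)) (X V : Config d k)
    (j : Fin k) :
    ∫⁻ z, ‖gainIntegrand γ b j f (X - (-s) • V) V z‖ₑ ∂(volume.prod (sphereMeasure d)) +
      ∫⁻ z, ‖lossIntegrand γ b j f (X - (-s) • V) V z‖ₑ ∂(volume.prod (sphereMeasure d)) ≤
      c * ((∏ i ∈ Finset.univ.erase j, ψ (X i) (V i)) *
        (4 * collisionRate γ b p q α β s (X j) (V j))) := by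
  have hψtop : ∀ x v, ψ x v ≠ ∞ := fun x v =>
    ((hψ x v).trans_lt (ENNReal.mul_lt_top (by simp) ENNReal.ofReal_lt_top)).ne
  set P := ∏ i ∈ Finset.univ.erase j, ψ (X i) (V i) with hP
  have hPtop : P ≠ ∞ := ENNReal.prod_ne_top fun i _ => hψtop _ _
  calc _ ≤ _ := add_le_add (lintegral_enorm_gainIntegrand_le hb0 hψ hf X V j)
        (lintegral_enorm_lossIntegrand_le hb0 hψ hf X V j)
    _ ≤ _ := le_lintegral_add _ _
    _ = c * P * 4 * collisionRate γ b p q α β s (X j) (V j) := by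
        rw [collisionRate, ← lintegral_const_mul' _ _
          (ENNReal.mul_ne_top (ENNReal.mul_ne_top hc hPtop) (by simp))]
        refine lintegral_congr fun z => ?_
        ring
    _ = _ := by ring

lemma enorm_collision_le (hb0 : ∀ x, 0 ≤ b x) (hc : c ≠ ∞)
    (hψ : ∀ x v, ψ x v ≤ 2 * ENNReal.ofReal (weight p q α β x v))
    (hf : ∀ X V, ‖transport (-s) f X V‖ₑ ≤ c * ∏ i, ψ (X i) (V i)) (X V : Config d k) :
    ‖transport (-s) (collision γ b f) X V‖ₑ ≤
      c * ∑ j : Fin k, (∏ i ∈ Finset.univ.erase j, ψ (X i) (V i)) *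
        (4 * collisionRate γ b p q α β s (X j) (V j)) := by
  rw [Finset.mul_sum]
  refine (enorm_sum_le _ _).trans (Finset.sum_le_sum fun j _ => ?_)
  calc _ ≤ ‖gain γ b j f (X - (-s) • V) V‖ₑ + ‖loss γ b j f (X - (-s) • V) V‖ₑ := enorm_sub_le
    _ ≤ _ := add_le_add (enorm_integral_le_lintegral_enorm _) (enorm_integral_le_lintegral_enorm _)
    _ ≤ _ := lintegral_enorm_integrands_le hb0 hc hψ hf X V j

end IntegrandBounds

/-! ### The iteration on one time interval -/

/-- A bounded family satisfying the hierarchy inequality with zero initial data vanishes on every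
time interval on which the collision rate is small relative to the decay in `k`. -/
lemma eq_zero_of_hierarchy_inequality {γ : ℝ} {b : ℝ → ℝ} (hbm : Measurable b)
    (hb0 : ∀ x, 0 ≤ b x) {p q α β t₀ t₁ : ℝ} {h : TimeDensitySeq d} {M lam θ C : ℝ≥0∞}
    (hM : M ≠ ∞) (hlam : lam ≠ ∞) (hθ : θ < 1) (hC : 4 * lam * C ≤ 1)
    (hrate : ∀ x v : E d, ∫⁻ s in Ioc t₀ t₁, collisionRate γ b p q α β s x v ≤
      C * ENNReal.ofReal (weight p q α β x v))
    (hbound : ∀ k, 1 ≤ k → ∀ t ∈ Ioc t₀ t₁, ∀ X V, ‖transport (-t) (h k t) X V‖ₑ ≤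
      M * (θ * lam) ^ k * ∏ i, ENNReal.ofReal (weight p q α β (X i) (V i)))
    (hmild : ∀ k, 1 ≤ k → ∀ t ∈ Ioc t₀ t₁, ∀ X V, ‖transport (-t) (h k t) X V‖ₑ ≤
      ∫⁻ s in Ioc t₀ t, ‖transport (-s) (collision γ b (h (k + 1) s)) X V‖ₑ) :
    ∀ k, 1 ≤ k → ∀ t ∈ Ioc t₀ t₁, h k t = 0 := by
  set W : E d → E d → ℝ≥0∞ := fun x v => ENNReal.ofReal (weight p q α β x v) with hW
  set R : E d → E d → ℝ → ℝ≥0∞ := fun x v s => 4 * lam * collisionRate γ b p q α β s x v with hR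
  have hRm : ∀ x v, Measurable (R x v) := fun x v =>
    (measurable_collisionRate hbm p q α β x v).const_mul _
  set ψ : ℝ → E d → E d → ℝ≥0∞ := fun t x v => primitive t₀ (W x v) (R x v) t with hψ
  have hψW : ∀ t ∈ Ioc t₀ t₁, ∀ x v, ψ t x v ≤ 2 * W x v := by
    intro t ht x v
    have h1 : ∫⁻ s in Ioc t₀ t, R x v s ≤ W x v := by
      calc _ ≤ ∫⁻ s in Ioc t₀ t₁, R x v s := lintegral_mono_set (Ioc_subset_Ioc_right ht.2)
        _ = 4 * lam * ∫⁻ s in Ioc t₀ t₁, collisionRate γ b p q α β s x v :=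
            lintegral_const_mul _ (measurable_collisionRate hbm p q α β x v)
        _ ≤ 4 * lam * (C * W x v) := mul_le_mul' le_rfl (hrate x v)
        _ = (4 * lam * C) * W x v := by ring
        _ ≤ 1 * W x v := mul_le_mul' hC le_rfl
        _ = W x v := one_mul _
    calc ψ t x v = W x v + ∫⁻ s in Ioc t₀ t, R x v s := rfl
      _ ≤ W x v + W x v := add_le_add le_rfl h1
      _ = _ := (two_mul _).symm
  have hθtop : θ ≠ ∞ := (hθ.trans ENNReal.one_lt_top).ne
  -- Each use of the integral inequality gains one `θ`: the bound for level `k + 1` carries an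
  -- additional `θ * lam`, whose `lam` is absorbed into `R`.
  have main : ∀ n : ℕ, ∀ k, 1 ≤ k → ∀ t ∈ Ioc t₀ t₁, ∀ X V, ‖transport (-t) (h k t) X V‖ₑ ≤
      M * (θ * lam) ^ k * θ ^ n * ∏ i, ψ t (X i) (V i) := by
    intro n
    induction n with
    | zero =>
      intro k hk t ht X V
      rw [pow_zero, mul_one]
      refine (hbound k hk t ht X V).trans (mul_le_mul' le_rfl ?_)
      exact Finset.prod_le_prod' fun i _ => le_self_add
    | succ n ih =>
      intro k hk t ht X V
      have hctop : M * (θ * lam) ^ (k + 1) * θ ^ n ≠ ∞ := by finiteness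
      calc _ ≤ _ := hmild k hk t ht X V
        _ ≤ ∫⁻ s in Ioc t₀ t, (M * (θ * lam) ^ k * θ ^ (n + 1)) * ∑ j : Fin k,
            (∏ i ∈ Finset.univ.erase j, ψ s (X i) (V i)) * R (X j) (V j) s := by
            refine setLIntegral_mono' measurableSet_Ioc fun s hs => ?_
            have hs' : s ∈ Ioc t₀ t₁ := ⟨hs.1, hs.2.trans ht.2⟩
            refine (enorm_collision_le hb0 hctop (hψW s hs')
              (ih (k + 1) (by omega) s hs') X V).trans (le_of_eq ?_)
            rw [Finset.mul_sum, Finset.mul_sum]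
            refine Finset.sum_congr rfl fun j _ => ?_
            simp only [hR]
            ring
        _ ≤ _ := by
            rw [lintegral_const_mul' _ _ (by finiteness)]
            refine mul_le_mul' le_rfl ?_
            exact lintegral_sum_prod_le Finset.univ t₀ (fun i => W (X i) (V i))
              (fun i => hRm (X i) (V i)) t
  intro k hk t ht
  have hz : ∀ X V, transport (-t) (h k t) X V = 0 := by
    intro X V
    rw [← enorm_eq_zero]
    set K := M * (θ * lam) ^ k * ∏ i, ψ t (X i) (V i) with hK
    have hψtop : ∀ i, ψ t (X i) (V i) ≠ ∞ := fun i =>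
      ((hψW t ht _ _).trans_lt (ENNReal.mul_lt_top (by simp) ENNReal.ofReal_lt_top)).ne
    have hKtop : K ≠ ∞ :=
      ENNReal.mul_ne_top (by finiteness) (ENNReal.prod_ne_top fun i _ => hψtop i)
    have hlim : Tendsto (fun n : ℕ => K * θ ^ n) atTop (𝓝 (K * 0)) :=
      ENNReal.Tendsto.const_mul (ENNReal.tendsto_pow_atTop_nhds_zero_of_lt_one hθ) (Or.inr hKtop)
    rw [mul_zero] at hlim
    refine le_antisymm (ge_of_tendsto' hlim fun n => ?_) zero_le
    refine (main n k hk t ht X V).trans (le_of_eq ?_)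
    rw [hK]; ring
  funext X V
  have := hz (X - t • V) V
  simpa [transport] using this

/-! ### Measurability, integrability and linearity of the collision integrals -/

lemma measurable_snoc {δ : Type*} [MeasurableSpace δ] {k : ℕ} {a : δ → Config d k} {c : δ → E d}
    (ha : Measurable a) (hc : Measurable c) :
    Measurable fun t => (Fin.snoc (α := fun _ => E d) (a t) (c t) : Config d (k + 1)) := by
  rw [measurable_pi_iff]
  intro i
  refine Fin.lastCases ?_ (fun i => ?_) i
  · simpa using hc
  · simp only [Fin.snoc_castSucc]
    exact (measurable_pi_apply i).comp ha

lemma measurable_gainIntegrand {γ : ℝ} {b : ℝ → ℝ} (hb : Measurable b) {k : ℕ}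
    {f : ℝ → Density d (k + 1)}
    (hf : Measurable fun z : ℝ × Config d (k + 1) × Config d (k + 1) => f z.1 z.2.1 z.2.2)
    (X V : Config d k) (j : Fin k) :
    Measurable fun t : ℝ × (E d × Metric.sphere (0 : E d) 1) =>
      gainIntegrand γ b j (f t.1) (X - (-t.1) • V) V t.2 := by
  unfold gainIntegrand
  have hX : Measurable fun t : ℝ × (E d × Metric.sphere (0 : E d) 1) => X - (-t.1) • V := by
    fun_prop
  have hup : Measurable fun t : ℝ × (E d × Metric.sphere (0 : E d) 1) =>
      Function.update V j (vStar (V j) t.2.1 t.2.2) :=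
    (measurable_update V).comp (by fun_prop)
  exact (measurable_crossSection hb (by fun_prop) (by fun_prop)).mul
    (hf.comp (measurable_fst.prodMk ((measurable_snoc hX ((measurable_pi_apply j).comp hX)).prodMk
      (measurable_snoc hup (by fun_prop)))))

lemma measurable_lossIntegrand {γ : ℝ} {b : ℝ → ℝ} (hb : Measurable b) {k : ℕ}
    {f : ℝ → Density d (k + 1)}
    (hf : Measurable fun z : ℝ × Config d (k + 1) × Config d (k + 1) => f z.1 z.2.1 z.2.2)
    (X V : Config d k) (j : Fin k) :
    Measurable fun t : ℝ × (E d × Metric.sphere (0 : E d) 1) =>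
      lossIntegrand γ b j (f t.1) (X - (-t.1) • V) V t.2 := by
  unfold lossIntegrand
  have hX : Measurable fun t : ℝ × (E d × Metric.sphere (0 : E d) 1) => X - (-t.1) • V := by
    fun_prop
  exact (measurable_crossSection hb (by fun_prop) (by fun_prop)).mul
    (hf.comp (measurable_fst.prodMk ((measurable_snoc hX ((measurable_pi_apply j).comp hX)).prodMk
      (measurable_snoc measurable_const (by fun_prop)))))

/-- The Bochner integral is zero for non-integrable functions, so linearity of the collision
operator must be earned. The rate bound gives integrability jointly in time and collision
parameters, hence linearity for almost every time. -/
lemma integrable_integrands {γ : ℝ} {b : ℝ → ℝ} (hb : Measurable b) (hb0 : ∀ x, 0 ≤ b x)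
    {p q α β : ℝ} {k : ℕ} {f : ℝ → Density d (k + 1)}
    (hf : Measurable fun z : ℝ × Config d (k + 1) × Config d (k + 1) => f z.1 z.2.1 z.2.2)
    {I : Set ℝ} (hI : MeasurableSet I)
    (hrate : ∀ x v : E d, ∫⁻ s in I, collisionRate γ b p q α β s x v < ∞) {c : ℝ≥0∞}
    (hc : c ≠ ∞)
    (hbound : ∀ s ∈ I, ∀ X V, ‖transport (-s) (f s) X V‖ₑ ≤
      c * ∏ i, ENNReal.ofReal (weight p q α β (X i) (V i))) (X V : Config d k) (j : Fin k) :
    Integrable (fun t : ℝ × (E d × Metric.sphere (0 : E d) 1) =>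
      gainIntegrand γ b j (f t.1) (X - (-t.1) • V) V t.2)
      ((volume.restrict I).prod (volume.prod (sphereMeasure d))) ∧
    Integrable (fun t : ℝ × (E d × Metric.sphere (0 : E d) 1) =>
      lossIntegrand γ b j (f t.1) (X - (-t.1) • V) V t.2)
      ((volume.restrict I).prod (volume.prod (sphereMeasure d))) := by
  have hg := measurable_gainIntegrand (γ := γ) hb hf X V j
  have hl := measurable_lossIntegrand (γ := γ) hb hf X V j
  have key : ∀ s ∈ I, _ := fun s hs => lintegral_enorm_integrands_le (γ := γ) hb0 hc
    (ψ := fun x v => ENNReal.ofReal (weight p q α β x v))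
    (fun x v => le_mul_of_one_le_left zero_le (by norm_num)) (hbound s hs) X V j
  have hfin : ∫⁻ s in I, c * ((∏ i ∈ Finset.univ.erase j,
      ENNReal.ofReal (weight p q α β (X i) (V i))) *
        (4 * collisionRate γ b p q α β s (X j) (V j))) < ∞ := by
    have hm := measurable_collisionRate (γ := γ) hb p q α β (X j) (V j)
    rw [lintegral_const_mul _ (by fun_prop), lintegral_const_mul _ (by fun_prop),
      lintegral_const_mul _ (by fun_prop)]
    exact ENNReal.mul_lt_top hc.lt_top (ENNReal.mul_lt_top
      (ENNReal.prod_lt_top fun i _ => ENNReal.ofReal_lt_top)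
      (ENNReal.mul_lt_top (by simp) (hrate _ _)))
  constructor
  · refine ⟨hg.aestronglyMeasurable, ?_⟩
    rw [HasFiniteIntegral, lintegral_prod _ hg.enorm.aemeasurable]
    exact lt_of_le_of_lt (setLIntegral_mono' hI fun s hs => le_self_add.trans (key s hs)) hfin
  · refine ⟨hl.aestronglyMeasurable, ?_⟩
    rw [HasFiniteIntegral, lintegral_prod _ hl.enorm.aemeasurable]
    exact lt_of_le_of_lt (setLIntegral_mono' hI fun s hs => le_add_self.trans (key s hs)) hfin

/-- The time integral of the difference of two collision terms. -/
lemma enorm_integral_collision_sub_le {γ : ℝ} {b : ℝ → ℝ} (hb : Measurable b)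
    (hb0 : ∀ x, 0 ≤ b x) {p q α β : ℝ} {k : ℕ} {f g : ℝ → Density d (k + 1)}
    (hf : Measurable fun z : ℝ × Config d (k + 1) × Config d (k + 1) => f z.1 z.2.1 z.2.2)
    (hg : Measurable fun z : ℝ × Config d (k + 1) × Config d (k + 1) => g z.1 z.2.1 z.2.2)
    {I : Set ℝ} (hI : MeasurableSet I)
    (hrate : ∀ x v : E d, ∫⁻ s in I, collisionRate γ b p q α β s x v < ∞) {c : ℝ≥0∞}
    (hc : c ≠ ∞)
    (hfb : ∀ s ∈ I, ∀ X V, ‖transport (-s) (f s) X V‖ₑ ≤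
      c * ∏ i, ENNReal.ofReal (weight p q α β (X i) (V i)))
    (hgb : ∀ s ∈ I, ∀ X V, ‖transport (-s) (g s) X V‖ₑ ≤
      c * ∏ i, ENNReal.ofReal (weight p q α β (X i) (V i))) (X V : Config d k) :
    ‖(∫ s in I, transport (-s) (collision γ b (f s)) X V) -
        ∫ s in I, transport (-s) (collision γ b (g s)) X V‖ₑ ≤
      ∫⁻ s in I, ‖transport (-s) (collision γ b (f s - g s)) X V‖ₑ := by
  have if1 := fun j => (integrable_integrands hb hb0 hf hI hrate hc hfb X V j).1
  have if2 := fun j => (integrable_integrands hb hb0 hf hI hrate hc hfb X V j).2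
  have ig1 := fun j => (integrable_integrands hb hb0 hg hI hrate hc hgb X V j).1
  have ig2 := fun j => (integrable_integrands hb hb0 hg hI hrate hc hgb X V j).2
  have hF : IntegrableOn (fun s => transport (-s) (collision γ b (f s)) X V) I :=
    (integrable_finsetSum Finset.univ fun j _ =>
      (if1 j).integral_prod_left.sub (if2 j).integral_prod_left).congr
        (Eventually.of_forall fun _ => rfl)
  have hG : IntegrableOn (fun s => transport (-s) (collision γ b (g s)) X V) I :=
    (integrable_finsetSum Finset.univ fun j _ =>
      (ig1 j).integral_prod_left.sub (ig2 j).integral_prod_left).congr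
        (Eventually.of_forall fun _ => rfl)
  rw [← integral_sub hF hG]
  refine (enorm_integral_le_lintegral_enorm _).trans (le_of_eq (lintegral_congr_ae ?_))
  have a1 := ae_all_iff.2 fun j => (if1 j).prod_right_ae
  have a2 := ae_all_iff.2 fun j => (if2 j).prod_right_ae
  have a3 := ae_all_iff.2 fun j => (ig1 j).prod_right_ae
  have a4 := ae_all_iff.2 fun j => (ig2 j).prod_right_ae
  filter_upwards [a1, a2, a3, a4] with s h1 h2 h3 h4
  congr 1
  have e1 : ∀ j, gain γ b j (f s - g s) (X - (-s) • V) V =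
      gain γ b j (f s) (X - (-s) • V) V - gain γ b j (g s) (X - (-s) • V) V := by
    intro j
    refine Eq.trans (integral_congr_ae (Eventually.of_forall fun z => ?_))
      (integral_sub (h1 j) (h3 j))
    simp only [Pi.sub_apply]
    ring
  have e2 : ∀ j, loss γ b j (f s - g s) (X - (-s) • V) V =
      loss γ b j (f s) (X - (-s) • V) V - loss γ b j (g s) (X - (-s) • V) V := by
    intro j
    refine Eq.trans (integral_congr_ae (Eventually.of_forall fun z => ?_))
      (integral_sub (h2 j) (h4 j))
    simp only [Pi.sub_apply]
    ring
  simp only [transport, collision, e1, e2]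
  rw [← Finset.sum_sub_distrib]
  refine Finset.sum_congr rfl fun j _ => ?_
  ring

/-! ### Uniform pointwise bounds -/

lemma enorm_le_of_seqNorm_le {p q α β μ : ℝ} {G : DensitySeq d} {M : ℝ≥0∞}
    (h : seqNorm p q α β μ G ≤ M) {k : ℕ} (hk : 1 ≤ k) (X V : Config d k) :
    ‖G k X V‖ₑ ≤ M * ENNReal.ofReal (Real.exp (-μ)) ^ k *
      ∏ i, ENNReal.ofReal (weight p q α β (X i) (V i)) := by
  have h1 : ENNReal.ofReal (Real.exp (μ * k)) *
      ENNReal.ofReal (bracketProd (α • X) ^ p * bracketProd (β • V) ^ q * |G k X V|) ≤ M := by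
    refine le_trans ?_ ((le_iSup₂ (f := fun (k : ℕ) (_ : 1 ≤ k) =>
      ENNReal.ofReal (Real.exp (μ * k)) * densityNorm p q α β (G k)) k hk).trans h)
    gcongr
    exact le_iSup₂ (f := fun (X V : Config d k) =>
      ENNReal.ofReal (bracketProd (α • X) ^ p * bracketProd (β • V) ^ q * |G k X V|)) X V
  have hA : 0 < bracketProd (α • X) := Finset.prod_pos fun i _ => bracket_pos _
  have hB : 0 < bracketProd (β • V) := Finset.prod_pos fun i _ => bracket_pos _
  have hprod : ∏ i, ENNReal.ofReal (weight p q α β (X i) (V i)) =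
      ENNReal.ofReal (bracketProd (α • X) ^ (-p) * bracketProd (β • V) ^ (-q)) := by
    rw [← ENNReal.ofReal_prod_of_nonneg fun i _ => (weight_pos _ _ _ _ _ _).le]
    congr 1
    unfold weight bracketProd
    rw [Finset.prod_mul_distrib, Real.finsetProd_rpow _ _ fun i _ => (bracket_pos _).le,
      Real.finsetProd_rpow _ _ fun i _ => (bracket_pos _).le]
    rfl
  rw [hprod, ← ENNReal.ofReal_pow (Real.exp_pos _).le]
  refine le_trans (le_of_eq ?_) (mul_le_mul' (mul_le_mul' h1 le_rfl) le_rfl)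
  rw [← ENNReal.ofReal_mul (Real.exp_pos _).le, ← ENNReal.ofReal_mul (by positivity),
    ← ENNReal.ofReal_mul (by positivity), Real.enorm_eq_ofReal_abs]
  congr 1
  rw [Real.rpow_neg hA.le, Real.rpow_neg hB.le, ← Real.exp_nat_mul]
  have he : Real.exp (μ * k) * Real.exp (k * -μ) = 1 := by
    rw [← Real.exp_add]; ring_nf; simp
  calc |G k X V| = (Real.exp (μ * k) * Real.exp (k * -μ)) * |G k X V| := by rw [he, one_mul]
    _ = _ := by field_simp

/-- Continuity bounds the norm near each time, and finitely many such neighbourhoods cover `[0,T]`.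
-/
lemma MemTimeSpace.exists_bound {p q α β μ T : ℝ} {G : ℝ → DensitySeq d}
    (hG : MemTimeSpace p q α β μ T G) :
    ∃ M : ℝ≥0∞, M ≠ ∞ ∧ ∀ t ∈ Icc (0 : ℝ) T, ∀ k, 1 ≤ k → ∀ X V : Config d k,
      ‖G t k X V‖ₑ ≤ M * ENNReal.ofReal (Real.exp (-μ)) ^ k *
        ∏ i, ENNReal.ofReal (weight p q α β (X i) (V i)) := by
  refine isCompact_Icc.induction_on (p := fun S => ∃ M : ℝ≥0∞, M ≠ ∞ ∧ ∀ t ∈ S, ∀ k, 1 ≤ k →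
      ∀ X V : Config d k, ‖G t k X V‖ₑ ≤ M * ENNReal.ofReal (Real.exp (-μ)) ^ k *
        ∏ i, ENNReal.ofReal (weight p q α β (X i) (V i))) ⟨0, by simp, by simp⟩ ?_ ?_ ?_
  · rintro S S' hSS' ⟨M, hM, h⟩
    exact ⟨M, hM, fun t ht => h t (hSS' ht)⟩
  · rintro S S' ⟨M, hM, h⟩ ⟨M', hM', h'⟩
    refine ⟨M + M', ENNReal.add_ne_top.2 ⟨hM, hM'⟩, fun t ht k hk X V => ?_⟩
    rcases ht with ht | ht
    · refine (h t ht k hk X V).trans ?_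
      gcongr
      exact le_self_add
    · refine (h' t ht k hk X V).trans ?_
      gcongr
      exact le_add_self
  · intro t₀ ht₀
    have h0 := (hG.mem t₀ ht₀).norm_lt_top
    have h1 : ∀ᶠ t in 𝓝[Icc (0 : ℝ) T] t₀, seqNorm p q α β μ (G t - G t₀) ≤ 1 :=
      (hG.continuous t₀ ht₀).eventually_le_const one_pos
    refine ⟨_, h1, 1 + seqNorm p q α β μ (G t₀), by finiteness, fun t ht k hk X V => ?_⟩
    have h2 := enorm_le_of_seqNorm_le (Set.mem_ofPred_eq ▸ ht) hk X V
    have h3 := enorm_le_of_seqNorm_le (le_refl (seqNorm p q α β μ (G t₀))) hk X V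
    calc ‖G t k X V‖ₑ = ‖(G t - G t₀) k X V + G t₀ k X V‖ₑ := by
          simp only [Pi.sub_apply, sub_add_cancel]
      _ ≤ _ := enorm_add_le _ _
      _ ≤ _ := add_le_add h2 h3
      _ = _ := by ring

lemma lintegral_collisionRate_lt_top (hd : 3 ≤ d) {γ p q α β N : ℝ}
    (hγ : γ ∈ Ioc (1 - (d : ℝ)) 1) {b : ℝ → ℝ} (hbm : Measurable b) (hb0 : ∀ x, 0 ≤ b x)
    (hbN : ∀ x, b x ≤ N) (hp : 1 < p) (hq : max ((d : ℝ) - 1 + γ) ((d : ℝ) - 1) < q)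
    (hα : 0 < α) (hβ : 0 < β) {I : Set ℝ} {τ : ℝ} (hτ : 0 ≤ τ)
    (hI : volume I ≤ ENNReal.ofReal τ) (x v : E d) :
    ∫⁻ s in I, collisionRate γ b p q α β s x v < ∞ := by
  have hd' : (3 : ℝ) ≤ d := by exact_mod_cast hd
  have hq0 : 0 ≤ q := by linarith [(le_max_right _ _).trans_lt hq]
  refine (lintegral_collisionRate_le hd hbm hb0 hbN hp hq0 hα hβ hτ (le_refl 0)
    zero_le_one hI x v).trans_lt ?_
  rw [add_zero]
  have h1 := velocitySup_lt_top hd hγ hq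
  have h2 := lossSup_lt_top hγ hq hq0
  finiteness

/-- Over time intervals of a fixed length, the integrated collision rate is bounded by a constant
below the threshold of the theorem. -/
lemma exists_collisionRate_const (hd : 3 ≤ d) {γ p q α β μ U : ℝ}
    (hγ : γ ∈ Ioc (1 - (d : ℝ)) 1) {b b' : ℝ → ℝ} (hbm : Measurable b') (hb0 : ∀ x, 0 ≤ b' x)
    (hbN : ∀ x, b' x ≤ angularNorm b) (hp : 1 < p)
    (hq : max ((d : ℝ) - 1 + γ) ((d : ℝ) - 1) < q) (hα : 0 < α) (hβ : 0 < β)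
    (hU : velocitySup d γ q ≤ ENNReal.ofReal U)
    (hμ : 4 * hierarchyConst p q α β U b < Real.exp μ) :
    ∃ C, 0 ≤ C ∧ 4 * C < Real.exp μ ∧ ∃ τ > 0, ∀ I : Set ℝ, volume I ≤ ENNReal.ofReal τ →
      ∀ x v : E d, ∫⁻ s in I, collisionRate γ b' p q α β s x v ≤
        ENNReal.ofReal C * ENNReal.ofReal (weight p q α β x v) := by
  have hμ0 := Real.exp_pos μ
  rcases hγ.2.lt_or_eq with h1 | rfl
  · exact ⟨Real.exp μ / 8, by positivity, by linarith, exists_time_collisionRate_le hd hγ.1 h1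
      hbm hb0 hbN hp hq hα hβ (by positivity)⟩
  · have hp1 : 0 < p - 1 := by linarith
    have hN : 0 ≤ angularNorm b := ENNReal.toReal_nonneg
    have hM : 0 ≤ max (β ^ q) (β ^ (-2 * q)) := le_max_of_le_left (by positivity)
    have hU0 : 0 ≤ max U 0 := le_max_right _ _
    -- `ENNReal.ofReal` truncates a negative `U` to 0, so `max U 0` is the effective bound. The
    -- length 1 is arbitrary, since the hard-sphere rate does not depend on it.
    refine ⟨hierarchyConst p q α β (max U 0) b, ?_, ?_, 1, one_pos, fun I hI x v =>
      lintegral_collisionRate_one_le hd hbm hb0 hbN hp ?_ hα hβ hU zero_le_one hI x v⟩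
    · unfold hierarchyConst
      positivity
    · rcases le_total 0 U with hU0 | hU0
      · rwa [max_eq_left hU0]
      · rw [max_eq_right hU0]
        simpa [hierarchyConst] using hμ0
    · linarith [(le_max_left _ _).trans_lt hq]

/-! ### Uniqueness on the whole time interval -/

lemma transport_zero {k : ℕ} (s : ℝ) : transport s (0 : Density d k) = 0 := rfl

lemma transport_sub {k : ℕ} (s : ℝ) (f g : Density d k) :
    transport s (f - g) = transport s f - transport s g := rfl

lemma collision_zero (γ : ℝ) (b : ℝ → ℝ) {k : ℕ} :
    collision γ b (0 : Density d (k + 1)) = 0 := by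
  ext X V
  simp [collision, gain, loss]

/-- The integral inequality satisfied by the difference of two mild solutions. -/
lemma IsMildSolution.enorm_sub_le {γ p q α β μ T : ℝ} {b b' : ℝ → ℝ} (hd : 2 ≤ d)
    (hbm : Measurable b') (hb0 : ∀ x, 0 ≤ b' x)
    (hbb : volume {x | x ∈ Icc (-1 : ℝ) 1 ∧ b x ≠ b' x} = 0)
    (hrate : ∀ x v : E d, ∫⁻ s in Ioc 0 T, collisionRate γ b' p q α β s x v < ∞)
    {F₀ : DensitySeq d} {F G : TimeDensitySeq d} (hF : IsMildSolution γ b p q α β μ T F₀ F)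
    (hG : IsMildSolution γ b p q α β μ T F₀ G) {k : ℕ} (hk : 1 ≤ k) {t : ℝ}
    (ht : t ∈ Icc 0 T) (X V : Config d k) :
    ‖transport (-t) (F k t - G k t) X V‖ₑ ≤
      ∫⁻ s in Ioc 0 t, ‖transport (-s) (collision γ b' (F (k + 1) s - G (k + 1) s)) X V‖ₑ := by
  have hT : (0 : ℝ) ≤ T := ht.1.trans ht.2
  have hsub : Ioc 0 t ⊆ Icc 0 T := fun s hs => ⟨hs.1.le, hs.2.trans ht.2⟩
  obtain ⟨MF, hMF, hMF'⟩ := hF.transported_mem.exists_bound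
  obtain ⟨MG, hMG, hMG'⟩ := hG.transported_mem.exists_bound
  -- Solutions are measurable only on `[0,T]`; composing with the projection onto `[0,T]` gives
  -- functions measurable for all times with the same values where they matter.
  have hproj : ∀ H : TimeDensitySeq d, ∀ s ∈ Ioc 0 t,
      H (k + 1) (projIcc 0 T hT s) = H (k + 1) s := fun H s hs => by
    rw [projIcc_of_mem hT (hsub hs)]
  have hmeas : ∀ H : TimeDensitySeq d, IsMildSolution γ b p q α β μ T F₀ H →
      Measurable fun z : ℝ × Config d (k + 1) × Config d (k + 1) =>
        H (k + 1) (projIcc 0 T hT z.1) z.2.1 z.2.2 := fun H hH =>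
    (hH.measurable (k + 1) (by omega)).comp
      (((continuous_projIcc (h := hT)).measurable.comp measurable_fst).prodMk measurable_snd)
  have heq : ∀ H : TimeDensitySeq d, IsMildSolution γ b p q α β μ T F₀ H →
      transport (-t) (H k t) X V = F₀ k X V + ∫ s in Ioc 0 t,
        transport (-s) (collision γ b' (H (k + 1) (projIcc 0 T hT s))) X V := fun H hH => by
    rw [hH.mild_eq t ht k hk X V, intervalIntegral.integral_of_le ht.1]
    congr 1
    refine setIntegral_congr_fun measurableSet_Ioc fun s hs => ?_
    simp only [hproj H s hs, collision_congr_angular hd γ hbb]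
  have main := enorm_integral_collision_sub_le (γ := γ) (p := p) (q := q) (α := α) (β := β)
    (f := fun s => F (k + 1) (projIcc 0 T hT s)) (g := fun s => G (k + 1) (projIcc 0 T hT s)) hbm hb0
    (hmeas F hF) (hmeas G hG)
    (measurableSet_Ioc (a := (0 : ℝ)) (b := t))
    (fun x v => (lintegral_mono_set (Ioc_subset_Ioc_right ht.2)).trans_lt (hrate x v))
    (c := (MF + MG) * ENNReal.ofReal (Real.exp (-μ)) ^ (k + 1)) (by finiteness)
    (fun s hs X V => by
      rw [hproj F s hs]
      refine (hMF' s (hsub hs) (k + 1) (by omega) X V).trans ?_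
      gcongr
      exact le_self_add)
    (fun s hs X V => by
      rw [hproj G s hs]
      refine (hMG' s (hsub hs) (k + 1) (by omega) X V).trans ?_
      gcongr
      exact le_add_self) X V
  rw [transport_sub, Pi.sub_apply, Pi.sub_apply, heq F hF, heq G hG, add_sub_add_left_eq_sub]
  refine main.trans (le_of_eq (setLIntegral_congr_fun measurableSet_Ioc fun s hs => ?_))
  simp only [hproj F s hs, hproj G s hs]

/-- Vanishing of a bounded sequence satisfying the hierarchy inequality from time zero. -/
lemma eq_zero_of_hierarchy_inequality_of_rate {γ : ℝ} {b : ℝ → ℝ} (hbm : Measurable b)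
    (hb0 : ∀ x, 0 ≤ b x) {p q α β τ T : ℝ} (hτ : 0 < τ) {h : TimeDensitySeq d}
    {M lam θ C : ℝ≥0∞} (hM : M ≠ ∞) (hlam : lam ≠ ∞) (hθ : θ < 1) (hC : 4 * lam * C ≤ 1)
    (hrate : ∀ I : Set ℝ, volume I ≤ ENNReal.ofReal τ → ∀ x v : E d,
      ∫⁻ s in I, collisionRate γ b p q α β s x v ≤ C * ENNReal.ofReal (weight p q α β x v))
    (hbound : ∀ k, 1 ≤ k → ∀ t ∈ Icc 0 T, ∀ X V, ‖transport (-t) (h k t) X V‖ₑ ≤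
      M * (θ * lam) ^ k * ∏ i, ENNReal.ofReal (weight p q α β (X i) (V i)))
    (hmild : ∀ k, 1 ≤ k → ∀ t ∈ Icc 0 T, ∀ X V, ‖transport (-t) (h k t) X V‖ₑ ≤
      ∫⁻ s in Ioc 0 t, ‖transport (-s) (collision γ b (h (k + 1) s)) X V‖ₑ) :
    ∀ k, 1 ≤ k → ∀ t ∈ Icc 0 T, h k t = 0 := by
  -- Advance by intervals of length `τ`: once `h` vanishes up to `n * τ`, the inequality holds with
  -- initial time `n * τ`, and the admissible length is the same at every step.
  have step : ∀ n : ℕ, ∀ k, 1 ≤ k → ∀ t ∈ Icc 0 T, t ≤ n * τ → h k t = 0 := by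
    intro n
    induction n with
    | zero =>
      intro k hk t ht htn
      obtain rfl : t = 0 := le_antisymm (by simpa using htn) ht.1
      ext X V
      have := hmild k hk 0 ht X V
      simpa [transport] using this
    | succ n ih =>
      intro k hk t ht htn
      rcases le_or_gt t (n * τ) with hle | hlt
      · exact ih k hk t ht hle
      have hnτ : 0 ≤ n * τ := by positivity
      have hmem : ∀ s ∈ Ioc (n * τ) t, s ∈ Icc 0 T := fun s hs =>
        ⟨hnτ.trans hs.1.le, hs.2.trans ht.2⟩
      refine eq_zero_of_hierarchy_inequality (t₀ := n * τ) (t₁ := t) hbm hb0 hM hlam hθ hC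
        (hrate _ ?_) (fun k hk s hs => hbound k hk s (hmem s hs)) (fun k hk s hs X V => ?_)
        k hk t ⟨hlt, le_rfl⟩
      · rw [Real.volume_Ioc]
        apply ENNReal.ofReal_le_ofReal
        push_cast at htn
        linarith
      · refine (hmild k hk s (hmem s hs) X V).trans (le_of_eq ?_)
        rw [← Ioc_union_Ioc_eq_Ioc hnτ hs.1.le, lintegral_union measurableSet_Ioc
          (Set.disjoint_left.2 fun r hr hr' => not_lt.2 hr.2 hr'.1)]
        have h0 : ∫⁻ r in Ioc 0 (n * τ),
            ‖transport (-r) (collision γ b (h (k + 1) r)) X V‖ₑ = 0 := by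
          rw [setLIntegral_congr_fun (g := fun _ => 0) measurableSet_Ioc fun r hr => ?_]
          · simp
          · simp only
            rw [ih (k + 1) (by omega) r ⟨hr.1.le, (hr.2.trans hs.1.le).trans (hmem s hs).2⟩ hr.2,
              collision_zero, transport_zero]
            simp
        rw [h0, zero_add]
  intro k hk t ht
  obtain ⟨n, hn⟩ := exists_nat_ge (t / τ)
  exact step n k hk t ht ((div_le_iff₀ hτ).1 hn)

theorem IsMildSolution.eq (hd : 3 ≤ d) {γ p q α β μ T U : ℝ} (hγ : γ ∈ Ioc (1 - (d : ℝ)) 1)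
    (hq : max ((d : ℝ) - 1 + γ) ((d : ℝ) - 1) < q) {b : ℝ → ℝ} (hb : IsAngularCrossSection b)
    (hU : velocitySup d γ q ≤ ENNReal.ofReal U) (hp : 1 < p) (hα : 0 < α)
    (hβ : 0 < β) (hμ : 4 * hierarchyConst p q α β U b < Real.exp μ)
    {F₀ : DensitySeq d} {F G : TimeDensitySeq d} (hF : IsMildSolution γ b p q α β μ T F₀ F)
    (hG : IsMildSolution γ b p q α β μ T F₀ G) {k : ℕ} (hk : 1 ≤ k) {t : ℝ} (ht : t ∈ Icc 0 T) :
    F k t = G k t := by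
  have hT : (0 : ℝ) ≤ T := ht.1.trans ht.2
  obtain ⟨b', hbm, hb0, hbN, hbb⟩ := exists_measurable_representative hb
  obtain ⟨C, hC0, hCμ, τ, hτ, hrate⟩ := exists_collisionRate_const hd hγ hbm hb0 hbN hp hq hα hβ
    hU hμ
  obtain ⟨MF, hMF, hMF'⟩ := hF.transported_mem.exists_bound
  obtain ⟨MG, hMG, hMG'⟩ := hG.transported_mem.exists_bound
  -- Strictness of `4C < e^μ` is spent here: `λ = 1/m` and `θ = m e^{-μ}` satisfy `4λC ≤ 1`, `θ < 1`
  -- and `θλ = e^{-μ}`.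
  obtain ⟨m, hm, hmμ⟩ := exists_between hCμ
  have hm0 : 0 < m := by linarith
  have hθ : ENNReal.ofReal (Real.exp (-μ) * m) < 1 := by
    rw [ENNReal.ofReal_lt_one, Real.exp_neg, inv_mul_lt_one₀ (Real.exp_pos μ)]
    exact hmμ
  have hθlam : ENNReal.ofReal (Real.exp (-μ) * m) * ENNReal.ofReal (1 / m) =
      ENNReal.ofReal (Real.exp (-μ)) := by
    rw [← ENNReal.ofReal_mul (by positivity)]
    congr 1
    field_simp
  have h4 : 4 * ENNReal.ofReal (1 / m) * ENNReal.ofReal C ≤ 1 := by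
    rw [show (4 : ℝ≥0∞) = ENNReal.ofReal 4 by norm_num, ← ENNReal.ofReal_mul (by norm_num),
      ← ENNReal.ofReal_mul (by positivity), ENNReal.ofReal_le_one, mul_one_div, div_mul_eq_mul_div,
      div_le_one hm0]
    exact hm.le
  rw [← sub_eq_zero]
  refine eq_zero_of_hierarchy_inequality_of_rate hbm hb0 hτ (h := fun k t => F k t - G k t)
    (M := MF + MG) (by finiteness) ENNReal.ofReal_ne_top hθ h4 hrate (fun k hk t ht X V => ?_)
    (fun k hk t ht X V => hF.enorm_sub_le (by omega) hbm hb0 hbb (fun x v =>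
      lintegral_collisionRate_lt_top hd hγ hbm hb0 hbN hp hq hα hβ hT (by simp) x v) hG hk ht X V)
    k hk t ht
  rw [hθlam, transport_sub, Pi.sub_apply, Pi.sub_apply]
  calc _ ≤ _ := _root_.enorm_sub_le
    _ ≤ _ := add_le_add (hMF' t ht k hk X V) (hMG' t ht k hk X V)
    _ = _ := by ring

/-! ### The zero solution -/

lemma seqNorm_eq_zero {p q α β μ : ℝ} {G : DensitySeq d} (hG : ∀ k, 1 ≤ k → G k = 0) :
    seqNorm p q α β μ G = 0 := by
  unfold seqNorm
  simp only [ENNReal.iSup_eq_zero]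
  intro k hk
  simp [densityNorm, hG k hk]

lemma memSeqSpace_of_eq_zero {p q α β μ : ℝ} {G : DensitySeq d} (hG : ∀ k, 1 ≤ k → G k = 0) :
    MemSeqSpace p q α β μ G where
  mem k hk := by
    rw [hG k hk]
    exact ⟨measurable_const, fun _ _ _ => rfl, by simp [densityNorm]⟩
  norm_lt_top := by simp [seqNorm_eq_zero hG]

lemma isMildSolution_of_eq_zero {γ p q α β μ T : ℝ} (b : ℝ → ℝ) {F : TimeDensitySeq d}
    (hF : ∀ k, 1 ≤ k → ∀ t ∈ Icc (0 : ℝ) T, F k t = 0) :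
    IsMildSolution γ b p q α β μ T (0 : DensitySeq d) F where
  initial_mem := memSeqSpace_of_eq_zero fun _ _ => rfl
  measurable k hk := by
    simp only [fun z : Icc (0 : ℝ) T × Config d k × Config d k => hF k hk z.1 z.1.2]
    exact measurable_const
  transported_mem := by
    refine ⟨fun t ht => memSeqSpace_of_eq_zero fun k hk => ?_, fun t₀ ht₀ => ?_⟩
    · rw [hF k hk t ht, transport_zero]
    · refine tendsto_const_nhds.congr' ?_
      filter_upwards [self_mem_nhdsWithin] with t ht
      refine (seqNorm_eq_zero fun k hk => ?_).symm
      simp only [Pi.sub_apply]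
      rw [hF k hk t ht, hF k hk t₀ ht₀, transport_zero, transport_zero, sub_zero]
  mild_eq t ht k hk X V := by
    rw [hF k hk t ht, intervalIntegral.integral_of_le ht.1,
      setIntegral_congr_fun (g := fun _ => 0) measurableSet_Ioc fun s hs => ?_]
    · simp [transport]
    · simp only
      rw [hF (k + 1) (by omega) s ⟨hs.1.le, hs.2.trans ht.2⟩, collision_zero, transport_zero]
      rfl

end BoltzmannHierarchy

end

open BoltzmannHierarchy in
/-- Uniqueness of mild `μ`-solutions of the Boltzmann hierarchy. The first clause says that the
velocity integral has a finite bound `U_q`; the other two hold for every such bound `U`. -/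
theorem mainTheorem1 (d : ℕ) (hd : 3 ≤ d) (γ : ℝ) (hγ : γ ∈ Set.Ioc (1 - (d : ℝ)) 1)
    (q : ℝ) (hq : max ((d : ℝ) - 1 + γ) ((d : ℝ) - 1) < q) :
    velocitySup d γ q < ⊤ ∧
    ∀ (b : ℝ → ℝ) (_ : IsAngularCrossSection b)
      (U : ℝ) (_ : velocitySup d γ q ≤ ENNReal.ofReal U)
      (T p α β μ : ℝ) (_ : 0 < T) (_ : 1 < p) (_ : 0 < α) (_ : 0 < β)
      (_ : 4 * hierarchyConst p q α β U b < Real.exp μ),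
      (∀ (F₀ : DensitySeq d) (F G : TimeDensitySeq d),
        MemSeqSpace p q α β μ F₀ →
        IsMildSolution γ b p q α β μ T F₀ F →
        IsMildSolution γ b p q α β μ T F₀ G →
        ∀ k, 1 ≤ k → ∀ t ∈ Set.Icc (0 : ℝ) T, F k t = G k t) ∧
      (∀ F : TimeDensitySeq d,
        IsMildSolution γ b p q α β μ T (0 : DensitySeq d) F ↔
          ∀ k, 1 ≤ k → ∀ t ∈ Set.Icc (0 : ℝ) T, F k t = 0) := by
  refine ⟨velocitySup_lt_top hd hγ hq, fun b hb U hU T p α β μ _ hp hα hβ hμ => ?_⟩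
  have key : ∀ (F₀ : DensitySeq d) (F G : TimeDensitySeq d),
      IsMildSolution γ b p q α β μ T F₀ F → IsMildSolution γ b p q α β μ T F₀ G →
      ∀ k, 1 ≤ k → ∀ t ∈ Set.Icc (0 : ℝ) T, F k t = G k t := fun F₀ F G hF hG k hk t ht =>
    hF.eq hd hγ hq hb hU hp hα hβ hμ hG hk ht
  refine ⟨fun F₀ F G _ => key F₀ F G, fun F => ⟨fun hF k hk t ht => ?_, fun hF => ?_⟩⟩
  -- The zero family is itself a mild solution with zero data, so uniqueness applies to the pair
  -- `F`, `0`.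
  · exact key 0 F 0 hF (isMildSolution_of_eq_zero b fun _ _ _ _ => rfl) k hk t ht
  · exact isMildSolution_of_eq_zero b hF
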